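/- Let $d\ge 0$, $I=\{+,z,-\}$, with involution $\overline{(\pm)}=\mp$, $\overline z=z$. Let $\tilde\epsilon_{\pm\mp z}=\pm1$, $\tilde\epsilon_{\pm z\pm}=\mp1$, $\tilde\epsilon_{z\pm\pm}=\pm1$, and $\tilde\epsilon_{ijk}=0$ otherwise. For a vector $M\in\mathbb R^3$ write $M_\pm=(M_1\pm iM_2)/\sqrt2$, $M_z=M_3$. Multi-indices are finitely supported $\alpha\in\mathbb N^{I\times\mathbb Z^d}$; $|\alpha(x)|=\sum_{i\in I}\alpha_i(x)$, $|\alpha|=\sum_x|\alpha(x)|$, $\overline\alpha_i(x)=\alpha_{\bar i}(x)$, and $M^\alpha=\prod_{x,i}M_i(x)^{\alpha_i(x)}$. Let $V$ assign to each multi-index a complex number such that $\overline{V(\alpha)}=V(\overline\alpha)$ and $$\|V\|=\sum_{n\in\mathbb N}\ \sup_{x\in\mathbb Z^d}\sum_{|\alpha|=n}|\alpha(x)|\,|V(\alpha)|\,e^n<\infty .$$ Let $\mathfrak P=\mathbb C[\{M_i(x): i\in I,\ x\in\mathbb Z^d\}]$. Classical evolution. For $M_0:\mathbb Z^d\to\mathbb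 S^2$, $M:\mathbb R\times\mathbb Z^d\to\mathbb S^2$ denotes the solution, continuously differentiable in $t$ with respect to the $l^\infty$-norm, of $$\frac{d}{dt}M_i(t,x)=\sum_{\alpha}V(\alpha)\sum_{j,k\in I} i\,\tilde\epsilon_{jik}\,\alpha_j(x)\,M^{\alpha-\delta_j(x)+\delta_k(x)}(t),\qquad M(0,x)=M_0(x),$$ where $\delta_i(x)$ is the multi-index equal to $1$ at $(i,x)$ and $0$ elsewhere. Quantum evolution. For $s\in\frac12\mathbb N$, $s>0$, and finite $\Lambda\subset\mathbb Z^d$ let $\widehat{\mathfrak A}_\Lambda$ be the algebra of operators on $\bigotimes_{x\in\Lambda}\mathbb C^{2s+1}$ with the operator norm, $\widehat{\mathfrak A}_{\Lambda_1}\subset\widehat{\mathfrak A}_{\Lambda_2}$ for $\Lambda_1\subset\Lambda_2$ through $\mathcal A\mapsto\mathcal A\otimes 1$, and let $\widehat{\mathfrak A}$ be the norm completion of $\bigcup_\Lambda\widehat{\mathfrak A}_\Lambda$. Let $S_1,S_2,S_3$ be the generators of the spin-$s$ representation of $su(2)$, $S_\pm=(S_1\pm iS_2)/\sqrt2$, $S_z=S_3$,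 and let $\widehat S_i(x)$ be $s^{-1}S_i$ acting at the site $x$. Quantization $A\mapsto\widehat A$ is the linear map $\mathfrak P\to\widehat{\mathfrak A}$ replacing each $M_i(x)$ in a monomial by $\widehat S_i(x)$ and ordering all $\widehat S_+$ to the left of all $\widehat S_z$, and these to the left of all $\widehat S_-$; $\widehat 1=1$. Put $\widehat H_\Lambda=\sum_{\alpha\in\mathbb N^{I\times\Lambda}}V(\alpha)\widehat{M^\alpha}$, $\widehat\alpha^t_\Lambda\mathcal A=e^{is\widehat H_\Lambda t}\mathcal A\,e^{-is\widehat H_\Lambda t}$, and $\widehat\alpha^t\mathcal A=\lim_{\Lambda\to\mathbb Z^d}\widehat\alpha^t_\Lambda\mathcal A$ in norm, along the directed set of finite subsets. Coherent states. For $m\in\mathbb S^2$ with polar angles $(\theta,\varphi)$ let $|m\rangle=\exp\big(\tfrac{\theta}{\sqrt2}[e^{i\varphi}S_--e^{-i\varphi}S_+]\big)|s\rangle\in\mathbb C^{2s+1}$, where $S_z|s\rangle=s|s\rangle$, $\||s\rangle\|=1$. For $M_0:\mathbb Z^d\to\mathbb S^2$ let $\rho_{M_0}$ be the continuous extension to $\widehat{\mathfrak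 A}$ of $\mathcal A\mapsto\langle M_\Lambda,\mathcal A M_\Lambda\rangle$, $\mathcal A\in\widehat{\mathfrak A}_\Lambda$, with $|M_\Lambda\rangle=\bigotimes_{x\in\Lambda}|M_0(x)\rangle$. Theorem. The norm limits $\widehat\alpha^t\widehat A$ exist for all $A\in\mathfrak P$, $t\in\mathbb R$ and $s$, the classical solution $M$ exists and is unique for every $M_0$, and for all $A\in\mathfrak P$ and $M_0:\mathbb Z^d\to\mathbb S^2$ $$\lim_{s\to\infty}\rho_{M_0}(\widehat\alpha^t\widehat A)=A(M(t)),$$ uniformly in $t$ on compact time intervals. Moreover, for every $A\in\mathfrak P$ and every $T$ with $T\|V\|<1$ there is a constant $C$, independent of $s$ and of $M_0$, such that $$\big|\rho_{M_0}(\widehat\alpha^t\widehat A)-A(M(t))\big|\le\frac{C}{\sqrt s}\qquad\text{for all }|t|\le T\text{ and all }s .$$ -/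

import Mathlib

open Filter Topology
open scoped Matrix.Norms.L2Operator ENNReal

noncomputable section

namespace SpinSystem

/-! ### Lattice, ladder indices, structure constants, multi-indices -/

/-- The sites of the lattice `ℤ^d`. -/
abbrev Site (d : ℕ) : Type := Fin d → ℤ

/-- The index set `I = {+, z, -}`. -/
inductive Ladder : Type
  | plus
  | z
  | minus
  deriving DecidableEq

instance : Fintype Ladder := ⟨{.plus, .z, .minus}, fun i => by cases i <;> decide⟩

/-- The involution `(+, z, -) ↦ (-, z, +)`. -/
def Ladder.conj : Ladder → Ladder
  | .plus => .minus
  | .z => .z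
  | .minus => .plus

/-- The symbol `ε̃ i j k`: `ε̃(±,∓,z) = ±1`, `ε̃(±,z,±) = ∓1`, `ε̃(z,±,±) = ±1`, and `0` otherwise. -/
def epsTilde : Ladder → Ladder → Ladder → ℂ
  | .plus, .minus, .z => 1
  | .minus, .plus, .z => -1
  | .plus, .z, .plus => -1
  | .minus, .z, .minus => 1
  | .z, .plus, .plus => 1
  | .z, .minus, .minus => -1
  | _, _, _ => 0

/-- Multi-indices `α ∈ ℕ^{I × ℤ^d}` with `|α| < ∞`. -/
abbrev MultiIndex (d : ℕ) : Type := (Site d × Ladder) →₀ ℕ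

/-- `|α(x)| = ∑_i α_i(x)`. -/
def siteDegree {d : ℕ} (α : MultiIndex d) (x : Site d) : ℕ := ∑ i : Ladder, α (x, i)

/-- The conjugate multi-index, `(conj α)_i(x) = α_{conj i}(x)`. -/
def conjIndex {d : ℕ} (α : MultiIndex d) : MultiIndex d :=
  α.mapDomain fun p => (p.1, p.2.conj)

/-- The finite set of sites on which `α` does not vanish. -/
def sites {d : ℕ} (α : MultiIndex d) : Finset (Site d) := α.support.image Prod.fst

/-! ### Interaction potentials -/

/-- `‖V‖ = ∑_n sup_x ∑_{|α| = n} |α(x)| |V(α)| e^n`, as an extended nonnegative number. -/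
def potentialENorm {d : ℕ} (V : MultiIndex d → ℂ) : ℝ≥0∞ :=
  ∑' n : ℕ, ⨆ x : Site d, ∑' α : {α : MultiIndex d // α.degree = n},
    ENNReal.ofReal (siteDegree α.1 x * ‖V α.1‖ * Real.exp n)

/-- The real number `‖V‖`, meaningful when `potentialENorm V` is finite. -/
def potentialNorm {d : ℕ} (V : MultiIndex d → ℂ) : ℝ := (potentialENorm V).toReal

/-- An admissible interaction potential: the Hamilton functions are real, and `‖V‖ < ∞`. -/
structure IsPotential {d : ℕ} (V : MultiIndex d → ℂ) : Prop where
  conj_eq : ∀ α, V (conjIndex α) = (starRingEnd ℂ) (V α)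
  norm_lt_top : potentialENorm V < ⊤

/-! ### Classical spins -/

/-- Euclidean three-space. -/
abbrev Vec3 : Type := EuclideanSpace ℝ (Fin 3)

/-- The complex coordinates `M_± = (M_1 ± i M_2)/√2`, `M_z = M_3` of a vector. -/
def ladderCoord (v : Vec3) : Ladder → ℂ
  | .plus => ((v 0 : ℂ) + Complex.I * (v 1 : ℂ)) / (Real.sqrt 2 : ℂ)
  | .z => (v 2 : ℂ)
  | .minus => ((v 0 : ℂ) - Complex.I * (v 1 : ℂ)) / (Real.sqrt 2 : ℂ)

/-- The monomial `M^α` evaluated at a configuration. -/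
def classicalMonomial {d : ℕ} (m : Site d → Vec3) (α : MultiIndex d) : ℂ :=
  α.prod fun p n => ladderCoord (m p.1) p.2 ^ n

/-- The algebra `𝔓` of complex polynomials in the variables `M_i(x)`, `x ∈ ℤ^d`, `i ∈ I`. -/
abbrev PolyObs (d : ℕ) : Type := MvPolynomial (Site d × Ladder) ℂ

/-- The value `A(m)` of a polynomial observable at a configuration. -/
def PolyObs.evalAt {d : ℕ} (A : PolyObs d) (m : Site d → Vec3) : ℂ :=
  MvPolynomial.eval (fun p => ladderCoord (m p.1) p.2) A

/-- The right-hand side of the Hamiltonian equation of motion on `ℤ^d`,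
`∑_α V(α) ∑_{j,k} i ε̃_{jik} α_j(x) M^{α - δ_j(x) + δ_k(x)}`. -/
def hamiltonField {d : ℕ} (V : MultiIndex d → ℂ) (m : Site d → Vec3) (x : Site d) (i : Ladder) :
    ℂ :=
  ∑' α : MultiIndex d, V α * ∑ j : Ladder, ∑ k : Ladder,
    Complex.I * epsTilde j i k * (α (x, j) : ℂ) *
      classicalMonomial m (α - Finsupp.single (x, j) 1 + Finsupp.single (x, k) 1)

/-- `M : ℝ × ℤ^d → S²` is a global solution, continuously differentiable in time for the `l^∞`-norm,
of the Hamiltonian equation of motion on `ℤ^d` with initial configuration `M₀`. -/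
structure IsHamiltonianEvolution {d : ℕ} (V : MultiIndex d → ℂ)
    (M₀ : Site d → Metric.sphere (0 : Vec3) 1)
    (M : ℝ → lp (fun _ : Site d => Vec3) ∞) : Prop where
  contDiff : ContDiff ℝ 1 M
  initial : ∀ x, M 0 x = M₀ x
  norm_eq_one : ∀ t x, ‖M t x‖ = 1
  hasDerivAt : ∀ t x i,
    HasDerivAt (fun τ : ℝ => ladderCoord (M τ x) i) (hamiltonField V (M t) x i) t

/-! ### Local algebras of quantum spins

The spin is `s = N / 2` with `N = 2s` a natural number; `ℂ^{2s+1}` has the orthonormal basis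
`|0⟩, …, |N⟩` in which `S_3 |k⟩ = (s - k) |k⟩`. -/

/-- Operators on the space `ℂ^{2s+1}` of a single spin. -/
abbrev SpinMat (N : ℕ) : Type := Matrix (Fin (N + 1)) (Fin (N + 1)) ℂ

/-- The algebra `𝔄_Λ` of operators on `⨂_{x ∈ Λ} ℂ^{2s+1}`, written as matrices in the product
basis, with the operator norm. -/
abbrev LocalAlgebra {d : ℕ} (N : ℕ) (Λ : Finset (Site d)) : Type :=
  Matrix (Λ → Fin (N + 1)) (Λ → Fin (N + 1)) ℂ

section Embedding

variable {d : ℕ} {N : ℕ} {Λ₁ Λ₂ : Finset (Site d)}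

/-- Split a basis label of `Λ₂` into its parts on `Λ₁` and on `Λ₂ \ Λ₁`. -/
def splitConfig (N : ℕ) (h : Λ₁ ⊆ Λ₂) :
    (Λ₂ → Fin (N + 1)) ≃
      (Λ₁ → Fin (N + 1)) × ({y : Λ₂ // (y : Site d) ∉ Λ₁} → Fin (N + 1)) where
  toFun σ := (fun x => σ ⟨x, h x.2⟩, fun y => σ y)
  invFun p := fun y => if hy : (y : Site d) ∈ Λ₁ then p.1 ⟨y, hy⟩ else p.2 ⟨y, hy⟩
  left_inv σ := by
    funext y
    by_cases hy : (y : Site d) ∈ Λ₁ <;> simp [hy]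
  right_inv p := by
    ext x
    · simp
    · simp [x.2]

/-- The identification `𝒜 ↦ 𝒜 ⊗ 1_{Λ₂ \ Λ₁}` of operators on `Λ₁` with operators on `Λ₂`. -/
def localEmbed (h : Λ₁ ⊆ Λ₂) : LocalAlgebra N Λ₁ →⋆ₐ[ℂ] LocalAlgebra N Λ₂ where
  toFun A := (Matrix.kronecker A 1).submatrix (splitConfig N h) (splitConfig N h)
  map_one' := by
    simp [Matrix.kronecker]
  map_mul' A B := by
    rw [Matrix.submatrix_mul_equiv]
    simp [Matrix.kronecker, ← Matrix.mul_kronecker_mul]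
  map_zero' := by simp [Matrix.kronecker]
  map_add' A B := by
    ext σ τ
    simp [Matrix.kronecker, add_mul]
  commutes' c := by
    simp only [Algebra.algebraMap_eq_smul_one]
    ext σ τ
    have : (1 : LocalAlgebra N Λ₂) = (Matrix.kronecker (1 : LocalAlgebra N Λ₁)
      (1 : Matrix ({y : Λ₂ // (y : Site d) ∉ Λ₁} → Fin (N + 1)) _ ℂ)).submatrix
        (splitConfig N h) (splitConfig N h) := by simp [Matrix.kronecker]
    have h' := congrFun (congrFun this σ) τ
    simp only [Matrix.kronecker, Matrix.submatrix_apply, Matrix.kroneckerMap_apply,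
      Matrix.smul_apply, smul_eq_mul] at h' ⊢
    rw [h', mul_assoc]
  map_star' A := by
    simp [Matrix.star_eq_conjTranspose, Matrix.kronecker, Matrix.conjTranspose_kronecker]

theorem localEmbed_apply (h : Λ₁ ⊆ Λ₂) (A : LocalAlgebra N Λ₁) (σ τ : Λ₂ → Fin (N + 1)) :
    localEmbed h A σ τ =
      if ∀ y : Λ₂, (y : Site d) ∉ Λ₁ → σ y = τ y then
        A (fun x => σ ⟨x, h x.2⟩) (fun x => τ ⟨x, h x.2⟩) else 0 := by
  have key : ((splitConfig N h σ).2 = (splitConfig N h τ).2) ↔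
      ∀ y : Λ₂, (y : Site d) ∉ Λ₁ → σ y = τ y := by
    simp [splitConfig, funext_iff]
  change A _ _ * (1 : Matrix _ _ ℂ) (splitConfig N h σ).2 (splitConfig N h τ).2 = _
  rw [Matrix.one_apply]
  simp only [key, mul_ite, mul_one, mul_zero]
  rfl

theorem localEmbed_injective (h : Λ₁ ⊆ Λ₂) :
    Function.Injective (localEmbed (N := N) h) := by
  intro A B hAB
  ext σ τ
  have := congrFun (congrFun hAB ((splitConfig N h).symm (σ, fun _ => 0)))
    ((splitConfig N h).symm (τ, fun _ => 0))
  simp only [localEmbed_apply] at this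
  simpa +contextual [splitConfig] using this

theorem norm_localEmbed (h : Λ₁ ⊆ Λ₂) (A : LocalAlgebra N Λ₁) : ‖localEmbed h A‖ = ‖A‖ :=
  NonUnitalStarAlgHom.norm_map (localEmbed h) (localEmbed_injective h) A

end Embedding

instance localDirected (d N : ℕ) :
    DirectedSystem (fun Λ : Finset (Site d) => LocalAlgebra N Λ)
      fun _ _ h => (localEmbed h : _ → _) where
  map_self Λ A := by
    ext σ τ
    rw [localEmbed_apply, if_pos]
    intro y hy
    exact absurd y.2 hy
  map_map Λ₃ Λ₂ Λ₁ h₁₂ h₂₃ A := by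
    ext σ τ
    simp only [localEmbed_apply]
    by_cases h : ∀ y : Λ₃, (y : Site d) ∉ Λ₁ → σ y = τ y
    · rw [if_pos h, if_pos, if_pos]
      · intro y hy
        exact h _ hy
      · intro y hy
        exact h _ fun hy' => hy (h₁₂ hy')
    · rw [if_neg h]
      by_cases h' : ∀ y : Λ₃, (y : Site d) ∉ Λ₂ → σ y = τ y
      · rw [if_pos h', if_neg]
        intro h''
        apply h
        intro y hy
        by_cases hy' : (y : Site d) ∈ Λ₂
        · exact h'' ⟨y, hy'⟩ hy
        · exact h' y hy'
      · rw [if_neg h']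

/-! ### The quasi-local algebra -/

/-- The union of all local algebras, i.e. the inductive limit of the `𝔄_Λ` over finite `Λ ⊂ ℤ^d`
along `𝒜 ↦ 𝒜 ⊗ 1`. -/
def LocalUnion (d N : ℕ) : Type :=
  DirectLimit (fun Λ : Finset (Site d) => LocalAlgebra N Λ)
    fun _ _ h => (localEmbed h : _ →⋆ₐ[ℂ] _)

namespace LocalUnion

variable {d N : ℕ}

instance : Ring (LocalUnion d N) :=
  inferInstanceAs (Ring (DirectLimit (fun Λ : Finset (Site d) => LocalAlgebra N Λ)
    fun _ _ h => (localEmbed h : _ →⋆ₐ[ℂ] _)))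

instance : Algebra ℂ (LocalUnion d N) :=
  inferInstanceAs (Algebra ℂ (DirectLimit (fun Λ : Finset (Site d) => LocalAlgebra N Λ)
    fun _ _ h => (localEmbed h : _ →⋆ₐ[ℂ] _)))

instance : StarRing (LocalUnion d N) :=
  inferInstanceAs (StarRing (DirectLimit (fun Λ : Finset (Site d) => LocalAlgebra N Λ)
    fun _ _ h => (localEmbed h : _ →⋆ₐ[ℂ] _)))

/-- The inclusion of `𝔄_Λ` in the union of all local algebras. -/
def of (Λ : Finset (Site d)) : LocalAlgebra N Λ →⋆ₐ[ℂ] LocalUnion d N where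
  toFun A := (⟦⟨Λ, A⟩⟧ : DirectLimit (fun Λ : Finset (Site d) => LocalAlgebra N Λ)
    fun _ _ h => (localEmbed h : _ →⋆ₐ[ℂ] _))
  map_one' := (DirectLimit.one_def Λ).symm
  map_mul' A B := (DirectLimit.mul_def Λ A B).symm
  map_zero' := (DirectLimit.zero_def Λ).symm
  map_add' A B := (DirectLimit.add_def Λ A B).symm
  commutes' c := (DirectLimit.algebraMap_def (R := ℂ) Λ c).symm
  map_star' A := (DirectLimit.star_def Λ A).symm

theorem of_localEmbed {Λ₁ Λ₂ : Finset (Site d)} (h : Λ₁ ⊆ Λ₂) (A : LocalAlgebra N Λ₁) :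
    of Λ₂ (localEmbed h A) = of Λ₁ A :=
  (DirectLimit.eq_of_le (f := fun _ _ h => (localEmbed h : LocalAlgebra N _ →⋆ₐ[ℂ] _))
    ⟨Λ₁, A⟩ Λ₂ h).symm

theorem exists_of (a : LocalUnion d N) : ∃ (Λ : Finset (Site d)) (A : LocalAlgebra N Λ),
    a = of Λ A :=
  DirectLimit.exists_eq_mk _ a

theorem exists_of₂ (a b : LocalUnion d N) : ∃ (Λ : Finset (Site d)) (A B : LocalAlgebra N Λ),
    a = of Λ A ∧ b = of Λ B :=
  DirectLimit.exists_eq_mk₂ _ a b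

/-- A function on the union of the local algebras from a compatible family. -/
def lift {C : Type*} (g : ∀ Λ : Finset (Site d), LocalAlgebra N Λ → C)
    (hg : ∀ (Λ₁ Λ₂ : Finset (Site d)) (h : Λ₁ ⊆ Λ₂) (A : LocalAlgebra N Λ₁),
      g Λ₁ A = g Λ₂ (localEmbed h A)) : LocalUnion d N → C :=
  DirectLimit.lift _ g hg

theorem lift_of {C : Type*} (g : ∀ Λ : Finset (Site d), LocalAlgebra N Λ → C)
    (hg : ∀ (Λ₁ Λ₂ : Finset (Site d)) (h : Λ₁ ⊆ Λ₂) (A : LocalAlgebra N Λ₁),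
      g Λ₁ A = g Λ₂ (localEmbed h A)) (Λ : Finset (Site d)) (A : LocalAlgebra N Λ) :
    lift g hg (of Λ A) = g Λ A :=
  rfl

instance : Norm (LocalUnion d N) where
  norm := lift (fun _ A => ‖A‖) fun _ _ h A => (norm_localEmbed h A).symm

theorem norm_of (Λ : Finset (Site d)) (A : LocalAlgebra N Λ) : ‖of Λ A‖ = ‖A‖ := rfl

instance : NormedRing (LocalUnion d N) :=
  { (inferInstance : Ring (LocalUnion d N)),
    NormedAddCommGroup.ofCore (𝕜 := ℂ) (E := LocalUnion d N)
      { norm_nonneg := fun a => by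
          obtain ⟨Λ, A, rfl⟩ := exists_of a
          rw [norm_of]
          exact norm_nonneg A
        norm_smul := fun c a => by
          obtain ⟨Λ, A, rfl⟩ := exists_of a
          rw [← map_smul, norm_of, norm_of, norm_smul]
        norm_triangle := fun a b => by
          obtain ⟨Λ, A, B, rfl, rfl⟩ := exists_of₂ a b
          rw [← map_add, norm_of, norm_of, norm_of]
          exact norm_add_le A B
        norm_eq_zero_iff := fun a => by
          obtain ⟨Λ, A, rfl⟩ := exists_of a
          rw [norm_of, norm_eq_zero]
          refine ⟨fun h => by rw [h, map_zero], fun h => ?_⟩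
          rw [← norm_eq_zero, ← norm_of, h, ← map_zero (of Λ), norm_of, norm_zero] } with
    norm_mul_le := fun a b => by
      obtain ⟨Λ, A, B, rfl, rfl⟩ := exists_of₂ a b
      rw [← map_mul, norm_of, norm_of, norm_of]
      exact norm_mul_le A B }

instance : NormedAlgebra ℂ (LocalUnion d N) where
  norm_smul_le c a := by
    obtain ⟨Λ, A, rfl⟩ := exists_of a
    rw [← map_smul, norm_of, norm_of, norm_smul]

instance : StarModule ℂ (LocalUnion d N) where
  star_smul c a := by
    obtain ⟨Λ, A, rfl⟩ := exists_of a
    rw [← map_smul, ← map_star, star_smul, map_smul, map_star]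

instance : CStarRing (LocalUnion d N) where
  norm_mul_self_le a := by
    obtain ⟨Λ, A, rfl⟩ := exists_of a
    rw [← map_star, ← map_mul, norm_of, norm_of]
    exact CStarRing.norm_mul_self_le A

end LocalUnion

/-- The quasi-local algebra: the norm completion of the union of all local algebras. -/
def QuasiLocal (d N : ℕ) : Type := UniformSpace.Completion (LocalUnion d N)

namespace QuasiLocal

open UniformSpace

variable {d N : ℕ}

instance : NormedRing (QuasiLocal d N) :=
  inferInstanceAs (NormedRing (Completion (LocalUnion d N)))

instance : Algebra ℂ (QuasiLocal d N) :=
  inferInstanceAs (Algebra ℂ (Completion (LocalUnion d N)))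

instance : CompleteSpace (QuasiLocal d N) :=
  inferInstanceAs (CompleteSpace (Completion (LocalUnion d N)))

instance : NormedAlgebra ℂ (QuasiLocal d N) where
  norm_smul_le := (inferInstance : NormedSpace ℂ (Completion (LocalUnion d N))).norm_smul_le

/-- The inclusion of the union of the local algebras in the quasi-local algebra. -/
def ofUnion : LocalUnion d N →ₗᵢ[ℂ] QuasiLocal d N :=
  (Completion.toComplₗᵢ : LocalUnion d N →ₗᵢ[ℂ] Completion (LocalUnion d N))

theorem denseRange_ofUnion : DenseRange (ofUnion : LocalUnion d N → QuasiLocal d N) :=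
  Completion.denseRange_coe

theorem ofUnion_mul (a b : LocalUnion d N) : ofUnion (a * b) = ofUnion a * ofUnion b :=
  Completion.coe_mul a b

theorem ofUnion_one : ofUnion (1 : LocalUnion d N) = 1 :=
  Completion.coe_one _

instance : Star (QuasiLocal d N) where
  star := Completion.map (star : LocalUnion d N → LocalUnion d N)

theorem continuous_star' : Continuous (star : QuasiLocal d N → QuasiLocal d N) :=
  Completion.continuous_map

theorem star_ofUnion (a : LocalUnion d N) : star (ofUnion a) = ofUnion (star a) :=
  Completion.map_coe star_isometry.uniformContinuous a

theorem induction_on {p : QuasiLocal d N → Prop} (a : QuasiLocal d N)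
    (hp : IsClosed {a | p a}) (ih : ∀ a, p (ofUnion a)) : p a :=
  denseRange_ofUnion.induction_on a hp ih

theorem induction_on₂ {p : QuasiLocal d N → QuasiLocal d N → Prop} (a b : QuasiLocal d N)
    (hp : IsClosed {x : QuasiLocal d N × QuasiLocal d N | p x.1 x.2})
    (ih : ∀ a b, p (ofUnion a) (ofUnion b)) : p a b :=
  denseRange_ofUnion.induction_on₂ (p := p) hp ih a b

instance : StarRing (QuasiLocal d N) where
  star_involutive a := by
    refine induction_on (p := fun a => star (star a) = a) a ?_ fun a => ?_
    · exact isClosed_eq (continuous_star'.comp continuous_star') continuous_id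
    · rw [star_ofUnion, star_ofUnion, star_star]
  star_mul a b := by
    refine induction_on₂ (p := fun a b => star (a * b) = star b * star a) a b ?_ fun a b => ?_
    · exact isClosed_eq (continuous_star'.comp continuous_mul)
        ((continuous_star'.comp continuous_snd).mul (continuous_star'.comp continuous_fst))
    · simp only [star_ofUnion, ← ofUnion_mul, star_mul]
  star_add a b := by
    refine induction_on₂ (p := fun a b => star (a + b) = star a + star b) a b ?_ fun a b => ?_
    · exact isClosed_eq (continuous_star'.comp continuous_add)
        ((continuous_star'.comp continuous_fst).add (continuous_star'.comp continuous_snd))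
    · simp only [star_ofUnion, ← map_add, star_add]

instance : StarModule ℂ (QuasiLocal d N) where
  star_smul c a := by
    refine induction_on (p := fun a => star (c • a) = star c • star a) a ?_ fun a => ?_
    · exact isClosed_eq (continuous_star'.comp (continuous_const_smul c))
        (continuous_star'.const_smul (star c))
    · rw [← map_smul, star_ofUnion, star_ofUnion, star_smul, map_smul]

instance : CStarRing (QuasiLocal d N) where
  norm_mul_self_le a := by
    refine induction_on (p := fun a => ‖a‖ * ‖a‖ ≤ ‖star a * a‖) a ?_ fun a => ?_
    · exact isClosed_le (continuous_norm.mul continuous_norm)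
        (continuous_norm.comp (continuous_star'.mul continuous_id))
    · rw [star_ofUnion, ← ofUnion_mul, LinearIsometry.norm_map, LinearIsometry.norm_map]
      exact CStarRing.norm_mul_self_le a

instance : CStarAlgebra (QuasiLocal d N) where

/-- The inclusion of the local algebra `𝔄_Λ` in the quasi-local algebra. -/
def ofLocal (Λ : Finset (Site d)) : LocalAlgebra N Λ →⋆ₐ[ℂ] QuasiLocal d N where
  toFun A := ofUnion (LocalUnion.of Λ A)
  map_one' := by rw [map_one, ofUnion_one]
  map_mul' A B := by rw [map_mul, ofUnion_mul]
  map_zero' := by rw [map_zero, map_zero]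
  map_add' A B := by rw [map_add, map_add]
  commutes' c := by
    rw [Algebra.algebraMap_eq_smul_one, map_smul, map_one, map_smul, ofUnion_one,
      Algebra.algebraMap_eq_smul_one]
  map_star' A := by rw [map_star, star_ofUnion]

end QuasiLocal

/-! ### Spin operators and quantization -/

/-- The (unscaled) ladder components `S_± = (S_1 ± i S_2)/√2`, `S_z = S_3` of the generators of the
spin-`s` representation of `su(2)` on `ℂ^{2s+1}`, `s = N/2`, in the basis with
`S_3 |k⟩ = (s - k) |k⟩`; thus `S_+ |k⟩ = √(k (2s + 1 - k) / 2) |k - 1⟩` and `S_- = S_+^*`. -/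
def spinMatrix (N : ℕ) : Ladder → SpinMat N
  | .plus => Matrix.of fun j k =>
      if (j : ℕ) + 1 = k then ((Real.sqrt ((k : ℝ) * (N + 1 - k) / 2) : ℝ) : ℂ) else 0
  | .z => Matrix.diagonal fun k => (N : ℂ) / 2 - (k : ℂ)
  | .minus => Matrix.of fun j k =>
      if (k : ℕ) + 1 = j then ((Real.sqrt ((j : ℝ) * (N + 1 - j) / 2) : ℝ) : ℂ) else 0

section SpinOperators

variable {d : ℕ} (N : ℕ) {Λ : Finset (Site d)}

/-- The elementary tensor `⨂_{x ∈ Λ} B x`. -/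
def tensorOp (B : Λ → SpinMat N) : LocalAlgebra N Λ :=
  Matrix.of fun σ τ => ∏ x, B x (σ x) (τ x)

theorem tensorOp_mul (B C : Λ → SpinMat N) :
    tensorOp N B * tensorOp N C = tensorOp N fun x => B x * C x := by
  ext σ τ
  simp only [tensorOp, Matrix.mul_apply, Matrix.of_apply, ← Finset.prod_mul_distrib]
  rw [Finset.prod_univ_sum, Fintype.piFinset_univ]

/-- The rescaled spin operator `Ŝ_i(x) = s^{-1} S_i` acting on the factor at the site `x`. -/
def spinOp (x : Λ) (i : Ladder) : LocalAlgebra N Λ :=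
  tensorOp N (Function.update (fun _ => 1) x (((N : ℂ) / 2)⁻¹ • spinMatrix N i))

theorem commute_spinOp {x y : Λ} (h : x ≠ y) (i j : Ladder) :
    Commute (spinOp N x i) (spinOp N y j) := by
  rw [Commute, SemiconjBy, spinOp, spinOp, tensorOp_mul, tensorOp_mul]
  congr 1
  funext w
  by_cases hx : w = x
  · subst hx
    simp [Function.update_of_ne h]
  · simp [Function.update_of_ne hx]

/-- The product over the sites of `Λ` of the (commuting) operators `Ŝ_i(x)^{α_i(x)}`, `i` fixed. -/
def ladderProd (i : Ladder) (α : MultiIndex d) (Λ : Finset (Site d)) : LocalAlgebra N Λ :=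
  (Finset.univ : Finset Λ).noncommProd (fun x => spinOp N x i ^ α (x, i))
    fun _ _ _ _ h => (commute_spinOp N h i i).pow_pow _ _

/-- The normal-ordered quantization of the monomial `M^α`, for `α` supported in `Λ`: all factors
`Ŝ_+` stand to the left of all `Ŝ_z`, and these to the left of all `Ŝ_-`. -/
def normalMonomial (Λ : Finset (Site d)) (α : MultiIndex d) : LocalAlgebra N Λ :=
  ladderProd N .plus α Λ * ladderProd N .z α Λ * ladderProd N .minus α Λ

/-- Quantization `A ↦ Â` of polynomials, with values in the quasi-local algebra. -/
def quantize (A : PolyObs d) : QuasiLocal d N :=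
  ∑ α ∈ A.support, A.coeff α • QuasiLocal.ofLocal (sites α) (normalMonomial N (sites α) α)

/-! ### Quantum dynamics -/

/-- The Hamiltonian `Ĥ_Λ`, the term by term quantization of `∑_{α ∈ ℕ^{I × Λ}} V(α) M^α`. -/
def quantumHamiltonian (V : MultiIndex d → ℂ) (Λ : Finset (Site d)) : LocalAlgebra N Λ :=
  ∑' α : {α : MultiIndex d // sites α ⊆ Λ}, V α.1 • normalMonomial N Λ α.1

/-- The propagator `e^{-i s Ĥ_Λ t}`, `s = N/2`. -/
def propagator (V : MultiIndex d → ℂ) (Λ : Finset (Site d)) (t : ℝ) : LocalAlgebra N Λ :=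
  NormedSpace.exp ((-(Complex.I * ((N : ℂ) / 2) * (t : ℂ))) • quantumHamiltonian N V Λ)

/-- The finite-volume dynamics `𝒜 ↦ U^* 𝒜 U` with `U = e^{-i s Ĥ_Λ t} ∈ 𝔄_Λ`. -/
def finiteVolumeEvolution (V : MultiIndex d → ℂ) (Λ : Finset (Site d)) (t : ℝ)
    (a : QuasiLocal d N) : QuasiLocal d N :=
  star (QuasiLocal.ofLocal Λ (propagator N V Λ t)) * a *
    QuasiLocal.ofLocal Λ (propagator N V Λ t)

/-- The infinite-volume dynamics `α̂^t`: the norm limit of the finite-volume dynamics as `Λ`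
increases to `ℤ^d` along the directed set of all finite subsets. -/
def quantumEvolution (V : MultiIndex d → ℂ) (t : ℝ) (a : QuasiLocal d N) : QuasiLocal d N :=
  limUnder atTop fun Λ : Finset (Site d) => finiteVolumeEvolution N V Λ t a

end SpinOperators

/-! ### Coherent states -/

/-- The generator `(θ/√2) (e^{iφ} S_- - e^{-iφ} S_+)`, where `θ`, `φ` are polar angles of `v`. -/
def coherentGenerator (N : ℕ) (v : Vec3) : SpinMat N :=
  ((Real.arccos (v 2) / Real.sqrt 2 : ℝ) : ℂ) •
    (Complex.exp (Complex.I * (Complex.arg ((v 0 : ℂ) + Complex.I * (v 1 : ℂ)) : ℂ)) •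
        spinMatrix N .minus -
      Complex.exp (-(Complex.I * (Complex.arg ((v 0 : ℂ) + Complex.I * (v 1 : ℂ)) : ℂ))) •
        spinMatrix N .plus)

/-- The spin coherent state `|v⟩ = exp((θ/√2) (e^{iφ} S_- - e^{-iφ} S_+)) |s⟩`, with `|s⟩` the
highest-weight vector. -/
def coherentVector (N : ℕ) (v : Vec3) : Fin (N + 1) → ℂ :=
  Matrix.mulVec (NormedSpace.exp (coherentGenerator N v)) (Pi.single 0 1)

theorem star_coherentGenerator (N : ℕ) (v : Vec3) :
    star (coherentGenerator N v) = -coherentGenerator N v := by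
  have h1 : star (spinMatrix N .minus) = spinMatrix N .plus := by
    ext j k
    simp only [spinMatrix, Matrix.star_apply, Matrix.of_apply]
    split_ifs <;> simp
  have h2 : star (spinMatrix N .plus) = spinMatrix N .minus := by
    rw [← h1, star_star]
  have h3 : ∀ r : ℝ, star (Complex.exp (Complex.I * (r : ℂ))) =
      Complex.exp (-(Complex.I * (r : ℂ))) := by
    intro r
    rw [Complex.star_def, ← Complex.exp_conj]
    simp
  have h4 : ∀ r : ℝ, star (Complex.exp (-(Complex.I * (r : ℂ)))) =
      Complex.exp (Complex.I * (r : ℂ)) := by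
    intro r
    rw [← h3, star_star]
  rw [coherentGenerator, star_smul, star_sub, star_smul, star_smul, h1, h2, h3, h4]
  rw [Complex.star_def, Complex.conj_ofReal, ← smul_neg, neg_sub]

theorem sum_coherentVector (N : ℕ) (v : Vec3) :
    ∑ k, star (coherentVector N v k) * coherentVector N v k = 1 := by
  set U : SpinMat N := NormedSpace.exp (coherentGenerator N v) with hU
  have hUU : star U * U = 1 := by
    rw [hU, NormedSpace.star_exp, star_coherentGenerator,
      ← Matrix.exp_add_of_commute _ _ (Commute.neg_left (Commute.refl (coherentGenerator N v)))]
    simp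
  have h := congrFun (congrFun hUU 0) 0
  rw [Matrix.mul_apply] at h
  simpa [coherentVector, ← hU] using h

section ProductStates

variable {d : ℕ} (N : ℕ)

/-- The product vector `|M_Λ⟩ = ⨂_{x ∈ Λ} |M(x)⟩`. -/
def productVector (M : Site d → Vec3) (Λ : Finset (Site d)) : (Λ → Fin (N + 1)) → ℂ :=
  fun σ => ∏ x : Λ, coherentVector N (M x) (σ x)

/-- The expectation `⟨M_Λ, 𝒜 M_Λ⟩` of a local observable. -/
def localState (M : Site d → Vec3) (Λ : Finset (Site d)) (A : LocalAlgebra N Λ) : ℂ :=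
  dotProduct (star (productVector N M Λ)) (Matrix.mulVec A (productVector N M Λ))

theorem sum_prod_coherentVector {ι : Type*} [Fintype ι] [DecidableEq ι] (c : ι → Vec3) :
    ∑ σ : ι → Fin (N + 1), star (∏ x, coherentVector N (c x) (σ x)) *
      ∏ x, coherentVector N (c x) (σ x) = 1 := by
  have h := Finset.prod_univ_sum (fun _ : ι => (Finset.univ : Finset (Fin (N + 1))))
    (fun x k => star (coherentVector N (c x) k) * coherentVector N (c x) k)
  simp only [sum_coherentVector, Finset.prod_const_one, Fintype.piFinset_univ] at h
  rw [h]
  refine Finset.sum_congr rfl fun σ _ => ?_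
  rw [star_prod, Finset.prod_mul_distrib]

theorem productVector_split (M : Site d → Vec3) {Λ₁ Λ₂ : Finset (Site d)} (h : Λ₁ ⊆ Λ₂)
    (p : (Λ₁ → Fin (N + 1)) × ({y : Λ₂ // (y : Site d) ∉ Λ₁} → Fin (N + 1))) :
    productVector N M Λ₂ ((splitConfig N h).symm p) =
      productVector N M Λ₁ p.1 * ∏ y, coherentVector N (M (y.1 : Site d)) (p.2 y) := by
  rw [productVector, productVector,
    ← Fintype.prod_subtype_mul_prod_subtype (fun y : Λ₂ => (y : Site d) ∈ Λ₁)]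
  congr 1
  · let e : {y : Λ₂ // (y : Site d) ∈ Λ₁} ≃ Λ₁ :=
      { toFun := fun y => ⟨y.1, y.2⟩
        invFun := fun x => ⟨⟨x, h x.2⟩, x.2⟩
        left_inv := fun _ => rfl
        right_inv := fun _ => rfl }
    refine Fintype.prod_equiv e _ _ fun y => ?_
    simp [splitConfig, e, y.2]
  · refine Finset.prod_congr rfl fun y _ => ?_
    simp [splitConfig, y.2]

theorem localState_localEmbed (M : Site d → Vec3) {Λ₁ Λ₂ : Finset (Site d)} (h : Λ₁ ⊆ Λ₂)
    (A : LocalAlgebra N Λ₁) :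
    localState N M Λ₁ A = localState N M Λ₂ (localEmbed h A) := by
  have hA : ∀ p q, localEmbed h A ((splitConfig N h).symm p) ((splitConfig N h).symm q) =
      if p.2 = q.2 then A p.1 q.1 else 0 := by
    intro p q
    change A _ _ * (1 : Matrix _ _ ℂ) (splitConfig N h ((splitConfig N h).symm p)).2
      (splitConfig N h ((splitConfig N h).symm q)).2 = _
    rw [Equiv.apply_symm_apply, Equiv.apply_symm_apply, Matrix.one_apply]
    have e1 : (splitConfig N h ((splitConfig N h).symm p)).1 = p.1 := by
      rw [Equiv.apply_symm_apply]
    have e2 : (splitConfig N h ((splitConfig N h).symm q)).1 = q.1 := by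
      rw [Equiv.apply_symm_apply]
    simp
  simp only [localState, dotProduct, Matrix.mulVec, Pi.star_apply]
  rw [← (splitConfig N h).symm.sum_comp, Fintype.sum_prod_type]
  refine Finset.sum_congr rfl fun a _ => ?_
  have h1 := sum_prod_coherentVector N
    (fun y : {y : Λ₂ // (y : Site d) ∉ Λ₁} => M (y.1 : Site d))
  calc star (productVector N M Λ₁ a) * ∑ a', A a a' * productVector N M Λ₁ a'
      = (star (productVector N M Λ₁ a) * ∑ a', A a a' * productVector N M Λ₁ a') * 1 := by
        rw [mul_one]
    _ = _ := by
        rw [← h1, Finset.mul_sum]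
        refine Finset.sum_congr rfl fun b _ => ?_
        rw [← (splitConfig N h).symm.sum_comp, Fintype.sum_prod_type]
        simp only [hA, productVector_split, ite_mul, zero_mul, Finset.sum_ite_eq,
          Finset.mem_univ, if_true, star_mul']
        simp only [← mul_assoc, ← Finset.sum_mul]
        ring

theorem norm_localState_le (M : Site d → Vec3) (Λ : Finset (Site d)) (A : LocalAlgebra N Λ) :
    ‖localState N M Λ A‖ ≤ ‖A‖ := by
  set ψ : EuclideanSpace ℂ (Λ → Fin (N + 1)) := WithLp.toLp 2 (productVector N M Λ) with hψ
  have h1 : ‖ψ‖ = 1 := by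
    have h2 := sum_prod_coherentVector N (fun x : Λ => M x)
    have h3 : ‖ψ‖ ^ 2 = 1 := by
      rw [EuclideanSpace.norm_sq_eq]
      have : ((∑ σ, ‖ψ σ‖ ^ 2 : ℝ) : ℂ) = 1 := by
        rw [← h2, Complex.ofReal_sum]
        refine Finset.sum_congr rfl fun σ _ => ?_
        rw [Complex.star_def, Complex.conj_mul', Complex.ofReal_pow]
        rfl
      exact_mod_cast this
    nlinarith [norm_nonneg ψ]
  have h4 : localState N M Λ A =
      inner ℂ ψ (WithLp.toLp 2 (Matrix.mulVec A (productVector N M Λ))) := by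
    rw [EuclideanSpace.inner_eq_star_dotProduct, dotProduct_comm]
    rfl
  rw [h4]
  refine (norm_inner_le_norm _ _).trans ?_
  have h5 := Matrix.l2_opNorm_mulVec A ψ
  rw [h1, mul_one] at h5
  rw [h1, one_mul]
  exact h5

/-- The state `ρ_M` on the union of the local algebras. -/
def unionState (M : Site d → Vec3) : LocalUnion d N →L[ℂ] ℂ :=
  LinearMap.mkContinuous
    { toFun := LocalUnion.lift (localState N M) fun _ _ h A => localState_localEmbed N M h A
      map_add' := fun a b => by
        obtain ⟨Λ, A, B, rfl, rfl⟩ := LocalUnion.exists_of₂ a b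
        rw [← map_add]
        simp only [LocalUnion.lift_of]
        simp [localState, Matrix.add_mulVec, dotProduct_add]
      map_smul' := fun c a => by
        obtain ⟨Λ, A, rfl⟩ := LocalUnion.exists_of a
        rw [← map_smul]
        simp only [LocalUnion.lift_of]
        simp [localState, Matrix.smul_mulVec, dotProduct_smul] }
    1 fun a => by
      obtain ⟨Λ, A, rfl⟩ := LocalUnion.exists_of a
      rw [one_mul, LocalUnion.norm_of]
      exact norm_localState_le N M Λ A

/-- The coherent product state `ρ_M`, extended by continuity to the quasi-local algebra. -/
def coherentState (M : Site d → Vec3) : QuasiLocal d N →L[ℂ] ℂ :=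
  (unionState N M).extend QuasiLocal.ofUnion.toContinuousLinearMap

theorem coherentState_ofLocal (M : Site d → Vec3) (Λ : Finset (Site d)) (A : LocalAlgebra N Λ) :
    coherentState N M (QuasiLocal.ofLocal Λ A) = localState N M Λ A :=
  (unionState N M).extend_eq (e := QuasiLocal.ofUnion.toContinuousLinearMap)
    QuasiLocal.denseRange_ofUnion
    (QuasiLocal.ofUnion (d := d) (N := N)).isometry.isUniformInducing (LocalUnion.of Λ A)

end ProductStates

end SpinSystem

end

noncomputable section

namespace SpinSystem

/-! ### Words in the spin variables -/

/-! Both dynamics are read on words, i.e. noncommutative monomials in the spin variables. For the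
rescaled spins, `i s [·,·]` turns a pair of words into a sum over pairs of letters at a common site,
each pair replaced by one letter, with coefficients free of `s` (`letterOp_commutator`,
`bracketSum_wordOp`). The classical bracket gives the same sum with commuting letters
(`hamiltonField_eq`, `bracketSum_evalWord`). Hence the evolved word operators and the word values
along a classical solution obey the same linear equation `φ' = liouville V φ`, with `V` restricted
to `Λ` in finite volume. The spin enters only through the initial values and the operator norms.

The Liouville operator is unbounded, as it lengthens words and carries a factor `|w|`. But its
`k`-th iterate on functions growing like `R^|w|` is at most `k! r^(-k) e^|w| ‖V‖^k` whenever `R e^r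
≤ e` (`iterate_majorant_weight_le`). So the power series `flow` converges for `|t| ‖V‖ < r`, and
Taylor's formula identifies every solution bounded by `R^|w|` with it (`eq_flow_of_hasDerivAt`). The
flow does not return to the class `R^|w|`, but a priori bounds do: quantum evolutions are isometric
and classical spins keep length one. Short steps can thus be repeated up to any time. This gives the
infinite-volume limit, by dominated convergence (`tendsto_finiteVolume_add`), and classical
uniqueness. Classical existence is Picard–Lindelöf in `l^∞` for a field made bounded and Lipschitz
by projecting each spin on the unit ball; spins precess, so the projection is never felt.

The difference of quantum and classical word values (`deviation`) solves the same equation.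
Initially it is at most `|w|/√s`, since the fluctuations of the three spin components in a coherent
state add up to `1/s` (`coherent_fluctuation`). For short times the bound on the iterates, with an
extra factor `|w|`, yields `C/√s`. For longer times only convergence to zero word by word survives
each restart. -/

/-- Noncommutative monomials in the variables `M_i(x)`. -/
abbrev Word (d : ℕ) : Type := List (Site d × Ladder)

/-- The index `k` with `ε̃ i j k ≠ 0`, if there is one. -/
def Ladder.bracket : Ladder → Ladder → Ladder
  | .plus, .z => .plus
  | .z, .plus => .plus
  | .minus, .z => .minus
  | .z, .minus => .minus
  | _, _ => .z

theorem Ladder.sum_univ {M : Type*} [AddCommMonoid M] (f : Ladder → M) :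
    ∑ k, f k = f .plus + (f .z + f .minus) := by
  have : (Finset.univ : Finset Ladder) = {.plus, .z, .minus} := rfl
  rw [this, Finset.sum_insert (by decide), Finset.sum_insert (by decide), Finset.sum_singleton]

/-- At most one third index has a nonzero structure constant, so the bracket of two letters is a
multiple of a single letter. This is why words are mapped to combinations of words. -/
theorem sum_epsTilde_smul {E : Type*} [AddCommGroup E] [Module ℂ E] (i j : Ladder)
    (f : Ladder → E) :
    ∑ k, epsTilde i j k • f k = epsTilde i j (i.bracket j) • f (i.bracket j) := by
  cases i <;> cases j <;> simp [Ladder.sum_univ, epsTilde, Ladder.bracket]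

theorem norm_epsTilde_le (i j k : Ladder) : ‖epsTilde i j k‖ ≤ 1 := by
  cases i <;> cases j <;> cases k <;> simp [epsTilde]

section NormalWord

variable {d : ℕ}

/-- The word `∏_x M_i(x)^{α_i(x)}`, with `x` running through `Λ`. -/
def ladderWord (i : Ladder) (α : MultiIndex d) (Λ : Finset (Site d)) : Word d :=
  Λ.toList.flatMap fun x => List.replicate (α (x, i)) (x, i)

/-- The normal-ordered word of a multi-index. -/
def normalWord (α : MultiIndex d) : Word d :=
  ladderWord .plus α (sites α) ++ ladderWord .z α (sites α) ++ ladderWord .minus α (sites α)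

theorem notMem_sites {α : MultiIndex d} {x : Site d} (h : x ∉ sites α) (i : Ladder) :
    α (x, i) = 0 := by
  by_contra h'
  exact h (Finset.mem_image.2 ⟨(x, i), Finsupp.mem_support_iff.2 h', rfl⟩)

theorem count_ladderWord (i : Ladder) (α : MultiIndex d) (p : Site d × Ladder) :
    Multiset.count p (ladderWord i α (sites α) : Multiset (Site d × Ladder)) =
      if p.2 = i then α p else 0 := by
  obtain ⟨x, j⟩ := p
  rw [ladderWord, ← Multiset.coe_bind, Multiset.count_bind, Finset.coe_toList]
  simp only [Multiset.coe_replicate, Multiset.count_replicate, Prod.mk.injEq]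
  rw [← Finset.sum_eq_multiset_sum]
  by_cases h : j = i
  · subst h
    simp only [and_true, if_true]
    rw [Finset.sum_ite_eq']
    split_ifs with hx
    · rfl
    · exact (notMem_sites hx j).symm
  · have h' : ¬ i = j := fun e => h e.symm
    simp [h, h']

/-- Counts over positions and commutative evaluations depend only on the multiset of letters; this
is the bridge from words back to multi-indices. -/
theorem coe_normalWord (α : MultiIndex d) :
    (normalWord α : Multiset (Site d × Ladder)) = Finsupp.toMultiset α := by
  ext p
  rw [Finsupp.count_toMultiset, normalWord, ← Multiset.coe_add, ← Multiset.coe_add]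
  simp only [Multiset.count_add, count_ladderWord]
  obtain ⟨x, i⟩ := p
  cases i <;> simp

theorem length_normalWord (α : MultiIndex d) : (normalWord α).length = α.degree := by
  rw [← Multiset.coe_card, coe_normalWord, Finsupp.card_toMultiset]
  rfl

theorem sum_map_normalWord {M : Type*} [AddCommMonoid M] (α : MultiIndex d) (x : Site d)
    (f : Ladder → M) :
    ((normalWord α).map fun p => if p.1 = x then f p.2 else 0).sum = ∑ j, α (x, j) • f j := by
  rw [← Multiset.sum_coe, ← Multiset.map_coe, coe_normalWord, Finset.sum_multiset_map_count,
    Finsupp.toFinset_toMultiset]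
  simp only [Finsupp.count_toMultiset]
  -- `t` consists of the three letters at `x`. Both sums are extended to `α.support ∪ t`; the added
  -- terms vanish because of a wrong site in one case and multiplicity zero in the other.
  set t : Finset (Site d × Ladder) := Finset.univ.image fun j => (x, j) with ht
  have h1 : ∑ j, α (x, j) • f j = ∑ p ∈ t, α p • (if p.1 = x then f p.2 else 0) := by
    rw [ht, Finset.sum_image fun i _ j _ h => (Prod.mk.inj h).2]
    simp
  rw [h1, Finset.sum_subset (Finset.subset_union_left (s₂ := t)),
    ← Finset.sum_subset (Finset.subset_union_right (s₁ := α.support))]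
  · rintro ⟨y, j⟩ _ hp
    rw [if_neg, smul_zero]
    rintro rfl
    exact hp (Finset.mem_image_of_mem _ (Finset.mem_univ j))
  · intro p _ hp
    rw [Finsupp.notMem_support_iff.1 hp, zero_smul]

theorem sum_normalWord_siteDegree (α : MultiIndex d) (x : Site d) :
    ((normalWord α).map fun p => if p.1 = x then (1 : ℕ) else 0).sum = siteDegree α x := by
  rw [sum_map_normalWord α x fun _ => 1]
  simp [siteDegree]

end NormalWord

/-! ### The Liouville operator on functions of words -/

section Liouville

variable {d : ℕ} {E F : Type*} [NormedAddCommGroup E] [NormedSpace ℂ E]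
  [NormedAddCommGroup F] [NormedSpace ℂ F]

/-- The word obtained from `u` and `w` by replacing the letters `u_a`, `w_b` with the third
letter in their commutation relation. -/
def exchange (u w : Word d) (a : Fin u.length) (b : Fin w.length) : Word d :=
  u.take a ++ (w.take b ++ (u[a.1].1, u[a.1].2.bracket w[b.1].2) :: w.drop (b + 1)) ++
    u.drop (a + 1)

theorem length_exchange (u w : Word d) (a : Fin u.length) (b : Fin w.length) :
    (exchange u w a b).length = w.length + u.length - 1 := by
  have := a.2
  have := b.2
  simp [exchange]
  omega

/-- The structure constant of the pair of letters `p`, `q`. -/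
def exchangeCoeff (p q : Site d × Ladder) : ℂ :=
  if p.1 = q.1 then Complex.I * epsTilde p.2 q.2 (p.2.bracket q.2) else 0

theorem norm_exchangeCoeff_le (p q : Site d × Ladder) :
    ‖exchangeCoeff p q‖ ≤ if p.1 = q.1 then 1 else 0 := by
  rw [exchangeCoeff]
  split_ifs
  · simpa using norm_epsTilde_le _ _ _
  · simp

/-- The bracket of the words `u` and `w`, evaluated with `φ`. -/
def bracketSum (u w : Word d) (φ : Word d → E) : E :=
  ∑ a : Fin u.length, ∑ b : Fin w.length, exchangeCoeff u[a.1] w[b.1] • φ (exchange u w a b)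

/-- The operator dual to `w ↦ ∑_α V(α) {M^α, w}` on functions of words. -/
def liouville (V : MultiIndex d → ℂ) (φ : Word d → E) (w : Word d) : E :=
  ∑' α, V α • bracketSum (normalWord α) w φ

/-- The contribution of the multi-indices of degree `n` to the norm of `V`. -/
def shellNorm (V : MultiIndex d → ℂ) (n : ℕ) : ℝ≥0∞ :=
  ⨆ x : Site d, ∑' α : {α : MultiIndex d // α.degree = n}, ‖V α.1‖ₑ * siteDegree α.1 x

theorem potentialENorm_eq (V : MultiIndex d → ℂ) :
    potentialENorm V = ∑' n : ℕ, shellNorm V n * ENNReal.ofReal (Real.exp n) := by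
  refine tsum_congr fun n => ?_
  rw [shellNorm, ENNReal.iSup_mul]
  refine iSup_congr fun x => ?_
  rw [← ENNReal.tsum_mul_right]
  refine tsum_congr fun α => ?_
  rw [ENNReal.ofReal_mul (by positivity), ENNReal.ofReal_mul (by positivity), ofReal_norm,
    ENNReal.ofReal_natCast, mul_comm (siteDegree α.1 x : ℝ≥0∞)]

/-- The operator on weights of word lengths which dominates the Liouville operator. -/
def majorant (V : MultiIndex d → ℂ) (g : ℕ → ℝ≥0∞) (p : ℕ) : ℝ≥0∞ :=
  p * ∑' n, shellNorm V n * g (p + n - 1)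

/-- The majorant of the term of the Liouville operator with index `α`. -/
def majorantTerm (V : MultiIndex d → ℂ) (g : ℕ → ℝ≥0∞) (w : Word d) (α : MultiIndex d) : ℝ≥0∞ :=
  ‖V α‖ₑ * ∑ b : Fin w.length, siteDegree α w[b.1].1 * g (w.length + α.degree - 1)

/-- A letter of `w` interacts only with the letters of `M^α` at its own site, and `siteDegree` is
their number. Each exchange has a coefficient of modulus at most one. -/
theorem enorm_bracketSum_le {g : ℕ → ℝ≥0∞} {φ : Word d → E} (hφ : ∀ v, ‖φ v‖ₑ ≤ g v.length)
    (α : MultiIndex d) (w : Word d) :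
    ‖bracketSum (normalWord α) w φ‖ₑ ≤
      ∑ b : Fin w.length, siteDegree α w[b.1].1 * g (w.length + α.degree - 1) := by
  rw [bracketSum, Finset.sum_comm]
  refine (enorm_sum_le _ _).trans (Finset.sum_le_sum fun b _ => ?_)
  refine (enorm_sum_le _ _).trans ?_
  rw [← sum_normalWord_siteDegree, ← Fin.sum_univ_fun_getElem, Nat.cast_sum, Finset.sum_mul]
  refine Finset.sum_le_sum fun a _ => ?_
  rw [enorm_smul]
  refine mul_le_mul' ?_ ?_
  · have := norm_exchangeCoeff_le (normalWord α)[a.1] w[b.1]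
    rw [← ofReal_norm]
    refine (ENNReal.ofReal_le_ofReal this).trans ?_
    split_ifs <;> simp
  · refine (hφ _).trans_eq ?_
    rw [length_exchange, length_normalWord]

/-- Grouping the multi-indices by degree leaves, for each letter of `w`, a sum attached to a single
site in every shell, which the supremum in `shellNorm` dominates. The letters then give the factor
`w.length`. -/
theorem tsum_majorantTerm_le (V : MultiIndex d → ℂ) (g : ℕ → ℝ≥0∞) (w : Word d) :
    ∑' α, majorantTerm V g w α ≤ majorant V g w.length := by
  simp only [majorantTerm, Finset.mul_sum]
  rw [Summable.tsum_finsetSum fun _ _ => ENNReal.summable]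
  have key : ∀ x : Site d,
      ∑' α : MultiIndex d, ‖V α‖ₑ * (siteDegree α x * g (w.length + α.degree - 1)) ≤
        ∑' n, shellNorm V n * g (w.length + n - 1) := by
    intro x
    rw [← ENNReal.tsum_fiberwise _ (Finsupp.degree : MultiIndex d → ℕ)]
    refine ENNReal.tsum_le_tsum fun n => ?_
    have : ∀ α : (Finsupp.degree : MultiIndex d → ℕ) ⁻¹' {n},
        ‖V α.1‖ₑ * (siteDegree α.1 x * g (w.length + α.1.degree - 1)) =
        ‖V α.1‖ₑ * siteDegree α.1 x * g (w.length + n - 1) := by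
      rintro ⟨α, rfl⟩
      rw [mul_assoc]
    rw [tsum_congr this, ENNReal.tsum_mul_right]
    refine mul_le_mul' ?_ le_rfl
    exact le_iSup (fun x => ∑' α : {α : MultiIndex d // α.degree = n},
      ‖V α.1‖ₑ * siteDegree α.1 x) x
  refine (Finset.sum_le_sum fun b _ => key _).trans ?_
  simp [majorant]

/-- Two potentials are carried along: `V'` acts, for instance a restriction to a finite volume,
while the bounds involve only `V` and are therefore uniform in the volume. -/
theorem enorm_term_le {V V' : MultiIndex d → ℂ} (hV : ∀ α, ‖V' α‖ ≤ ‖V α‖) {g : ℕ → ℝ≥0∞}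
    {φ : Word d → E} (hφ : ∀ v, ‖φ v‖ₑ ≤ g v.length) (w : Word d) (α : MultiIndex d) :
    ‖V' α • bracketSum (normalWord α) w φ‖ₑ ≤ majorantTerm V g w α := by
  rw [enorm_smul]
  exact mul_le_mul' (enorm_le_iff_norm_le.2 (hV α)) (enorm_bracketSum_le hφ α w)

theorem summable_majorantTerm {V : MultiIndex d → ℂ} {g : ℕ → ℝ≥0∞} {w : Word d}
    (h : majorant V g w.length ≠ ⊤) : Summable fun α => (majorantTerm V g w α).toReal :=
  ENNReal.summable_toReal (ne_top_of_le_ne_top h (tsum_majorantTerm_le V g w))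

theorem norm_term_le {V V' : MultiIndex d → ℂ} (hV : ∀ α, ‖V' α‖ ≤ ‖V α‖) {g : ℕ → ℝ≥0∞}
    {φ : Word d → E} (hφ : ∀ v, ‖φ v‖ₑ ≤ g v.length) {w : Word d}
    (h : majorant V g w.length ≠ ⊤) (α : MultiIndex d) :
    ‖V' α • bracketSum (normalWord α) w φ‖ ≤ (majorantTerm V g w α).toReal := by
  have h1 : majorantTerm V g w α ≠ ⊤ :=
    ne_top_of_le_ne_top h ((ENNReal.le_tsum α).trans (tsum_majorantTerm_le V g w))
  have := ENNReal.toReal_mono h1 (enorm_term_le hV hφ w α)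
  rwa [toReal_enorm] at this

theorem summable_liouville [CompleteSpace E] {V V' : MultiIndex d → ℂ}
    (hV : ∀ α, ‖V' α‖ ≤ ‖V α‖) {g : ℕ → ℝ≥0∞}
    {φ : Word d → E} (hφ : ∀ v, ‖φ v‖ₑ ≤ g v.length) {w : Word d}
    (h : majorant V g w.length ≠ ⊤) :
    Summable fun α => V' α • bracketSum (normalWord α) w φ :=
  .of_norm_bounded (summable_majorantTerm h) (norm_term_le hV hφ h)

theorem enorm_liouville_le {V V' : MultiIndex d → ℂ}
    (hV : ∀ α, ‖V' α‖ ≤ ‖V α‖) {g : ℕ → ℝ≥0∞}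
    {φ : Word d → E} (hφ : ∀ v, ‖φ v‖ₑ ≤ g v.length) (w : Word d) :
    ‖liouville V' φ w‖ₑ ≤ majorant V g w.length :=
  (enorm_tsum_le_tsum_enorm).trans
    ((ENNReal.tsum_le_tsum (enorm_term_le hV hφ w)).trans (tsum_majorantTerm_le V g w))

theorem enorm_iterate_liouville_le {V V' : MultiIndex d → ℂ}
    (hV : ∀ α, ‖V' α‖ ≤ ‖V α‖) {g : ℕ → ℝ≥0∞}
    {φ : Word d → E} (hφ : ∀ v, ‖φ v‖ₑ ≤ g v.length) (k : ℕ) :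
    ∀ w, ‖(liouville V')^[k] φ w‖ₑ ≤ (majorant V)^[k] g w.length := by
  induction k with
  | zero => exact hφ
  | succ k ih =>
    intro w
    rw [Function.iterate_succ_apply', Function.iterate_succ_apply']
    exact enorm_liouville_le hV ih w

/-! ### Weights -/

theorem majorant_mono (V : MultiIndex d → ℂ) : Monotone (majorant V) := by
  intro g g' h p
  exact mul_le_mul' le_rfl (ENNReal.tsum_le_tsum fun n => mul_le_mul' le_rfl (h _))

theorem majorant_tsum (V : MultiIndex d → ℂ) (c : ℕ → ℝ≥0∞) (g : ℕ → ℕ → ℝ≥0∞) :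
    majorant V (fun p => ∑' n, c n * g n p) = fun p => ∑' n, c n * majorant V (g n) p := by
  funext p
  simp only [majorant, ← ENNReal.tsum_mul_left]
  rw [ENNReal.tsum_comm]
  refine tsum_congr fun n => tsum_congr fun m => ?_
  ring

theorem iterate_majorant_tsum (V : MultiIndex d → ℂ) (k : ℕ) (c : ℕ → ℝ≥0∞)
    (g : ℕ → ℕ → ℝ≥0∞) :
    (majorant V)^[k] (fun p => ∑' n, c n * g n p) =
      fun p => ∑' n, c n * (majorant V)^[k] (g n) p := by
  induction k with
  | zero => rfl
  | succ k ih => simp only [Function.iterate_succ_apply', ih, majorant_tsum]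

/-- The weight `(p + m)^j R^{p + m}` of words of length `p`. -/
def weight (R : ℝ) (j m p : ℕ) : ℝ≥0∞ := ENNReal.ofReal (((p + m : ℕ) : ℝ) ^ j * R ^ (p + m))

/-- The number of letters is absorbed in one more power of the total length, the new letters in the
shift. Trading powers for exponentials already here would cost a constant at every iteration, so
this is postponed to the end. -/
theorem majorant_weight_le (V : MultiIndex d → ℂ) {R : ℝ} (hR : 1 ≤ R) (j m : ℕ) :
    majorant V (weight R j m) ≤ fun p => ∑' n, shellNorm V n * weight R (j + 1) (m + n) p := by
  intro p
  rw [majorant, ← ENNReal.tsum_mul_left]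
  refine ENNReal.tsum_le_tsum fun n => ?_
  rw [mul_left_comm]
  refine mul_le_mul' le_rfl ?_
  rw [weight, weight, ← ENNReal.ofReal_natCast, ← ENNReal.ofReal_mul (by positivity)]
  refine ENNReal.ofReal_le_ofReal ?_
  have h1 : p + n - 1 + m ≤ p + (m + n) := by omega
  rw [pow_succ, mul_comm _ (((p + (m + n) : ℕ) : ℝ)), mul_assoc]
  gcongr
  omega

/-- `(r q)^j / j! ≤ e^(r q)` trades the power for a factorial; the room left by `R e^r ≤ e` pays for
the exponential. -/
theorem weight_le {R r : ℝ} (hR : 1 ≤ R) (hr : 0 < r) (hRr : R * Real.exp r ≤ Real.exp 1)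
    (j m p : ℕ) :
    weight R j m p ≤ ENNReal.ofReal ((j.factorial : ℝ) / r ^ j * Real.exp ((p + m : ℕ) : ℝ)) := by
  refine ENNReal.ofReal_le_ofReal ?_
  set q := p + m
  have h1 := Real.pow_div_factorial_le_exp (x := r * q) (by positivity) j
  rw [div_le_iff₀ (by positivity), mul_pow] at h1
  have h2 : R ^ q * Real.exp (r * q) ≤ Real.exp q := by
    have := pow_le_pow_left₀ (by positivity) hRr q
    rwa [mul_pow, ← Real.exp_nat_mul, ← Real.exp_nat_mul, mul_one, mul_comm (q : ℝ) r] at this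
  rw [div_mul_eq_mul_div, le_div_iff₀ (by positivity)]
  calc (q : ℝ) ^ j * R ^ q * r ^ j = r ^ j * (q : ℝ) ^ j * R ^ q := by ring
    _ ≤ Real.exp (r * q) * j.factorial * R ^ q := by gcongr
    _ = j.factorial * (R ^ q * Real.exp (r * q)) := by ring
    _ ≤ _ := by gcongr

/-- After `k` steps the power is `k + j` and the shift `m + n₁ + ⋯ + n_k`. The exponential of the
shift factorizes and turns the sums over the `n_i` into `‖V‖^k`. A single factorial appears, to be
compensated by the `1/k!` of the time series. -/
theorem iterate_majorant_weight_le (V : MultiIndex d → ℂ) {R r : ℝ} (hR : 1 ≤ R) (hr : 0 < r)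
    (hRr : R * Real.exp r ≤ Real.exp 1) (k j m p : ℕ) :
    (majorant V)^[k] (weight R j m) p ≤
      ENNReal.ofReal (((k + j).factorial : ℝ) / r ^ (k + j) * Real.exp ((p + m : ℕ) : ℝ)) *
        potentialENorm V ^ k := by
  induction k generalizing j m with
  | zero => simpa using weight_le hR hr hRr j m p
  | succ k ih =>
    rw [Function.iterate_succ_apply]
    refine ((majorant_mono V).iterate k (majorant_weight_le V hR j m) p).trans ?_
    rw [iterate_majorant_tsum]
    refine (ENNReal.tsum_le_tsum fun n => mul_le_mul' le_rfl (ih (j + 1) (m + n))).trans_eq ?_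
    have : ∀ n : ℕ, shellNorm V n * (ENNReal.ofReal (((k + (j + 1)).factorial : ℝ) /
          r ^ (k + (j + 1)) * Real.exp ((p + (m + n) : ℕ) : ℝ)) * potentialENorm V ^ k) =
        (ENNReal.ofReal (((k + (j + 1)).factorial : ℝ) /
          r ^ (k + (j + 1)) * Real.exp ((p + m : ℕ) : ℝ)) * potentialENorm V ^ k) *
          (shellNorm V n * ENNReal.ofReal (Real.exp n)) := by
      intro n
      have : ((p + (m + n) : ℕ) : ℝ) = ((p + m : ℕ) : ℝ) + n := by push_cast; ring
      rw [this, Real.exp_add, ← mul_assoc (_ / _), ENNReal.ofReal_mul (by positivity)]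
      simp only [mul_assoc, mul_comm, mul_left_comm]
    rw [tsum_congr this, ENNReal.tsum_mul_left, ← potentialENorm_eq, pow_succ, mul_assoc,
      show k + 1 + j = k + (j + 1) by ring]

end Liouville

/-! ### The Liouville flow: convergence, stability, linearity, uniqueness -/

section Flow

variable {d : ℕ} {E F : Type*} [NormedAddCommGroup E] [NormedSpace ℂ E]
  [NormedAddCommGroup F] [NormedSpace ℂ F]

theorem iterate_majorant_const_mul (V : MultiIndex d → ℂ) (c : ℝ≥0∞) (g : ℕ → ℝ≥0∞) (k : ℕ) :
    (majorant V)^[k] (fun p => c * g p) = fun p => c * (majorant V)^[k] g p := by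
  induction k with
  | zero => rfl
  | succ k ih =>
    simp only [Function.iterate_succ_apply', ih]
    funext p
    simp only [majorant, mul_left_comm _ c, ENNReal.tsum_mul_left]

/-- The hypotheses under which the growth `R^{|w|}` of functions of words leads to a
Liouville flow for times `|t| ‖V‖ < r`. -/
structure FlowData (V : MultiIndex d → ℂ) (R r : ℝ) : Prop where
  finite : potentialENorm V < ⊤
  one_le : 1 ≤ R
  pos : 0 < r
  mul_exp_le : R * Real.exp r ≤ Real.exp 1

/-- For letters of norm at most one: classical unit vectors, and quantum spins with `s ≥ 1`. -/
theorem FlowData.one {V : MultiIndex d → ℂ} (hV : potentialENorm V < ⊤) : FlowData V 1 1 :=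
  ⟨hV, le_rfl, one_pos, by simp⟩

/-- Covers every spin, including `s = 1/2`, where the rescaled `S_±` have norm `√2`. The price is a
shorter time of convergence. -/
theorem FlowData.half {V : MultiIndex d → ℂ} (hV : potentialENorm V < ⊤) :
    FlowData V (3 / 2) (1 / 2) := by
  refine ⟨hV, by norm_num, by norm_num, ?_⟩
  have h1 := Real.add_one_le_exp (1 / 2 : ℝ)
  have h2 : Real.exp 1 = Real.exp (1 / 2) * Real.exp (1 / 2) := by
    rw [← Real.exp_add]; norm_num
  rw [h2]
  gcongr
  linarith

variable {V V' : MultiIndex d → ℂ} {R r c : ℝ} {j : ℕ}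

/-- The weight `c p^j R^p` of words of length `p`. -/
def scaledWeight (c R : ℝ) (j p : ℕ) : ℝ≥0∞ := ENNReal.ofReal c * weight R j 0 p

theorem enorm_le_scaledWeight {E : Type*} [NormedAddCommGroup E] (hc : 0 ≤ c) {x : E} {p : ℕ}
    (h : ‖x‖ ≤ c * ((p : ℝ) ^ j * R ^ p)) : ‖x‖ₑ ≤ scaledWeight c R j p := by
  rw [← ofReal_norm, scaledWeight, weight, ← ENNReal.ofReal_mul hc]
  exact ENNReal.ofReal_le_ofReal (by simpa using h)

theorem iterate_majorant_scaledWeight_le (h : FlowData V R r) (hc : 0 ≤ c) (k p : ℕ) :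
    (majorant V)^[k] (scaledWeight c R j) p ≤
      ENNReal.ofReal (c * (((k + j).factorial : ℝ) / r ^ (k + j) * Real.exp p) *
        potentialNorm V ^ k) := by
  have h1 := iterate_majorant_const_mul V (ENNReal.ofReal c) (weight R j 0) k
  have h2 : (majorant V)^[k] (scaledWeight c R j) p =
      ENNReal.ofReal c * (majorant V)^[k] (weight R j 0) p := congrFun h1 p
  have hr := h.pos
  rw [h2, mul_assoc, ENNReal.ofReal_mul hc, ENNReal.ofReal_mul (by positivity), potentialNorm,
    ENNReal.ofReal_pow ENNReal.toReal_nonneg, ENNReal.ofReal_toReal h.finite.ne]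
  refine mul_le_mul' le_rfl ?_
  simpa using iterate_majorant_weight_le V h.one_le h.pos h.mul_exp_le k j 0 p

theorem iterate_majorant_scaledWeight_ne_top (h : FlowData V R r) (hc : 0 ≤ c) (k p : ℕ) :
    (majorant V)^[k] (scaledWeight c R j) p ≠ ⊤ :=
  ne_top_of_le_ne_top ENNReal.ofReal_ne_top (iterate_majorant_scaledWeight_le h hc k p)

theorem norm_iterate_liouville_le (h : FlowData V R r) (hV : ∀ α, ‖V' α‖ ≤ ‖V α‖) (hc : 0 ≤ c)
    {φ : Word d → E} (hφ : ∀ v, ‖φ v‖ ≤ c * ((v.length : ℝ) ^ j * R ^ v.length))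
    (k : ℕ) (w : Word d) :
    ‖(liouville V')^[k] φ w‖ ≤
      c * (((k + j).factorial : ℝ) / r ^ (k + j) * Real.exp w.length) * potentialNorm V ^ k := by
  have hr := h.pos
  have h0 : 0 ≤ potentialNorm V := ENNReal.toReal_nonneg
  have h1 := (enorm_iterate_liouville_le hV (fun v => enorm_le_scaledWeight hc (hφ v))
    k w).trans (iterate_majorant_scaledWeight_le h hc k w.length)
  rw [← ofReal_norm] at h1
  exact (ENNReal.ofReal_le_ofReal_iff (by positivity)).1 h1

/-- The majorant of the `k`-th term of the Liouville flow at a word of length `p`. -/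
def flowBound (V : MultiIndex d → ℂ) (r c τ : ℝ) (j p k : ℕ) : ℝ :=
  c * Real.exp p / r ^ j * (((k + j).descFactorial j : ℝ) * (τ * potentialNorm V / r) ^ k)

theorem summable_flowBound (hr : 0 < r) {τ : ℝ} (hτ0 : 0 ≤ τ) (hτ : τ * potentialNorm V < r)
    (p : ℕ) : Summable (flowBound V r c τ j p) := by
  refine Summable.mul_left _ (summable_descFactorial_mul_geometric_of_norm_lt_one j ?_)
  have h0 : 0 ≤ potentialNorm V := ENNReal.toReal_nonneg
  rw [Real.norm_of_nonneg (by positivity), div_lt_one hr]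
  exact hτ

/-- The quotient `(k + j)!/k!` is polynomial in `k`, so the series is geometric with ratio `τ‖V‖/r`
up to a polynomial factor. -/
theorem norm_flowTerm_le (h : FlowData V R r) (hV : ∀ α, ‖V' α‖ ≤ ‖V α‖) (hc : 0 ≤ c)
    {φ : Word d → E} (hφ : ∀ v, ‖φ v‖ ≤ c * ((v.length : ℝ) ^ j * R ^ v.length))
    {t τ : ℝ} (ht : |t| ≤ τ) (k : ℕ) (w : Word d) :
    ‖(t ^ k / k.factorial : ℝ) • (liouville V')^[k] φ w‖ ≤ flowBound V r c τ j w.length k := by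
  have hr := h.pos
  rw [norm_smul, norm_div, norm_pow, Real.norm_eq_abs, Real.norm_natCast]
  have h0 : 0 ≤ potentialNorm V := ENNReal.toReal_nonneg
  refine (mul_le_mul (div_le_div_of_nonneg_right (pow_le_pow_left₀ (abs_nonneg t) ht k)
    (by positivity)) (norm_iterate_liouville_le h hV hc hφ k w) (norm_nonneg _)
    (by have := (abs_nonneg t).trans ht; positivity)).trans_eq ?_
  have h2 : ((k + j).factorial : ℝ) = k.factorial * (k + j).descFactorial j := by
    have := Nat.factorial_mul_descFactorial (n := k + j) (k := j) (Nat.le_add_left _ _)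
    rw [Nat.add_sub_cancel] at this
    exact_mod_cast this.symm
  rw [flowBound, h2, div_pow, mul_pow, pow_add]
  field_simp

/-- The flow generated by the Liouville operator, as a power series in time. -/
def flow (V : MultiIndex d → ℂ) (t : ℝ) (φ : Word d → E) (w : Word d) : E :=
  ∑' k : ℕ, (t ^ k / k.factorial : ℝ) • (liouville V)^[k] φ w

theorem summable_flow [CompleteSpace E] (h : FlowData V R r) (hV : ∀ α, ‖V' α‖ ≤ ‖V α‖)
    (hc : 0 ≤ c)
    {φ : Word d → E} (hφ : ∀ v, ‖φ v‖ ≤ c * ((v.length : ℝ) ^ j * R ^ v.length))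
    {t : ℝ} (ht : |t| * potentialNorm V < r) (w : Word d) :
    Summable fun k : ℕ => (t ^ k / k.factorial : ℝ) • (liouville V')^[k] φ w :=
  .of_norm_bounded (summable_flowBound h.pos (abs_nonneg t) ht w.length)
    fun k => norm_flowTerm_le h hV hc hφ le_rfl k w

theorem norm_flow_le (h : FlowData V R r) (hV : ∀ α, ‖V' α‖ ≤ ‖V α‖) (hc : 0 ≤ c)
    {φ : Word d → E} (hφ : ∀ v, ‖φ v‖ ≤ c * ((v.length : ℝ) ^ j * R ^ v.length))
    {t τ : ℝ} (ht : |t| ≤ τ) (hτ : τ * potentialNorm V < r) (w : Word d) :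
    ‖flow V' t φ w‖ ≤ ∑' k, flowBound V r c τ j w.length k :=
  tsum_of_norm_bounded (summable_flowBound h.pos ((abs_nonneg t).trans ht) hτ w.length).hasSum
    fun k => norm_flowTerm_le h hV hc hφ ht k w

/-! ### Dominated convergence -/

section Convergence

variable {ι : Type*} {ℱ : Filter ι} {W : ι → MultiIndex d → ℂ} {φ : ι → Word d → E}
  {φ' : Word d → E}

theorem tendsto_bracketSum (hφ' : ∀ v, Tendsto (fun i => φ i v) ℱ (𝓝 (φ' v))) (u w : Word d) :
    Tendsto (fun i => bracketSum u w (φ i)) ℱ (𝓝 (bracketSum u w φ')) :=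
  tendsto_finsetSum _ fun _ _ => tendsto_finsetSum _ fun _ _ => (hφ' _).const_smul _

theorem tendsto_iterate_liouville [CompleteSpace E] (hW : ∀ i α, ‖W i α‖ ≤ ‖V α‖)
    (hW' : ∀ α, Tendsto (fun i => W i α) ℱ (𝓝 (V' α))) {g : ℕ → ℝ≥0∞}
    (hg : ∀ k p, (majorant V)^[k] g p ≠ ⊤) (hφ : ∀ᶠ i in ℱ, ∀ v, ‖φ i v‖ₑ ≤ g v.length)
    (hφ' : ∀ v, Tendsto (fun i => φ i v) ℱ (𝓝 (φ' v))) (k : ℕ) :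
    ∀ w, Tendsto (fun i => (liouville (W i))^[k] (φ i) w) ℱ (𝓝 ((liouville V')^[k] φ' w)) := by
  induction k with
  | zero => exact hφ'
  | succ k ih =>
    intro w
    simp only [Function.iterate_succ_apply']
    have hk := hg (k + 1) w.length
    rw [Function.iterate_succ_apply'] at hk
    refine tendsto_tsum_of_dominated_convergence (summable_majorantTerm hk)
      (fun α => (hW' α).smul (tendsto_bracketSum ih _ w)) ?_
    filter_upwards [hφ] with i hi α
    exact norm_term_le (hW i) (enorm_iterate_liouville_le (hW i) hi k) hk α

/-- Dominated convergence in the power series. The times `σ i` are only bounded and need not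
converge, hence a difference of flows is compared with zero; this later gives uniformity in time. -/
theorem tendsto_flow_sub_flow [CompleteSpace E] (h : FlowData V R r)
    (hW : ∀ i α, ‖W i α‖ ≤ ‖V α‖) (hV : ∀ α, ‖V' α‖ ≤ ‖V α‖)
    (hW' : ∀ α, Tendsto (fun i => W i α) ℱ (𝓝 (V' α))) (hc : 0 ≤ c)
    (hφ : ∀ᶠ i in ℱ, ∀ v, ‖φ i v‖ ≤ c * ((v.length : ℝ) ^ j * R ^ v.length))
    (hφ'b : ∀ v, ‖φ' v‖ ≤ c * ((v.length : ℝ) ^ j * R ^ v.length))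
    (hφ' : ∀ v, Tendsto (fun i => φ i v) ℱ (𝓝 (φ' v))) {σ : ι → ℝ} {τ : ℝ}
    (hσ : ∀ᶠ i in ℱ, |σ i| ≤ τ) (hτ0 : 0 ≤ τ) (hτ : τ * potentialNorm V < r) (w : Word d) :
    Tendsto (fun i => flow (W i) (σ i) (φ i) w - flow V' (σ i) φ' w) ℱ (𝓝 0) := by
  have hlt : ∀ {t : ℝ}, |t| ≤ τ → |t| * potentialNorm V < r := fun ht =>
    (mul_le_mul_of_nonneg_right ht ENNReal.toReal_nonneg).trans_lt hτ
  have e : (fun i => ∑' k : ℕ, (((σ i) ^ k / k.factorial : ℝ) • (liouville (W i))^[k] (φ i) w -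
      ((σ i) ^ k / k.factorial : ℝ) • (liouville V')^[k] φ' w)) =ᶠ[ℱ]
      fun i => flow (W i) (σ i) (φ i) w - flow V' (σ i) φ' w := by
    filter_upwards [hφ, hσ] with i hi hs
    exact (summable_flow h (hW i) hc hi (hlt hs) w).tsum_sub
      (summable_flow h hV hc hφ'b (hlt hs) w)
  refine Tendsto.congr' e ?_
  rw [← tsum_zero (β := ℕ) (α := E)]
  refine tendsto_tsum_of_dominated_convergence (bound := fun k => flowBound V r c τ j w.length k +
    flowBound V r c τ j w.length k) ((summable_flowBound h.pos hτ0 hτ w.length).add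
      (summable_flowBound h.pos hτ0 hτ w.length)) (fun k => ?_) ?_
  · have h1 := tendsto_iterate_liouville hW hW' (iterate_majorant_scaledWeight_ne_top h hc)
      (hφ.mono fun i hi v => enorm_le_scaledWeight hc (hi v)) hφ' k w
    have h2 := (tendsto_sub_nhds_zero_iff.2 h1).norm.const_mul (τ ^ k / k.factorial : ℝ)
    rw [norm_zero, mul_zero] at h2
    refine squeeze_zero_norm' ?_ h2
    filter_upwards [hσ] with i hs
    rw [← smul_sub, norm_smul, norm_div, norm_pow, Real.norm_eq_abs, Real.norm_natCast]
    gcongr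
  · filter_upwards [hφ, hσ] with i hi hs k
    exact (norm_sub_le _ _).trans (add_le_add (norm_flowTerm_le h (hW i) hc hi hs k w)
      (norm_flowTerm_le h hV hc hφ'b hs k w))

end Convergence

/-! ### Linear functionals -/

theorem bracketSum_map (L : E →L[ℂ] F) (u w : Word d) (φ : Word d → E) :
    bracketSum u w (fun v => L (φ v)) = L (bracketSum u w φ) := by
  simp [bracketSum, map_sum]

theorem bracketSum_sub (u w : Word d) (φ ψ : Word d → E) :
    bracketSum u w (fun v => φ v - ψ v) = bracketSum u w φ - bracketSum u w ψ := by
  simp [bracketSum, smul_sub, Finset.sum_sub_distrib]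

theorem bracketSum_zero (u w : Word d) : bracketSum u w (fun _ => (0 : E)) = 0 := by
  simp [bracketSum]

theorem iterate_liouville_zero (k : ℕ) :
    (liouville V)^[k] (fun _ : Word d => (0 : E)) = fun _ => 0 := by
  induction k with
  | zero => rfl
  | succ k ih =>
    rw [Function.iterate_succ_apply', ih]
    funext w
    simp [liouville, bracketSum_zero]

theorem flow_zero (t : ℝ) (w : Word d) : flow V t (fun _ : Word d => (0 : E)) w = 0 := by
  simp [flow, iterate_liouville_zero]

/-- Each application of the Liouville operator is an infinite sum, and a linear map passes through
it only by convergence; this is what the growth hypothesis provides. -/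
theorem iterate_liouville_map [CompleteSpace E] (h : FlowData V R r) (L : E →L[ℂ] F) (hc : 0 ≤ c)
    {φ : Word d → E} (hφ : ∀ v, ‖φ v‖ ≤ c * ((v.length : ℝ) ^ j * R ^ v.length)) (k : ℕ) :
    (liouville V)^[k] (fun v => L (φ v)) = fun w => L ((liouville V)^[k] φ w) := by
  induction k with
  | zero => rfl
  | succ k ih =>
    rw [Function.iterate_succ_apply', Function.iterate_succ_apply', ih]
    funext w
    have hs := summable_liouville (V := V) (V' := V) (w := w) (fun α => le_rfl)
      (enorm_iterate_liouville_le (fun α => le_rfl)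
        (fun v => enorm_le_scaledWeight hc (hφ v)) k) (by
        rw [← Function.iterate_succ_apply' (majorant V)]
        exact iterate_majorant_scaledWeight_ne_top h hc (k + 1) w.length)
    rw [liouville, liouville, L.map_tsum hs]
    exact tsum_congr fun α => by rw [bracketSum_map, map_smul]

theorem flow_map [CompleteSpace E] (h : FlowData V R r) (L : E →L[ℂ] F) (hc : 0 ≤ c)
    {φ : Word d → E} (hφ : ∀ v, ‖φ v‖ ≤ c * ((v.length : ℝ) ^ j * R ^ v.length))
    {t : ℝ} (ht : |t| * potentialNorm V < r) (w : Word d) :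
    flow V t (fun v => L (φ v)) w = L (flow V t φ w) := by
  rw [flow, flow, L.map_tsum (summable_flow h (fun _ => le_rfl) hc hφ ht w)]
  refine tsum_congr fun k => ?_
  rw [iterate_liouville_map h L hc hφ, L.map_smul_of_tower]

theorem iterate_liouville_sub [CompleteSpace E] (h : FlowData V R r) (hc : 0 ≤ c)
    {φ ψ : Word d → E} (hφ : ∀ v, ‖φ v‖ ≤ c * ((v.length : ℝ) ^ j * R ^ v.length))
    (hψ : ∀ v, ‖ψ v‖ ≤ c * ((v.length : ℝ) ^ j * R ^ v.length)) (k : ℕ) :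
    (liouville V)^[k] (fun v => φ v - ψ v) =
      fun w => (liouville V)^[k] φ w - (liouville V)^[k] ψ w := by
  induction k with
  | zero => rfl
  | succ k ih =>
    simp only [Function.iterate_succ_apply', ih]
    funext w
    have hs : ∀ {χ : Word d → E}, (∀ v, ‖χ v‖ ≤ c * ((v.length : ℝ) ^ j * R ^ v.length)) → _ :=
      fun {χ} hχ => summable_liouville (V := V) (V' := V) (w := w) (fun α => le_rfl)
      (enorm_iterate_liouville_le (fun α => le_rfl)
        (fun v => enorm_le_scaledWeight hc (hχ v)) k) (by
        rw [← Function.iterate_succ_apply' (majorant V)]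
        exact iterate_majorant_scaledWeight_ne_top h hc (k + 1) w.length)
    rw [liouville, liouville, liouville, ← (hs hφ).tsum_sub (hs hψ)]
    exact tsum_congr fun α => by rw [bracketSum_sub, smul_sub]

theorem flow_sub [CompleteSpace E] (h : FlowData V R r) (hc : 0 ≤ c)
    {φ ψ : Word d → E} (hφ : ∀ v, ‖φ v‖ ≤ c * ((v.length : ℝ) ^ j * R ^ v.length))
    (hψ : ∀ v, ‖ψ v‖ ≤ c * ((v.length : ℝ) ^ j * R ^ v.length))
    {t : ℝ} (ht : |t| * potentialNorm V < r) (w : Word d) :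
    flow V t (fun v => φ v - ψ v) w = flow V t φ w - flow V t ψ w := by
  rw [flow, flow, flow, ← (summable_flow h (fun _ => le_rfl) hc hφ ht w).tsum_sub
    (summable_flow h (fun _ => le_rfl) hc hψ ht w)]
  refine tsum_congr fun k => ?_
  rw [iterate_liouville_sub h hc hφ hψ, smul_sub]

/-! ### Solutions of the Liouville equation -/

/-- Derivatives of size `k! q^k` force the Taylor series at any point to represent the function
within distance `1/q`. -/
theorem hasSum_taylor {f : ℕ → ℝ → E} (hf : ∀ k t, HasDerivAt (f k) (f (k + 1) t) t)
    {C q : ℝ} (hq : 0 ≤ q) (hb : ∀ k t, ‖f k t‖ ≤ C * (k.factorial * q ^ k)) (t : ℝ) {τ : ℝ}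
    (hτ : |τ| * q < 1) :
    Tendsto (fun n => ∑ k ∈ Finset.range n, (τ ^ k / k.factorial : ℝ) • f k t) atTop
      (𝓝 (f 0 (t + τ))) := by
  -- The Taylor polynomial with base point `t + σ`, evaluated at `t + τ`. It is the partial sum at
  -- `σ = 0` and the value itself at `σ = τ`, and its derivative in `σ` telescopes to one term.
  set G : ℕ → ℝ → E := fun n σ =>
    ∑ k ∈ Finset.range n, ((τ - σ) ^ k / k.factorial : ℝ) • f k (t + σ) with hG
  have hG0 : ∀ n, G n 0 = ∑ k ∈ Finset.range n, (τ ^ k / k.factorial : ℝ) • f k t := by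
    intro n; simp [hG]
  have hG1 : ∀ n, G (n + 1) τ = f 0 (t + τ) := by
    intro n
    rw [hG]
    simp only [sub_self]
    rw [Finset.sum_range_succ']
    simp
  have hder : ∀ n σ, HasDerivAt (G (n + 1))
      (((τ - σ) ^ n / n.factorial : ℝ) • f (n + 1) (t + σ)) σ := by
    intro n σ
    have hfd : ∀ k, HasDerivAt (fun σ => f k (t + σ)) (f (k + 1) (t + σ)) σ := fun k => by
      simpa using (hf k (t + σ)).comp_const_add t σ
    induction n with
    | zero =>
      have : G (0 + 1) = fun σ => f 0 (t + σ) := by funext σ; simp [hG]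
      rw [this]
      simpa using hfd 0
    | succ n ih =>
      have e : G (n + 1 + 1) = fun σ => G (n + 1) σ +
          ((τ - σ) ^ (n + 1) / (n + 1).factorial : ℝ) • f (n + 1) (t + σ) := by
        funext σ
        simp only [hG]
        rw [Finset.sum_range_succ]
      rw [e]
      have hp : HasDerivAt (fun σ : ℝ => (τ - σ) ^ (n + 1) / ((n + 1).factorial : ℝ))
          (-((τ - σ) ^ n / n.factorial)) σ := by
        have := (((hasDerivAt_id σ).const_sub τ).pow (n + 1)).div_const ((n + 1).factorial : ℝ)
        refine this.congr_deriv ?_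
        rw [Nat.factorial_succ, Nat.add_sub_cancel, id]
        push_cast
        field_simp
      refine (ih.fun_add (hp.fun_smul (hfd (n + 1)))).congr_deriv ?_
      rw [neg_smul]
      abel
  -- The mean value inequality loses a factor `n + 1` against the integral remainder, harmless
  -- beside the geometric decay.
  have hbound : ∀ n : ℕ, ‖f 0 (t + τ) -
      ∑ k ∈ Finset.range (n + 1), (τ ^ k / k.factorial : ℝ) • f k t‖ ≤
      C * ((n + 1 : ℕ) * (|τ| * q) ^ (n + 1)) := by
    intro n
    rw [← hG0, ← hG1 n]
    have := (convex_uIcc (0 : ℝ) τ).norm_image_sub_le_of_norm_hasDerivWithin_le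
      (f := G (n + 1)) (C := |τ| ^ n / n.factorial * (C * ((n + 1).factorial * q ^ (n + 1))))
      (fun σ _ => (hder n σ).hasDerivWithinAt) (fun σ hσ => ?_) Set.left_mem_uIcc
      Set.right_mem_uIcc
    · refine this.trans_eq ?_
      rw [sub_zero, Real.norm_eq_abs, Nat.factorial_succ, mul_pow, pow_succ |τ|]
      push_cast
      field_simp
    · rw [norm_smul, norm_div, norm_pow, Real.norm_eq_abs, Real.norm_natCast]
      have h1 : |τ - σ| ≤ |τ| := by
        have := Set.abs_sub_right_of_mem_uIcc hσ
        simpa using this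
      have h2 := hb (n + 1) (t + σ)
      gcongr
  rw [← tendsto_add_atTop_iff_nat 1]
  refine tendsto_iff_norm_sub_tendsto_zero.2 (squeeze_zero (fun _ => norm_nonneg _)
    (fun n => (norm_sub_rev _ _).trans_le (hbound n)) ?_)
  have h1 := tendsto_self_mul_const_pow_of_abs_lt_one
    (r := |τ| * q) (by rwa [abs_of_nonneg (by positivity)])
  simpa using ((tendsto_add_atTop_iff_nat 1).2 h1).const_mul C

theorem hasDerivAt_bracketSum {φ φ' : ℝ → Word d → E}
    (hφ : ∀ t v, HasDerivAt (fun t => φ t v) (φ' t v) t) (u w : Word d) (t : ℝ) :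
    HasDerivAt (fun t => bracketSum u w (φ t)) (bracketSum u w (φ' t)) t :=
  HasDerivAt.fun_sum fun _ _ => HasDerivAt.fun_sum fun _ _ => (hφ t _).const_smul (_ : ℂ)

theorem hasDerivAt_liouville [CompleteSpace E] {g g' : ℕ → ℝ≥0∞}
    (hV : ∀ α, ‖V' α‖ ≤ ‖V α‖) {φ φ' : ℝ → Word d → E}
    (hφ : ∀ t v, HasDerivAt (fun t => φ t v) (φ' t v) t) (hg : ∀ t v, ‖φ t v‖ₑ ≤ g v.length)
    (hg' : ∀ t v, ‖φ' t v‖ₑ ≤ g' v.length) (w : Word d) (h : majorant V g w.length ≠ ⊤)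
    (h' : majorant V g' w.length ≠ ⊤) (t : ℝ) :
    HasDerivAt (fun t => liouville V' (φ t) w) (liouville V' (φ' t) w) t :=
  hasDerivAt_tsum (summable_majorantTerm h')
    (fun α t => (hasDerivAt_bracketSum hφ _ w t).const_smul (V' α))
    (fun α t => norm_term_le hV (hg' t) h' α) (summable_liouville hV (hg t) h) t

/-- A bounded solution of the Liouville equation is given by the flow. -/
theorem eq_flow_of_hasDerivAt [CompleteSpace E] (h : FlowData V R r)
    (hV : ∀ α, ‖V' α‖ ≤ ‖V α‖) {φ : ℝ → Word d → E}
    (hφ : ∀ t v, HasDerivAt (fun t => φ t v) (liouville V' (φ t) v) t)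
    (hb : ∀ t v, ‖φ t v‖ ≤ R ^ v.length) (t : ℝ) {τ : ℝ} (hτ : |τ| * potentialNorm V < r)
    (w : Word d) : φ (t + τ) w = flow V' τ (φ t) w := by
  have hr := h.pos
  have hb' : ∀ t v, ‖φ t v‖ ≤ 1 * ((v.length : ℝ) ^ 0 * R ^ v.length) := fun t v => by
    simpa using hb t v
  have hW : ∀ t v, ‖φ t v‖ₑ ≤ scaledWeight 1 R 0 v.length := fun t v =>
    enorm_le_scaledWeight zero_le_one (hb' t v)
  -- The iterates of the Liouville operator are the time derivatives of the solution. Termwise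
  -- differentiation is justified because the bound `R^|v|` is uniform in time.
  have hder : ∀ k t v, HasDerivAt (fun t => (liouville V')^[k] (φ t) v)
      ((liouville V')^[k + 1] (φ t) v) t := by
    intro k
    induction k with
    | zero => exact hφ
    | succ k ih =>
      intro t v
      rw [Function.iterate_succ_apply' _ (k + 1)]
      simp only [Function.iterate_succ_apply' (liouville V') k (φ _)]
      simp only [Function.iterate_succ_apply' (liouville V') k (φ _)] at ih
      refine hasDerivAt_liouville hV ih (fun t => enorm_iterate_liouville_le hV (hW t) k)
        (fun t v => by
          rw [← Function.iterate_succ_apply' (liouville V')]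
          exact enorm_iterate_liouville_le hV (hW t) (k + 1) v) v ?_ ?_ t
      · rw [← Function.iterate_succ_apply' (majorant V)]
        exact iterate_majorant_scaledWeight_ne_top h zero_le_one (k + 1) v.length
      · rw [← Function.iterate_succ_apply' (majorant V)]
        exact iterate_majorant_scaledWeight_ne_top h zero_le_one (k + 1 + 1) v.length
  have h0 : 0 ≤ potentialNorm V := ENNReal.toReal_nonneg
  have h1 := hasSum_taylor (f := fun k t => (liouville V')^[k] (φ t) w) (q := potentialNorm V / r)
    (C := Real.exp w.length) (fun k t => hder k t w) (by positivity) (fun k t => by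
      refine (norm_iterate_liouville_le h hV zero_le_one (hb' t) k w).trans_eq ?_
      rw [div_pow, add_zero]
      field_simp) t (τ := τ) (by rwa [← mul_div_assoc, div_lt_one hr])
  exact tendsto_nhds_unique h1 (summable_flow h hV zero_le_one (hb' t) hτ w).hasSum.tendsto_sum_nat

end Flow

/-! ### Spin matrices -/

section SpinMatrices

theorem star_spinMatrix (N : ℕ) (i : Ladder) : star (spinMatrix N i) = spinMatrix N i.conj := by
  have h1 : star (spinMatrix N .minus) = spinMatrix N .plus := by
    ext j k
    simp only [spinMatrix, Matrix.star_apply, Matrix.of_apply]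
    split_ifs <;> simp
  cases i
  · rw [← h1, star_star]; rfl
  · ext j k
    simp only [spinMatrix, Matrix.star_apply, Ladder.conj, Matrix.diagonal_apply]
    by_cases h : j = k
    · subst h; simp
    · simp [h, Ne.symm h]
  · exact h1

theorem plus_mul_minus (N : ℕ) : spinMatrix N .plus * spinMatrix N .minus =
    Matrix.diagonal fun j : Fin (N + 1) => (((((j : ℕ) : ℝ) + 1) * (N - (j : ℕ)) / 2 : ℝ) : ℂ) := by
  ext j k
  rw [Matrix.mul_apply, Matrix.diagonal_apply]
  simp only [spinMatrix, Matrix.of_apply]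
  by_cases hj : (j : ℕ) + 1 < N + 1
  · rw [Finset.sum_eq_single (⟨j + 1, hj⟩ : Fin (N + 1))]
    · by_cases h : j = k
      · subst h
        have h0 : (0 : ℝ) ≤ (((j : ℕ) + 1 : ℕ) : ℝ) * (N + 1 - ((j : ℕ) + 1 : ℕ)) / 2 := by
          have : (((j : ℕ) + 1 : ℕ) : ℝ) ≤ N + 1 := by exact_mod_cast hj.le
          have : 0 ≤ (N : ℝ) + 1 - ((j : ℕ) + 1 : ℕ) := by linarith
          positivity
        simp only [if_true]
        rw [← Complex.ofReal_mul, Real.mul_self_sqrt h0]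
        push_cast
        ring
      · have h' : ¬ (k : ℕ) = j := fun e => h (Fin.ext e.symm)
        simp [h, h']
    · intro l _ hl
      rw [if_neg, zero_mul]
      intro e
      exact hl (Fin.ext e.symm)
    · simp
  · rw [Finset.sum_eq_zero]
    · have : (j : ℕ) = N := by omega
      simp [this]
    · intro l _
      rw [if_neg (by omega), zero_mul]

theorem minus_mul_plus (N : ℕ) : spinMatrix N .minus * spinMatrix N .plus =
    Matrix.diagonal fun j : Fin (N + 1) => ((((j : ℕ) : ℝ) * (N + 1 - (j : ℕ)) / 2 : ℝ) : ℂ) := by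
  ext j k
  rw [Matrix.mul_apply, Matrix.diagonal_apply]
  simp only [spinMatrix, Matrix.of_apply]
  by_cases hj : 0 < (j : ℕ)
  · rw [Finset.sum_eq_single (⟨j - 1, by omega⟩ : Fin (N + 1))]
    · by_cases h : j = k
      · subst h
        have h0 : (0 : ℝ) ≤ ((j : ℕ) : ℝ) * (N + 1 - (j : ℕ)) / 2 := by
          have : ((j : ℕ) : ℝ) ≤ N + 1 := by exact_mod_cast j.2.le
          have : 0 ≤ (N : ℝ) + 1 - (j : ℕ) := by linarith
          positivity
        have e : (j : ℕ) - 1 + 1 = j := by omega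
        simp only [e, if_true]
        rw [← Complex.ofReal_mul, Real.mul_self_sqrt h0]
      · have h1 : ¬ (j : ℕ) = k := fun e => h (Fin.ext e)
        have h2 : ¬ (j : ℕ) - 1 + 1 = k := by omega
        simp [h, h2]
    · intro l _ hl
      rw [if_neg, zero_mul]
      intro e
      exact hl (Fin.ext (by simp; omega))
    · simp
  · rw [Finset.sum_eq_zero]
    · have : (j : ℕ) = 0 := by omega
      simp [this]
    · intro l _
      rw [if_neg (by omega), zero_mul]

theorem commutator_plus_minus (N : ℕ) :
    spinMatrix N .plus * spinMatrix N .minus - spinMatrix N .minus * spinMatrix N .plus =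
      spinMatrix N .z := by
  rw [plus_mul_minus, minus_mul_plus, Matrix.diagonal_sub, spinMatrix]
  congr 1
  funext j
  push_cast
  ring

theorem commutator_z_plus (N : ℕ) :
    spinMatrix N .z * spinMatrix N .plus - spinMatrix N .plus * spinMatrix N .z =
      spinMatrix N .plus := by
  ext j k
  simp only [spinMatrix, Matrix.sub_apply, Matrix.diagonal_mul, Matrix.mul_diagonal,
    Matrix.of_apply]
  split_ifs with h
  · rw [← h]
    push_cast
    ring
  · simp

theorem commutator_z_minus (N : ℕ) :
    spinMatrix N .z * spinMatrix N .minus - spinMatrix N .minus * spinMatrix N .z =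
      -spinMatrix N .minus := by
  ext j k
  simp only [spinMatrix, Matrix.sub_apply, Matrix.diagonal_mul, Matrix.mul_diagonal,
    Matrix.of_apply, Matrix.neg_apply]
  split_ifs with h
  · rw [← h]
    push_cast
    ring
  · simp

/-- The commutation relations of `su(2)` in ladder components. -/
theorem commutator_spinMatrix (N : ℕ) (i j : Ladder) :
    spinMatrix N i * spinMatrix N j - spinMatrix N j * spinMatrix N i =
      epsTilde i j (i.bracket j) • spinMatrix N (i.bracket j) := by
  have h1 := commutator_plus_minus N
  have h2 := commutator_z_plus N
  have h3 := commutator_z_minus N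
  cases i <;> cases j <;> simp only [epsTilde, Ladder.bracket, sub_self, zero_smul, one_smul,
    neg_smul]
  · rw [← neg_sub, h2]
  · exact h1
  · exact h2
  · exact h3
  · rw [← neg_sub, h1]
  · rw [← neg_sub, h3, neg_neg]

/-- By the C*-identity `‖S_+‖² = ‖S_+ S_-‖`, and this product is diagonal with entries `(j + 1)(N -
j)/2`. -/
theorem norm_spinMatrix_le (N : ℕ) {b : ℝ} (hb : (N : ℝ) / 2 ≤ b)
    (h : ∀ j : ℕ, j ≤ N → ((j + 1 : ℝ) * (N - j) / 2 : ℝ) ≤ b * b) (i : Ladder) :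
    ‖spinMatrix N i‖ ≤ b := by
  have hb0 : 0 ≤ b := le_trans (by positivity) hb
  have hp : ‖spinMatrix N .plus‖ ≤ b := by
    have h1 := CStarRing.norm_self_mul_star (x := spinMatrix N .plus)
    rw [star_spinMatrix, Ladder.conj, plus_mul_minus, Matrix.l2_opNorm_diagonal] at h1
    refine abs_le_of_sq_le_sq' ?_ hb0 |>.2
    rw [sq, sq, ← h1, pi_norm_le_iff_of_nonneg (by positivity)]
    intro j
    have hj : ((j : ℕ) : ℝ) ≤ N := by exact_mod_cast Nat.lt_succ_iff.1 j.2
    rw [Complex.norm_real, Real.norm_of_nonneg (by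
      have : 0 ≤ (N : ℝ) - (j : ℕ) := by linarith
      positivity)]
    exact h j (Nat.lt_succ_iff.1 j.2)
  cases i
  · exact hp
  · rw [spinMatrix, Matrix.l2_opNorm_diagonal, pi_norm_le_iff_of_nonneg hb0]
    intro j
    have hj : ((j : ℕ) : ℝ) ≤ N := by exact_mod_cast Nat.lt_succ_iff.1 j.2
    have e : (N : ℂ) / 2 - ((j : ℕ) : ℂ) = (((N : ℝ) / 2 - ((j : ℕ) : ℝ) : ℝ) : ℂ) := by
      push_cast; rfl
    rw [e, Complex.norm_real, Real.norm_eq_abs, abs_le]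
    constructor <;> linarith [(Nat.cast_nonneg (j : ℕ) : (0 : ℝ) ≤ (j : ℕ))]
  · have : spinMatrix N .minus = star (spinMatrix N .plus) := by rw [star_spinMatrix]; rfl
    rw [this, norm_star]
    exact hp

theorem norm_scaled_spinMatrix_le {N : ℕ} (hN : 1 ≤ N) {R : ℝ} (hR : 1 ≤ R)
    (h : ∀ j : ℕ, j ≤ N → ((j + 1 : ℝ) * (N - j) / 2 : ℝ) ≤ (R * (N / 2)) * (R * (N / 2)))
    (i : Ladder) : ‖((N : ℂ) / 2)⁻¹ • spinMatrix N i‖ ≤ R := by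
  have hN' : (0 : ℝ) < N := by exact_mod_cast hN
  have h1 := norm_spinMatrix_le N (b := R * (N / 2)) (by nlinarith) h i
  rw [norm_smul, norm_inv, norm_div, Complex.norm_natCast, Complex.norm_ofNat,
    inv_mul_le_iff₀ (by positivity), mul_comm]
  exact h1

/-- A bound for the norms of the rescaled spin operators. -/
def SpinBound (N : ℕ) (R : ℝ) : Prop :=
  1 ≤ R ∧ ∀ i, ‖((N : ℂ) / 2)⁻¹ • spinMatrix N i‖ ≤ R

/-- `(j + 1)(N - j) ≤ (N + 1)²/4`, and `2(N + 1)² ≤ 9N²` for `N ≥ 1`. -/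
theorem spinBound_half {N : ℕ} (hN : 1 ≤ N) : SpinBound N (3 / 2) := by
  refine ⟨by norm_num, norm_scaled_spinMatrix_le hN (by norm_num) fun j hj => ?_⟩
  have h1 : (1 : ℝ) ≤ N := by exact_mod_cast hN
  nlinarith [sq_nonneg ((2 * j + 1 : ℝ) - N)]

theorem spinBound_one {N : ℕ} (hN : 2 ≤ N) : SpinBound N 1 := by
  refine ⟨le_rfl, norm_scaled_spinMatrix_le (by omega) le_rfl fun j hj => ?_⟩
  -- For real `j` the bound 1 would need `(N + 1)² ≤ 2N²`, which fails at `N = 2`; there the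
  -- integrality of `j` is used.
  obtain rfl | h3 := hN.eq_or_lt
  · interval_cases j <;> norm_num
  · have h1 : (3 : ℝ) ≤ N := by exact_mod_cast h3
    nlinarith [sq_nonneg ((2 * j + 1 : ℝ) - N)]

end SpinMatrices

/-! ### Spin operators in the quasi-local algebra -/

section Operators

variable {d : ℕ} (N : ℕ) {Λ Λ₁ Λ₂ : Finset (Site d)}

theorem tensorOp_update_apply (x : Λ) (A : SpinMat N) (σ τ : Λ → Fin (N + 1)) :
    tensorOp N (Function.update (fun _ => 1) x A) σ τ =
      A (σ x) (τ x) * ∏ y ∈ Finset.univ.erase x, (1 : SpinMat N) (σ y) (τ y) := by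
  rw [tensorOp, Matrix.of_apply, ← Finset.mul_prod_erase _ _ (Finset.mem_univ x),
    Function.update_self]
  congr 1
  refine Finset.prod_congr rfl fun y hy => ?_
  rw [Function.update_of_ne (Finset.ne_of_mem_erase hy)]

theorem tensorOp_one : tensorOp N (fun _ : Λ => (1 : SpinMat N)) = 1 := by
  ext σ τ
  simp only [tensorOp, Matrix.of_apply, Matrix.one_apply]
  by_cases h : σ = τ
  · simp [h]
  · rw [if_neg h]
    obtain ⟨y, hy⟩ := Function.ne_iff.1 h
    exact Finset.prod_eq_zero (Finset.mem_univ y) (if_neg hy)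

theorem star_tensorOp (B : Λ → SpinMat N) :
    star (tensorOp N B) = tensorOp N fun x => star (B x) := by
  ext σ τ
  simp [tensorOp, Matrix.star_apply, star_prod]

/-- The inclusion of the algebra of a single site `x ∈ Λ` in `𝔄_Λ`. -/
def siteHom (x : Λ) : SpinMat N →⋆ₐ[ℂ] LocalAlgebra N Λ where
  toFun A := tensorOp N (Function.update (fun _ => 1) x A)
  map_one' := by
    rw [← tensorOp_one]
    congr 1
    exact Function.update_eq_self x _
  map_mul' A B := by
    rw [tensorOp_mul]
    congr 1
    funext y
    by_cases h : y = x
    · subst h; simp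
    · simp [Function.update_of_ne h]
  map_zero' := by
    ext σ τ
    rw [tensorOp_update_apply]
    simp
  map_add' A B := by
    ext σ τ
    rw [Matrix.add_apply]
    simp only [tensorOp_update_apply]
    rw [Matrix.add_apply, add_mul]
  commutes' c := by
    rw [Algebra.algebraMap_eq_smul_one, Algebra.algebraMap_eq_smul_one, ← tensorOp_one]
    ext σ τ
    have h := tensorOp_update_apply N x 1 σ τ
    rw [Function.update_eq_self_iff.2 rfl] at h
    rw [tensorOp_update_apply, Matrix.smul_apply, Matrix.smul_apply, h, smul_eq_mul, smul_eq_mul,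
      mul_assoc]
  map_star' A := by
    rw [star_tensorOp]
    congr 1
    funext y
    by_cases h : y = x
    · subst h; simp
    · simp [Function.update_of_ne h]

theorem spinOp_eq (x : Λ) (i : Ladder) :
    spinOp N x i = siteHom N x (((N : ℂ) / 2)⁻¹ • spinMatrix N i) := rfl

theorem localEmbed_tensorOp (h : Λ₁ ⊆ Λ₂) (B : Λ₁ → SpinMat N) :
    localEmbed h (tensorOp N B) =
      tensorOp N fun y : Λ₂ => if hy : (y : Site d) ∈ Λ₁ then B ⟨y, hy⟩ else 1 := by
  ext σ τ
  rw [localEmbed_apply, tensorOp, tensorOp, Matrix.of_apply, Matrix.of_apply,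
    ← Fintype.prod_subtype_mul_prod_subtype (fun y : Λ₂ => (y : Site d) ∈ Λ₁)]
  have h1 : ∏ y : {y : Λ₂ // (y : Site d) ∈ Λ₁},
      (if hy : (y.1 : Site d) ∈ Λ₁ then B ⟨y.1, hy⟩ else 1) (σ y) (τ y) =
      ∏ x, B x (σ ⟨x, h x.2⟩) (τ ⟨x, h x.2⟩) := by
    let e : {y : Λ₂ // (y : Site d) ∈ Λ₁} ≃ Λ₁ :=
      { toFun := fun y => ⟨y.1, y.2⟩
        invFun := fun x => ⟨⟨x, h x.2⟩, x.2⟩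
        left_inv := fun _ => rfl
        right_inv := fun _ => rfl }
    refine Fintype.prod_equiv e _ _ fun y => ?_
    simp [e, y.2]
  have h2 : ∏ y : {y : Λ₂ // ¬ (y : Site d) ∈ Λ₁},
      (if hy : (y.1 : Site d) ∈ Λ₁ then B ⟨y.1, hy⟩ else 1) (σ y) (τ y) =
      ∏ y : {y : Λ₂ // ¬ (y : Site d) ∈ Λ₁}, if σ y = τ y then (1 : ℂ) else 0 := by
    refine Finset.prod_congr rfl fun y _ => ?_
    rw [dif_neg y.2, Matrix.one_apply]
  rw [h1, h2]
  split_ifs with hσ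
  · have h3 : ∏ y : {y : Λ₂ // ¬ (y : Site d) ∈ Λ₁}, (if σ y = τ y then (1 : ℂ) else 0) = 1 :=
      Finset.prod_eq_one fun y _ => if_pos (hσ y.1 y.2)
    rw [h3, mul_one]
  · push Not at hσ
    obtain ⟨y, hy, hne⟩ := hσ
    rw [Finset.prod_eq_zero (Finset.mem_univ (⟨y, hy⟩ : {y : Λ₂ // ¬ (y : Site d) ∈ Λ₁}))
      (if_neg hne), mul_zero]

theorem localEmbed_spinOp (h : Λ₁ ⊆ Λ₂) (x : Λ₁) (i : Ladder) :
    localEmbed h (spinOp N x i) = spinOp N ⟨x, h x.2⟩ i := by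
  rw [spinOp, spinOp, localEmbed_tensorOp]
  congr 1
  funext y
  by_cases hy : y = ⟨x, h x.2⟩
  · subst hy
    simp
  · rw [Function.update_of_ne hy]
    split_ifs with hy'
    · rw [Function.update_of_ne]
      rintro rfl
      exact hy rfl
    · rfl

theorem norm_ofLocal (A : LocalAlgebra N Λ) : ‖QuasiLocal.ofLocal Λ A‖ = ‖A‖ :=
  (LinearIsometry.norm_map QuasiLocal.ofUnion _).trans (LocalUnion.norm_of Λ A)

theorem ofLocal_localEmbed (h : Λ₁ ⊆ Λ₂) (A : LocalAlgebra N Λ₁) :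
    QuasiLocal.ofLocal Λ₂ (localEmbed h A) = QuasiLocal.ofLocal Λ₁ A :=
  congrArg QuasiLocal.ofUnion (LocalUnion.of_localEmbed h A)

/-- The rescaled spin operator `Ŝ_i(x)` as an element of the quasi-local algebra. -/
def letterOp (p : Site d × Ladder) : QuasiLocal d N :=
  QuasiLocal.ofLocal {p.1} (spinOp N ⟨p.1, Finset.mem_singleton_self _⟩ p.2)

theorem ofLocal_spinOp (x : Λ) (i : Ladder) :
    QuasiLocal.ofLocal Λ (spinOp N x i) = letterOp N ((x : Site d), i) := by
  have h : ({(x : Site d)} : Finset (Site d)) ⊆ Λ := Finset.singleton_subset_iff.2 x.2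
  rw [letterOp, ← ofLocal_localEmbed N h, localEmbed_spinOp]

variable {N}

theorem norm_letterOp_le {R : ℝ} (hN : SpinBound N R) (p : Site d × Ladder) :
    ‖letterOp N p‖ ≤ R := by
  rw [letterOp, norm_ofLocal, spinOp_eq]
  exact (NonUnitalStarAlgHom.norm_apply_le (siteHom N _) _).trans (hN.2 p.2)

theorem commute_letterOp {p q : Site d × Ladder} (h : p.1 ≠ q.1) :
    Commute (letterOp N p) (letterOp N q) := by
  have hp : p.1 ∈ ({p.1, q.1} : Finset (Site d)) := by simp
  have hq : q.1 ∈ ({p.1, q.1} : Finset (Site d)) := by simp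
  have e1 := ofLocal_spinOp N (⟨p.1, hp⟩ : ({p.1, q.1} : Finset (Site d))) p.2
  have e2 := ofLocal_spinOp N (⟨q.1, hq⟩ : ({p.1, q.1} : Finset (Site d))) q.2
  simp only [Prod.mk.eta] at e1 e2
  rw [← e1, ← e2]
  exact (commute_spinOp N (fun e => h (congrArg Subtype.val e)) _ _).map _

/-- The prefactor `s` and one of the two rescalings `s⁻¹` cancel, the other rescales the resulting
letter. No `s` is left in the structure constants, so the equation of motion for words is the same
for all spins. -/
theorem letterOp_commutator (hN : 1 ≤ N) (p q : Site d × Ladder) :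
    (Complex.I * ((N : ℂ) / 2)) • (letterOp N p * letterOp N q - letterOp N q * letterOp N p) =
      exchangeCoeff p q • letterOp N (p.1, p.2.bracket q.2) := by
  obtain ⟨x, i⟩ := p
  obtain ⟨y, j⟩ := q
  by_cases h : x = y
  · subst h
    have hN' : (N : ℂ) / 2 ≠ 0 := by
      have : (N : ℂ) ≠ 0 := by exact_mod_cast (by omega : N ≠ 0)
      exact div_ne_zero this two_ne_zero
    rw [exchangeCoeff, if_pos rfl]
    simp only [letterOp, spinOp_eq, ← map_mul, ← map_sub, ← map_smul]
    congr 2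
    rw [smul_mul_smul_comm, smul_mul_smul_comm, ← smul_sub, commutator_spinMatrix]
    simp only [smul_smul]
    congr 1
    field_simp
  · rw [(commute_letterOp (p := (x, i)) (q := (y, j)) h).eq, sub_self, smul_zero, exchangeCoeff,
      if_neg h, zero_smul]

theorem star_spinOp (x : Λ) (i : Ladder) : star (spinOp N x i) = spinOp N x i.conj := by
  rw [spinOp_eq, spinOp_eq, ← map_star, star_smul, star_spinMatrix]
  congr 2
  simp

variable (N)

/-- The operator of a word. -/
def wordOp (w : Word d) : QuasiLocal d N := (w.map (letterOp N)).prod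

theorem norm_one_quasiLocal : ‖(1 : QuasiLocal d N)‖ = 1 := by
  rw [← map_one (QuasiLocal.ofLocal (∅ : Finset (Site d))), norm_ofLocal]
  exact CStarRing.norm_one

variable {N}

theorem norm_wordOp_le {R : ℝ} (hN : SpinBound N R) (w : Word d) :
    ‖wordOp N w‖ ≤ R ^ w.length := by
  have hR : 0 ≤ R := zero_le_one.trans hN.1
  induction w with
  | nil => simp [wordOp, norm_one_quasiLocal]
  | cons p w ih =>
    rw [List.length_cons, pow_succ', wordOp, List.map_cons, List.prod_cons]
    exact (norm_mul_le _ _).trans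
      (mul_le_mul (norm_letterOp_le hN p) ih (norm_nonneg _) hR)

/-- The Leibniz rule: `x` is moved through the product letter by letter. -/
theorem sum_commutator_prod {α A : Type*} [Ring A] (f : α → A) (x : A) (w : List α) :
    ∑ b : Fin w.length, ((w.take b).map f).prod * (x * f w[b.1] - f w[b.1] * x) *
      ((w.drop (b + 1)).map f).prod = x * (w.map f).prod - (w.map f).prod * x := by
  induction w with
  | nil => simp
  | cons y w ih =>
    refine (Fin.sum_univ_succ (n := w.length) _).trans ?_
    simp only [Fin.val_zero, List.take_zero, List.map_nil, List.prod_nil, one_mul,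
      List.getElem_cons_zero, List.drop_succ_cons, List.drop_zero, Fin.val_succ, List.take_succ_cons,
      List.map_cons, List.prod_cons, List.getElem_cons_succ, zero_add]
    have : ∀ b : Fin w.length, f y * ((w.take b).map f).prod * (x * f w[b.1] - f w[b.1] * x) *
        ((w.drop (b + 1)).map f).prod = f y * (((w.take b).map f).prod *
          (x * f w[b.1] - f w[b.1] * x) * ((w.drop (b + 1)).map f).prod) := fun b => by
      simp only [mul_assoc]
    rw [Finset.sum_congr rfl fun b _ => this b, ← Finset.mul_sum, ih]
    noncomm_ring

/-- The Leibniz rule in both words. The shape of `exchange`, a modified copy of `w` inserted into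
`u`, is exactly the operator ordering this produces. -/
theorem bracketSum_wordOp (hN : 1 ≤ N) (u w : Word d) :
    bracketSum u w (wordOp N) =
      (Complex.I * ((N : ℂ) / 2)) • (wordOp N u * wordOp N w - wordOp N w * wordOp N u) := by
  have h1 : ∀ a : Fin u.length, ∑ b : Fin w.length,
      exchangeCoeff u[a.1] w[b.1] • wordOp N (exchange u w a b) =
      (Complex.I * ((N : ℂ) / 2)) • (wordOp N (u.take a) *
        (letterOp N u[a.1] * wordOp N w - wordOp N w * letterOp N u[a.1]) *
          wordOp N (u.drop (a + 1))) := by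
    intro a
    simp only [wordOp]
    rw [← sum_commutator_prod, Finset.mul_sum, Finset.sum_mul, Finset.smul_sum]
    refine Finset.sum_congr rfl fun b _ => ?_
    simp only [exchange, List.map_append, List.map_cons, List.prod_append, List.prod_cons]
    have key : ∀ (z : ℂ) (A B X C D : QuasiLocal d N),
        z • (A * (B * (X * C)) * D) = A * (B * (z • X * C)) * D := fun z A B X C D => by
      simp only [smul_mul_assoc, mul_smul_comm]
    rw [key, ← letterOp_commutator hN, ← key]
    simp only [mul_assoc]
  rw [bracketSum, Finset.sum_congr rfl fun a _ => h1 a, ← Finset.smul_sum]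
  congr 1
  -- Now `u` is expanded with the operator of `w` as the fixed element, so the commutators come with
  -- the opposite sign.
  have h2 : ∑ a : Fin u.length, wordOp N (u.take a) *
      (wordOp N w * letterOp N u[a.1] - letterOp N u[a.1] * wordOp N w) *
        wordOp N (u.drop (a + 1)) = wordOp N w * wordOp N u - wordOp N u * wordOp N w :=
    sum_commutator_prod (letterOp N) (wordOp N w) u
  rw [← neg_sub, ← h2, ← Finset.sum_neg_distrib]
  refine Finset.sum_congr rfl fun a _ => ?_
  rw [← neg_mul, ← mul_neg, neg_sub]

end Operators

/-! ### Normal-ordered monomials as words, and their adjoints -/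

section NormalOrder

variable {d : ℕ} {N : ℕ} {Λ : Finset (Site d)}

theorem wordOp_append (u w : Word d) : wordOp N (u ++ w) = wordOp N u * wordOp N w := by
  simp [wordOp]

theorem pairwise_commute_letterOp_pow (i : Ladder) (α : MultiIndex d) (s : Set (Site d)) :
    s.Pairwise (Function.onFun Commute fun x => letterOp N (x, i) ^ α (x, i)) :=
  fun x _ y _ h => (commute_letterOp (N := N) (p := (x, i)) (q := (y, i)) h).pow_pow _ _

/-- The order chosen by `toList` is arbitrary, which is harmless since letters at different sites
commute. -/
theorem wordOp_ladderWord (i : Ladder) (α : MultiIndex d) (Λ : Finset (Site d)) :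
    wordOp N (ladderWord i α Λ) = Λ.noncommProd (fun x => letterOp N (x, i) ^ α (x, i))
      (pairwise_commute_letterOp_pow i α _) := by
  have h1 : ∀ l : List (Site d),
      wordOp N (l.flatMap fun x => List.replicate (α (x, i)) (x, i)) =
        (l.map fun x => letterOp N (x, i) ^ α (x, i)).prod := by
    intro l
    induction l with
    | nil => rfl
    | cons x l ih =>
      rw [List.flatMap_cons, wordOp_append, ih, List.map_cons, List.prod_cons]
      simp [wordOp]
  have h2 := Finset.noncommProd_toFinset Λ.toList (fun x => letterOp N (x, i) ^ α (x, i))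
    (pairwise_commute_letterOp_pow i α _) Λ.nodup_toList
  rw [ladderWord, h1, ← h2]
  exact Finset.noncommProd_congr Λ.toList_toFinset (fun _ _ => rfl) _

/-- Sites off the support contribute zeroth powers, so one word per multi-index serves all volumes.
-/
theorem wordOp_ladderWord_of_subset {α : MultiIndex d} (h : sites α ⊆ Λ) (i : Ladder) :
    wordOp N (ladderWord i α Λ) = wordOp N (ladderWord i α (sites α)) := by
  rw [wordOp_ladderWord, wordOp_ladderWord]
  have h1 := Finset.noncommProd_union_of_disjoint (Finset.disjoint_sdiff (s := sites α) (t := Λ))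
    (fun x => letterOp N (x, i) ^ α (x, i)) (pairwise_commute_letterOp_pow i α _)
  rw [Finset.noncommProd_eq_pow_card (Λ \ sites α) _ _ 1, one_pow, mul_one] at h1
  · rw [← h1]
    exact Finset.noncommProd_congr (Finset.union_sdiff_of_subset h).symm (fun _ _ => rfl) _
  · intro x hx
    rw [notMem_sites (Finset.mem_sdiff.1 hx).2, pow_zero]

theorem ofLocal_ladderProd (i : Ladder) (α : MultiIndex d) (Λ : Finset (Site d)) :
    QuasiLocal.ofLocal Λ (ladderProd N i α Λ) = wordOp N (ladderWord i α Λ) := by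
  rw [wordOp_ladderWord]
  refine (Finset.map_noncommProd Finset.univ (fun x : Λ => spinOp N x i ^ α ((x : Site d), i))
    (fun _ _ _ _ h => (commute_spinOp N h i i).pow_pow _ _) (QuasiLocal.ofLocal Λ)).trans ?_
  have hm : (Finset.univ : Finset Λ).val.map
      (fun x : Λ => QuasiLocal.ofLocal Λ (spinOp N x i ^ α ((x : Site d), i))) =
      Λ.val.map fun x => letterOp N (x, i) ^ α (x, i) := by
    have h1 : (Finset.univ : Finset Λ).val.map Subtype.val = Λ.val := Multiset.attach_map_val _
    conv_rhs => rw [← h1, Multiset.map_map]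
    refine Multiset.map_congr rfl fun x _ => ?_
    rw [map_pow, ofLocal_spinOp]
    rfl
  unfold Finset.noncommProd
  congr 1

/-- Every normal-ordered monomial is the operator of its normal word. -/
theorem ofLocal_normalMonomial {α : MultiIndex d} (h : sites α ⊆ Λ) :
    QuasiLocal.ofLocal Λ (normalMonomial N Λ α) = wordOp N (normalWord α) := by
  rw [normalMonomial, map_mul, map_mul, ofLocal_ladderProd, ofLocal_ladderProd,
    ofLocal_ladderProd, normalWord, wordOp_append, wordOp_append]
  simp only [wordOp_ladderWord_of_subset h]

theorem quantize_eq (A : PolyObs d) :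
    quantize N A = ∑ α ∈ A.support, A.coeff α • wordOp N (normalWord α) :=
  Finset.sum_congr rfl fun α _ => by rw [ofLocal_normalMonomial subset_rfl]

theorem Ladder.conj_conj (i : Ladder) : i.conj.conj = i := by cases i <;> rfl

theorem conjIndex_apply (α : MultiIndex d) (x : Site d) (i : Ladder) :
    conjIndex α (x, i) = α (x, i.conj) := by
  have hinj : Function.Injective fun p : Site d × Ladder => (p.1, p.2.conj) := by
    rintro ⟨x, i⟩ ⟨y, j⟩ h
    simp only [Prod.mk.injEq] at h
    rw [h.1, ← i.conj_conj, h.2, Ladder.conj_conj]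
  have := Finsupp.mapDomain_apply hinj α (x, i.conj)
  simpa [conjIndex, Ladder.conj_conj] using this

theorem conjIndex_conjIndex (α : MultiIndex d) : conjIndex (conjIndex α) = α := by
  ext ⟨x, i⟩
  rw [conjIndex_apply, conjIndex_apply, Ladder.conj_conj]

theorem sites_conjIndex_subset (α : MultiIndex d) : sites (conjIndex α) ⊆ sites α := by
  intro x hx
  obtain ⟨⟨y, i⟩, hp, rfl⟩ := Finset.mem_image.1 hx
  rw [Finsupp.mem_support_iff, conjIndex_apply] at hp
  by_contra h
  exact hp (notMem_sites h _)

theorem star_noncommProd {ι A : Type*} [DecidableEq ι] [Monoid A] [StarMul A] (s : Finset ι)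
    (f g : ι → A) (hf : (s : Set ι).Pairwise (Function.onFun Commute f))
    (hg : (s : Set ι).Pairwise (Function.onFun Commute g)) (h : ∀ x ∈ s, star (f x) = g x) :
    star (s.noncommProd f hf) = s.noncommProd g hg := by
  induction s using Finset.induction_on with
  | empty => simp
  | insert a s ha ih =>
    rw [Finset.noncommProd_insert_of_notMem _ _ _ _ ha,
      Finset.noncommProd_insert_of_notMem' _ _ _ _ ha, star_mul,
      ih _ (hg.mono (by simp)) fun x hx => h x (Finset.mem_insert_of_mem hx),
      h a (Finset.mem_insert_self a s)]

theorem star_ladderProd (i : Ladder) (α : MultiIndex d) :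
    star (ladderProd N i α Λ) = ladderProd N i.conj (conjIndex α) Λ :=
  star_noncommProd _ _ _ _ _ fun x _ => by
    rw [star_pow, star_spinOp, conjIndex_apply, Ladder.conj_conj]

/-- The adjoint reverses the order and also exchanges `Ŝ_+` with `Ŝ_-`, so normal order is
preserved. With the reality of `V` this makes the Hamiltonian self-adjoint. -/
theorem star_normalMonomial (α : MultiIndex d) :
    star (normalMonomial N Λ α) = normalMonomial N Λ (conjIndex α) := by
  simp only [normalMonomial, star_mul, star_ladderProd, Ladder.conj, mul_assoc]

end NormalOrder

/-! ### Finite-volume dynamics -/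

section Dynamics

variable {d : ℕ} {N : ℕ} {V : MultiIndex d → ℂ} {Λ : Finset (Site d)} {R r : ℝ}

theorem star_quantumHamiltonian (hV : IsPotential V) (Λ : Finset (Site d)) :
    star (quantumHamiltonian N V Λ) = quantumHamiltonian N V Λ := by
  let e : {α : MultiIndex d // sites α ⊆ Λ} ≃ {α : MultiIndex d // sites α ⊆ Λ} :=
    { toFun := fun α => ⟨conjIndex α.1, (sites_conjIndex_subset α.1).trans α.2⟩
      invFun := fun α => ⟨conjIndex α.1, (sites_conjIndex_subset α.1).trans α.2⟩
      left_inv := fun α => Subtype.ext (conjIndex_conjIndex α.1)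
      right_inv := fun α => Subtype.ext (conjIndex_conjIndex α.1) }
  rw [quantumHamiltonian, tsum_star, ← e.tsum_eq]
  refine tsum_congr fun α => ?_
  rw [star_smul, star_normalMonomial]
  change star (V (conjIndex α.1)) • normalMonomial N Λ (conjIndex (conjIndex α.1)) = _
  rw [hV.conj_eq, conjIndex_conjIndex, Complex.star_def, Complex.conj_conj]

/-- The part of the potential which contributes to the Hamiltonian of `Λ`. -/
def restrictPotential (V : MultiIndex d → ℂ) (Λ : Finset (Site d)) (α : MultiIndex d) : ℂ :=
  if sites α ⊆ Λ then V α else 0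

theorem norm_restrictPotential_le (V : MultiIndex d → ℂ) (Λ : Finset (Site d))
    (α : MultiIndex d) : ‖restrictPotential V Λ α‖ ≤ ‖V α‖ := by
  rw [restrictPotential]
  split_ifs <;> simp

theorem tendsto_restrictPotential (V : MultiIndex d → ℂ) (α : MultiIndex d) :
    Tendsto (fun Λ => restrictPotential V Λ α) atTop (𝓝 (V α)) := by
  refine tendsto_const_nhds.congr' ?_
  filter_upwards [eventually_ge_atTop (sites α)] with Λ hΛ
  exact (if_pos hΛ).symm

theorem majorant_weight_ne_top (h : FlowData V R r) (p : ℕ) :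
    majorant V (weight R 0 0) p ≠ ⊤ := by
  have := iterate_majorant_scaledWeight_ne_top (j := 0) h zero_le_one 1 p
  simpa [scaledWeight, majorant] using this

/-- The norm of `V` controls only multi-indices touching a given site. Within `Λ` every nonzero `α`
touches one of finitely many sites; `α = 0` is invisible to the norm and is added by hand. -/
theorem summable_restrictPotential (h : FlowData V R r) (hN : SpinBound N R)
    (Λ : Finset (Site d)) :
    Summable fun α => ‖restrictPotential V Λ α • wordOp N (normalWord α)‖ := by
  -- A one-letter word at `x` makes the exponent `1 + |α| - 1 = |α|`, the growth of the operator of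
  -- `α`. Its label `z` plays no role.
  refine Summable.of_nonneg_of_le (f := fun α => (if α = 0 then ‖V 0‖ else 0) +
    ∑ x ∈ Λ, (majorantTerm V (weight R 0 0) [(x, .z)] α).toReal) (fun _ => norm_nonneg _)
    (fun α => ?_) ?_
  rotate_left
  · refine (summable_of_ne_finset_zero (s := {0}) fun α hα => ?_).add
      (summable_sum fun x _ => summable_majorantTerm (majorant_weight_ne_top h _))
    rw [if_neg (by simpa using hα)]
  · rw [norm_smul, restrictPotential]
    have hpos : 0 ≤ ∑ x ∈ Λ, (majorantTerm V (weight R 0 0) [(x, .z)] α).toReal :=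
      Finset.sum_nonneg fun _ _ => ENNReal.toReal_nonneg
    split_ifs with hα h0 h0
    · subst h0
      have h1 := norm_wordOp_le hN (normalWord (0 : MultiIndex d))
      rw [length_normalWord, map_zero, pow_zero] at h1
      nlinarith [norm_nonneg (V 0)]
    · rw [zero_add]
      obtain ⟨⟨x, i⟩, hp⟩ := Finsupp.support_nonempty_iff.2 h0
      have hx : x ∈ sites α := Finset.mem_image.2 ⟨_, hp, rfl⟩
      have hd : 1 ≤ siteDegree α x :=
        (Nat.one_le_iff_ne_zero.2 (Finsupp.mem_support_iff.1 hp)).trans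
          (Finset.single_le_sum (f := fun i => α (x, i)) (fun _ _ => Nat.zero_le _)
            (Finset.mem_univ i))
      refine le_trans ?_ (Finset.single_le_sum
        (f := fun x => (majorantTerm V (weight R 0 0) [(x, .z)] α).toReal)
        (fun _ _ => ENNReal.toReal_nonneg) (hα hx))
      have h1 := norm_wordOp_le hN (normalWord α)
      rw [length_normalWord] at h1
      have hd' : (1 : ℝ) ≤ siteDegree α x := by exact_mod_cast hd
      have hR : 0 ≤ R := zero_le_one.trans hN.1
      simp only [majorantTerm, weight, List.length_singleton, Finset.univ_unique,
        Finset.sum_singleton, ENNReal.toReal_mul, toReal_enorm, ENNReal.toReal_natCast]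
      rw [ENNReal.toReal_ofReal (by positivity)]
      refine mul_le_mul_of_nonneg_left ?_ (norm_nonneg _)
      simp only [Fin.default_eq_zero, Fin.val_zero, List.getElem_cons_zero, add_zero, pow_zero,
        one_mul, Nat.add_sub_cancel_left]
      exact h1.trans (le_mul_of_one_le_left (by positivity) hd')
    · rw [norm_zero, zero_mul]; positivity
    · rw [norm_zero, zero_mul]; positivity

/-- The inclusion of `𝔄_Λ` as a continuous linear map. -/
def ofLocalL (N : ℕ) (Λ : Finset (Site d)) : LocalAlgebra N Λ →L[ℂ] QuasiLocal d N :=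
  (QuasiLocal.ofLocal Λ).toLinearMap.mkContinuous 1 fun A => by
    rw [one_mul]
    exact (norm_ofLocal N A).le

/-- Moves the volume from the index set into the potential, so that all Hamiltonians are sums over
the same multi-indices and can be compared by dominated convergence. -/
theorem hasSum_quantumHamiltonian (h : FlowData V R r) (hN : SpinBound N R)
    (Λ : Finset (Site d)) :
    HasSum (fun α => restrictPotential V Λ α • wordOp N (normalWord α))
      (QuasiLocal.ofLocal Λ (quantumHamiltonian N V Λ)) := by
  have hs := summable_restrictPotential h hN Λ
  have hsupp : Function.support (fun α => restrictPotential V Λ α • wordOp N (normalWord α)) ⊆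
      {α | sites α ⊆ Λ} := by
    intro α hα
    by_contra h'
    change ¬ sites α ⊆ Λ at h'
    exact hα (by simp only [restrictPotential, if_neg h', zero_smul])
  have e : ∀ α : {α : MultiIndex d // sites α ⊆ Λ},
      restrictPotential V Λ α.1 • wordOp N (normalWord α.1) =
        QuasiLocal.ofLocal Λ (V α.1 • normalMonomial N Λ α.1) := fun α => by
    rw [restrictPotential, if_pos α.2, map_smul, ofLocal_normalMonomial α.2]
  have hs' : Summable fun α : {α : MultiIndex d // sites α ⊆ Λ} =>
      V α.1 • normalMonomial N Λ α.1 := by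
    refine Summable.of_norm ((hs.comp_injective
      (Subtype.val_injective (p := fun α => sites α ⊆ Λ))).congr fun α => ?_)
    rw [Function.comp_apply, e, norm_ofLocal]
  have h1 := hs'.hasSum.map (QuasiLocal.ofLocal (N := N) Λ) (ofLocalL N Λ).continuous
  rw [← hasSum_subtype_iff_of_support_subset hsupp]
  refine Eq.mp (congrArg (HasSum · _) (funext fun α => (e α).symm)) h1

/-- The generator of the propagator in the quasi-local algebra. -/
def propagatorGenerator (N : ℕ) (V : MultiIndex d → ℂ) (Λ : Finset (Site d)) : QuasiLocal d N :=
  (-(Complex.I * ((N : ℂ) / 2))) • QuasiLocal.ofLocal Λ (quantumHamiltonian N V Λ)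

theorem star_propagatorGenerator (hV : IsPotential V) (Λ : Finset (Site d)) :
    star (propagatorGenerator N V Λ) = -propagatorGenerator N V Λ := by
  rw [propagatorGenerator, star_smul, ← map_star, star_quantumHamiltonian hV, ← neg_smul]
  congr 1
  simp

theorem ofLocal_propagator (t : ℝ) : QuasiLocal.ofLocal Λ (propagator N V Λ t) =
    NormedSpace.exp (t • propagatorGenerator N V Λ) := by
  let := NormedAlgebra.restrictScalars ℚ ℂ (LocalAlgebra N Λ)
  let := NormedAlgebra.restrictScalars ℚ ℂ (QuasiLocal d N)
  have hc : Continuous (QuasiLocal.ofLocal (N := N) Λ) := (ofLocalL N Λ).continuous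
  rw [propagator, NormedSpace.map_exp (QuasiLocal.ofLocal Λ) hc, map_smul, propagatorGenerator]
  congr 1
  rw [← Complex.coe_smul, smul_smul]
  congr 1
  ring

theorem star_exp_propagatorGenerator (hV : IsPotential V) (Λ : Finset (Site d)) (t : ℝ) :
    star (NormedSpace.exp (t • propagatorGenerator N V Λ)) =
      NormedSpace.exp (t • -propagatorGenerator N V Λ) := by
  rw [NormedSpace.star_exp, star_smul, star_propagatorGenerator hV, star_trivial]

theorem exp_mem_unitary (hV : IsPotential V) (Λ : Finset (Site d)) (t : ℝ) :
    NormedSpace.exp (t • propagatorGenerator N V Λ) ∈ unitary (QuasiLocal d N) := by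
  have h1 : Commute (t • -propagatorGenerator N V Λ) (t • propagatorGenerator N V Λ) :=
    (((Commute.refl _).neg_left).smul_left t).smul_right t
  let := NormedAlgebra.restrictScalars ℚ ℂ (QuasiLocal d N)
  constructor
  · rw [star_exp_propagatorGenerator hV, ← NormedSpace.exp_add_of_commute h1]
    simp
  · rw [star_exp_propagatorGenerator hV, ← NormedSpace.exp_add_of_commute h1.symm]
    simp

theorem finiteVolumeEvolution_eq (t : ℝ) (a : QuasiLocal d N) :
    finiteVolumeEvolution N V Λ t a =
      star (NormedSpace.exp (t • propagatorGenerator N V Λ)) * a *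
        NormedSpace.exp (t • propagatorGenerator N V Λ) := by
  rw [finiteVolumeEvolution, ofLocal_propagator]

theorem norm_finiteVolumeEvolution (hV : IsPotential V) (t : ℝ) (a : QuasiLocal d N) :
    ‖finiteVolumeEvolution N V Λ t a‖ = ‖a‖ := by
  rw [finiteVolumeEvolution_eq, CStarRing.norm_mul_mem_unitary _ (exp_mem_unitary hV Λ t),
    CStarRing.norm_mem_unitary_mul _ (Unitary.star_mem (exp_mem_unitary hV Λ t))]

theorem finiteVolumeEvolution_zero (a : QuasiLocal d N) :
    finiteVolumeEvolution N V Λ 0 a = a := by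
  simp [finiteVolumeEvolution_eq]

/-- The finite-volume dynamics as a continuous linear map. -/
def finiteVolumeEvolutionL (N : ℕ) (V : MultiIndex d → ℂ) (Λ : Finset (Site d)) (t : ℝ) :
    QuasiLocal d N →L[ℂ] QuasiLocal d N :=
  ((ContinuousLinearMap.mul ℂ _).flip (QuasiLocal.ofLocal Λ (propagator N V Λ t))).comp
    (ContinuousLinearMap.mul ℂ _ (star (QuasiLocal.ofLocal Λ (propagator N V Λ t))))

theorem finiteVolumeEvolutionL_apply (t : ℝ) (a : QuasiLocal d N) :
    finiteVolumeEvolutionL N V Λ t a = finiteVolumeEvolution N V Λ t a := rfl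

theorem hasDerivAt_finiteVolumeEvolution (hV : IsPotential V) (t : ℝ) (a : QuasiLocal d N) :
    HasDerivAt (fun t => finiteVolumeEvolution N V Λ t a)
      (finiteVolumeEvolution N V Λ t ((Complex.I * ((N : ℂ) / 2)) •
        (QuasiLocal.ofLocal Λ (quantumHamiltonian N V Λ) * a -
          a * QuasiLocal.ofLocal Λ (quantumHamiltonian N V Λ)))) t := by
  have h1 := hasDerivAt_exp_smul_const (𝕂 := ℝ) (-propagatorGenerator N V Λ) t
  have h2 := hasDerivAt_exp_smul_const' (𝕂 := ℝ) (propagatorGenerator N V Λ) t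
  have h3 := (h1.mul_const a).mul h2
  simp only [finiteVolumeEvolution_eq, star_exp_propagatorGenerator hV]
  refine h3.congr_deriv ?_
  have e : (Complex.I * ((N : ℂ) / 2)) • (QuasiLocal.ofLocal Λ (quantumHamiltonian N V Λ) * a -
      a * QuasiLocal.ofLocal Λ (quantumHamiltonian N V Λ)) =
      a * propagatorGenerator N V Λ - propagatorGenerator N V Λ * a := by
    simp only [propagatorGenerator, neg_smul, mul_neg, neg_mul, mul_smul_comm, smul_mul_assoc,
      smul_sub]
    abel
  rw [e]
  noncomm_ring

/-- The commutator with the Hamiltonian is summed term by term through the bounded evolution map,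
and every term is again a combination of evolved words: a closed linear system. -/
theorem hasDerivAt_finiteVolume_wordOp (hV : IsPotential V) (h : FlowData V R r) (hN1 : 1 ≤ N)
    (hN : SpinBound N R) (t : ℝ) (w : Word d) :
    HasDerivAt (fun t => finiteVolumeEvolution N V Λ t (wordOp N w))
      (liouville (restrictPotential V Λ)
        (fun w => finiteVolumeEvolution N V Λ t (wordOp N w)) w) t := by
  refine (hasDerivAt_finiteVolumeEvolution hV t (wordOp N w)).congr_deriv ?_
  have h1 := hasSum_quantumHamiltonian h hN Λ
  have h2 := ((h1.mul_right (wordOp N w)).sub (h1.mul_left (wordOp N w))).const_smul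
    (Complex.I * ((N : ℂ) / 2))
  have h3 := h2.mapL (finiteVolumeEvolutionL N V Λ t)
  rw [← finiteVolumeEvolutionL_apply, ← h3.tsum_eq, liouville]
  refine tsum_congr fun α => ?_
  simp only [← finiteVolumeEvolutionL_apply, bracketSum_map]
  rw [bracketSum_wordOp hN1, ← map_smul]
  congr 1
  rw [smul_mul_assoc, mul_smul_comm, ← smul_sub, smul_comm]

theorem norm_finiteVolume_wordOp_le (hV : IsPotential V) (hN : SpinBound N R) (t : ℝ)
    (w : Word d) : ‖finiteVolumeEvolution N V Λ t (wordOp N w)‖ ≤ R ^ w.length := by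
  rw [norm_finiteVolumeEvolution hV]
  exact norm_wordOp_le hN w

theorem finiteVolume_eq_flow (hV : IsPotential V) (h : FlowData V R r) (hN1 : 1 ≤ N)
    (hN : SpinBound N R) (Λ : Finset (Site d)) (t : ℝ) {τ : ℝ} (hτ : |τ| * potentialNorm V < r)
    (w : Word d) :
    finiteVolumeEvolution N V Λ (t + τ) (wordOp N w) =
      flow (restrictPotential V Λ) τ (fun w => finiteVolumeEvolution N V Λ t (wordOp N w)) w :=
  eq_flow_of_hasDerivAt (φ := fun t w => finiteVolumeEvolution N V Λ t (wordOp N w)) h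
    (norm_restrictPotential_le V Λ) (hasDerivAt_finiteVolume_wordOp hV h hN1 hN)
    (norm_finiteVolume_wordOp_le hV hN) t hτ w

/-! ### Infinite-volume dynamics -/

/-- One time step. In the flow only the restricted potential and the values at time `t` depend on
`Λ`; both converge pointwise, and the limit `Φ` inherits the bound `R^|w|`. -/
theorem tendsto_finiteVolume_add (hV : IsPotential V) (h : FlowData V R r) (hN1 : 1 ≤ N)
    (hN : SpinBound N R) {t : ℝ} {Φ : Word d → QuasiLocal d N}
    (hΦ : ∀ w, Tendsto (fun Λ => finiteVolumeEvolution N V Λ t (wordOp N w)) atTop (𝓝 (Φ w)))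
    {τ : ℝ} (hτ : |τ| * potentialNorm V < r) (w : Word d) :
    Tendsto (fun Λ => finiteVolumeEvolution N V Λ (t + τ) (wordOp N w)) atTop
      (𝓝 (flow V τ Φ w)) := by
  have hb : ∀ (Λ : Finset (Site d)) (w : Word d),
      ‖finiteVolumeEvolution N V Λ t (wordOp N w)‖ ≤ 1 * ((w.length : ℝ) ^ 0 * R ^ w.length) :=
    fun Λ w => by simpa using norm_finiteVolume_wordOp_le hV hN t w
  have h1 := tendsto_flow_sub_flow (j := 0) h (norm_restrictPotential_le V) (fun _ => le_rfl)
    (tendsto_restrictPotential V) zero_le_one (Eventually.of_forall hb)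
    (fun w => le_of_tendsto (hΦ w).norm (Eventually.of_forall fun Λ => hb Λ w)) hΦ
    (σ := fun _ => τ) (Eventually.of_forall fun _ => le_rfl) (abs_nonneg τ) hτ w
  rw [tendsto_sub_nhds_zero_iff] at h1
  simpa only [finiteVolume_eq_flow hV h hN1 hN _ t hτ] using h1

/-- A time step for which the flow converges. -/
theorem exists_step (V : MultiIndex d → ℂ) {r : ℝ} (hr : 0 < r) (t : ℝ) :
    ∃ n : ℕ, 0 < n ∧ |t| / n * potentialNorm V < r := by
  obtain ⟨n, hn⟩ := exists_nat_gt (|t| * potentialNorm V / r)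
  have h0 : 0 ≤ |t| * potentialNorm V / r := by
    have : 0 ≤ potentialNorm V := ENNReal.toReal_nonneg
    positivity
  have hn0 : (0 : ℝ) < n := h0.trans_lt hn
  refine ⟨n, by exact_mod_cast hn0, ?_⟩
  rw [div_lt_iff₀ hr] at hn
  rw [div_mul_eq_mul_div, div_lt_iff₀ hn0]
  linarith

theorem exists_tendsto_wordOp (hV : IsPotential V) (hN1 : 1 ≤ N) (t : ℝ) (w : Word d) :
    ∃ a, Tendsto (fun Λ => finiteVolumeEvolution N V Λ t (wordOp N w)) atTop (𝓝 a) := by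
  have h := FlowData.half hV.norm_lt_top
  have hN := spinBound_half hN1
  obtain ⟨n, hn, ht⟩ := exists_step V h.pos t
  have hn' : (0 : ℝ) < n := by exact_mod_cast hn
  -- All words are treated at once, because a step for `w` uses the limits of words of every length.
  -- The step length stays fixed since the a priori bound holds afresh at each time.
  have key : ∀ k : ℕ, ∀ w, ∃ a,
      Tendsto (fun Λ => finiteVolumeEvolution N V Λ (k * (t / n)) (wordOp N w)) atTop (𝓝 a) := by
    intro k
    induction k with
    | zero => exact fun w => ⟨wordOp N w, by simp [finiteVolumeEvolution_zero]⟩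
    | succ k ih =>
      intro w
      choose Φ hΦ using ih
      have := tendsto_finiteVolume_add hV h hN1 hN hΦ (τ := t / n)
        (by rwa [abs_div, Nat.abs_cast]) w
      rw [← add_one_mul, ← Nat.cast_succ] at this
      exact ⟨_, this⟩
  have := key n w
  rwa [mul_div_cancel₀ _ hn'.ne'] at this

theorem tendsto_wordOp (hV : IsPotential V) (hN1 : 1 ≤ N) (t : ℝ) (w : Word d) :
    Tendsto (fun Λ => finiteVolumeEvolution N V Λ t (wordOp N w)) atTop
      (𝓝 (quantumEvolution N V t (wordOp N w))) :=
  tendsto_nhds_limUnder (exists_tendsto_wordOp hV hN1 t w)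

theorem quantumEvolution_add (hV : IsPotential V) (h : FlowData V R r) (hN1 : 1 ≤ N)
    (hN : SpinBound N R) (t : ℝ) {τ : ℝ} (hτ : |τ| * potentialNorm V < r) (w : Word d) :
    quantumEvolution N V (t + τ) (wordOp N w) =
      flow V τ (fun w => quantumEvolution N V t (wordOp N w)) w :=
  tendsto_nhds_unique (tendsto_wordOp hV hN1 (t + τ) w)
    (tendsto_finiteVolume_add hV h hN1 hN (tendsto_wordOp hV hN1 t) hτ w)

theorem quantumEvolution_zero (w : Word d) :
    quantumEvolution N V 0 (wordOp N w) = wordOp N w :=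
  Tendsto.limUnder_eq (by simp [finiteVolumeEvolution_zero])

theorem norm_quantumEvolution_le (hV : IsPotential V) (hN1 : 1 ≤ N) (hN : SpinBound N R) (t : ℝ)
    (w : Word d) : ‖quantumEvolution N V t (wordOp N w)‖ ≤ R ^ w.length :=
  le_of_tendsto (tendsto_wordOp hV hN1 t w).norm
    (Eventually.of_forall fun _ => norm_finiteVolume_wordOp_le hV hN t w)

theorem tendsto_quantize (hV : IsPotential V) (hN1 : 1 ≤ N) (t : ℝ) (A : PolyObs d) :
    Tendsto (fun Λ => finiteVolumeEvolution N V Λ t (quantize N A)) atTop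
      (𝓝 (∑ α ∈ A.support, A.coeff α • quantumEvolution N V t (wordOp N (normalWord α)))) := by
  simp only [← finiteVolumeEvolutionL_apply, quantize_eq, map_sum, map_smul]
  exact tendsto_finsetSum _ fun α _ => (tendsto_wordOp hV hN1 t _).const_smul _

theorem quantumEvolution_quantize (hV : IsPotential V) (hN1 : 1 ≤ N) (t : ℝ) (A : PolyObs d) :
    quantumEvolution N V t (quantize N A) =
      ∑ α ∈ A.support, A.coeff α • quantumEvolution N V t (wordOp N (normalWord α)) :=
  (tendsto_quantize hV hN1 t A).limUnder_eq

end Dynamics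

/-! ### Ladder coordinates -/

section LadderCoord

theorem ladderCoord_plus (v : Vec3) :
    ladderCoord v .plus = ((v 0 : ℂ) + Complex.I * (v 1 : ℂ)) / (Real.sqrt 2 : ℂ) := rfl

theorem ladderCoord_z (v : Vec3) : ladderCoord v .z = (v 2 : ℂ) := rfl

theorem ladderCoord_minus (v : Vec3) :
    ladderCoord v .minus = ((v 0 : ℂ) - Complex.I * (v 1 : ℂ)) / (Real.sqrt 2 : ℂ) := rfl

theorem sqrt_two_mul_self : (Real.sqrt 2 : ℂ) * (Real.sqrt 2 : ℂ) = 2 := by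
  rw [← Complex.ofReal_mul, Real.mul_self_sqrt (by norm_num)]
  simp

theorem sqrt_two_ne_zero : (Real.sqrt 2 : ℂ) ≠ 0 := by
  intro h
  have := sqrt_two_mul_self
  rw [h] at this
  norm_num at this

theorem star_ladderCoord (v : Vec3) (i : Ladder) :
    star (ladderCoord v i) = ladderCoord v i.conj := by
  cases i <;> simp [ladderCoord, Ladder.conj, sub_eq_add_neg]

theorem norm_sq_vec3 (v : Vec3) : ‖v‖ ^ 2 = v 0 ^ 2 + v 1 ^ 2 + v 2 ^ 2 := by
  rw [EuclideanSpace.norm_sq_eq, Fin.sum_univ_three]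
  simp

theorem sum_ladderCoord_conj_mul (v : Vec3) :
    ∑ i, ladderCoord v i.conj * ladderCoord v i = ((‖v‖ ^ 2 : ℝ) : ℂ) := by
  rw [norm_sq_vec3, Ladder.sum_univ]
  simp only [Ladder.conj, ladderCoord]
  have h := sqrt_two_mul_self
  have h0 := sqrt_two_ne_zero
  push_cast
  field_simp
  rw [sq (Real.sqrt 2 : ℂ), h]
  linear_combination (-2 * (v 1 : ℂ) ^ 2) * Complex.I_sq

theorem norm_ladderCoord_le (v : Vec3) (i : Ladder) : ‖ladderCoord v i‖ ≤ ‖v‖ := by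
  have h1 : ∀ j, ladderCoord v j.conj * ladderCoord v j = ((‖ladderCoord v j‖ ^ 2 : ℝ) : ℂ) := by
    intro j
    rw [← star_ladderCoord, Complex.star_def, Complex.conj_mul']
    push_cast
    rfl
  have h2 := sum_ladderCoord_conj_mul v
  simp only [h1, ← Complex.ofReal_sum] at h2
  have h3 : ∑ j, ‖ladderCoord v j‖ ^ 2 = ‖v‖ ^ 2 := by exact_mod_cast h2
  refine abs_le_of_sq_le_sq' ?_ (norm_nonneg v) |>.2
  rw [← h3]
  exact Finset.single_le_sum (f := fun j => ‖ladderCoord v j‖ ^ 2) (fun _ _ => by positivity)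
    (Finset.mem_univ i)

/-- The value of a word at a configuration. -/
def evalWord {d : ℕ} (m : Site d → Vec3) (w : Word d) : ℂ :=
  (w.map fun p => ladderCoord (m p.1) p.2).prod

theorem evalWord_append {d : ℕ} (m : Site d → Vec3) (u w : Word d) :
    evalWord m (u ++ w) = evalWord m u * evalWord m w := by
  simp [evalWord]

theorem evalWord_cons {d : ℕ} (m : Site d → Vec3) (p : Site d × Ladder) (w : Word d) :
    evalWord m (p :: w) = ladderCoord (m p.1) p.2 * evalWord m w := by
  simp [evalWord]

theorem norm_evalWord_le {d : ℕ} {m : Site d → Vec3} (hm : ∀ x, ‖m x‖ ≤ 1) (w : Word d) :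
    ‖evalWord m w‖ ≤ 1 := by
  induction w with
  | nil => simp [evalWord]
  | cons p w ih =>
    rw [evalWord_cons, norm_mul]
    exact mul_le_one₀ ((norm_ladderCoord_le _ _).trans (hm _)) (norm_nonneg _) ih

theorem evalWord_normalWord {d : ℕ} (m : Site d → Vec3) (α : MultiIndex d) :
    evalWord m (normalWord α) = classicalMonomial m α := by
  rw [evalWord, ← Multiset.prod_coe, ← Multiset.map_coe, coe_normalWord,
    Finset.prod_multiset_map_count, Finsupp.toFinset_toMultiset]
  simp only [Finsupp.count_toMultiset]
  rfl

theorem evalAt_eq {d : ℕ} (A : PolyObs d) (m : Site d → Vec3) :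
    A.evalAt m = ∑ α ∈ A.support, A.coeff α * evalWord m (normalWord α) := by
  rw [PolyObs.evalAt, MvPolynomial.eval_eq]
  refine Finset.sum_congr rfl fun α _ => ?_
  rw [evalWord_normalWord]
  rfl

end LadderCoord

/-! ### Coherent states of a single spin -/

section Coherent

variable (N : ℕ)

/-- The component of the spin in the direction `v`. -/
def spinComponent (v : Vec3) : SpinMat N := ∑ i, ladderCoord v i.conj • spinMatrix N i

/-- The Casimir operator `s(s + 1)`, in ladder components. -/
theorem sum_conj_mul_spinMatrix : ∑ i : Ladder, spinMatrix N i.conj * spinMatrix N i =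
    ((N : ℂ) / 2 * ((N : ℂ) / 2 + 1)) • (1 : SpinMat N) := by
  rw [Ladder.sum_univ]
  simp only [Ladder.conj]
  rw [plus_mul_minus, minus_mul_plus]
  simp only [spinMatrix]
  rw [Matrix.diagonal_mul_diagonal, Matrix.diagonal_add, Matrix.diagonal_add,
    Matrix.smul_one_eq_diagonal]
  congr 1
  funext j
  push_cast
  ring

variable {N}

/-- Commutation with `Y` rotates the plane of `P` and `Z`, so `e^(-θY) (sin θ P + cos θ Z) e^(θY)`
has derivative zero and keeps its value `Z` at `θ = 0`. -/
theorem rotate_spin {Y P Z : SpinMat N} (h1 : P * Y - Y * P = Z) (h2 : Z * Y - Y * Z = -P)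
    (θ : ℝ) :
    (Real.sin θ • P + Real.cos θ • Z) * NormedSpace.exp (θ • Y) = NormedSpace.exp (θ • Y) * Z := by
  let := NormedAlgebra.restrictScalars ℚ ℂ (SpinMat N)
  set F : ℝ → SpinMat N := fun τ =>
    NormedSpace.exp (τ • -Y) * (Real.sin τ • P + Real.cos τ • Z) * NormedSpace.exp (τ • Y) with hF
  have hd : ∀ τ, HasDerivAt F 0 τ := by
    intro τ
    have e1 := hasDerivAt_exp_smul_const (𝕂 := ℝ) (-Y) τ
    have e2 := hasDerivAt_exp_smul_const' (𝕂 := ℝ) Y τ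
    have e3 := ((Real.hasDerivAt_sin τ).smul_const P).add ((Real.hasDerivAt_cos τ).smul_const Z)
    refine ((e1.mul e3).mul e2).congr_deriv ?_
    have e4 : -Y * (Real.sin τ • P + Real.cos τ • Z) + (Real.cos τ • P + -Real.sin τ • Z) +
        (Real.sin τ • P + Real.cos τ • Z) * Y = 0 := by
      have : -Y * (Real.sin τ • P + Real.cos τ • Z) + (Real.cos τ • P + -Real.sin τ • Z) +
        (Real.sin τ • P + Real.cos τ • Z) * Y = Real.sin τ • (P * Y - Y * P) +
          Real.cos τ • (Z * Y - Y * Z) + (Real.cos τ • P + -Real.sin τ • Z) := by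
        simp only [mul_add, add_mul, mul_smul_comm, smul_mul_assoc, neg_mul, smul_sub, smul_neg]
        abel
      rw [this, h1, h2, smul_neg, neg_smul]
      abel
    calc _ = NormedSpace.exp (τ • -Y) * (-Y * (Real.sin τ • P + Real.cos τ • Z) +
          (Real.cos τ • P + -Real.sin τ • Z) + (Real.sin τ • P + Real.cos τ • Z) * Y) *
            NormedSpace.exp (τ • Y) := by
          simp only [Pi.add_apply, Pi.mul_apply]
          noncomm_ring
      _ = 0 := by rw [e4, mul_zero, zero_mul]
  have hconst := is_const_of_deriv_eq_zero (fun τ => (hd τ).differentiableAt)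
    (fun τ => (hd τ).deriv) θ 0
  have hF0 : F 0 = Z := by simp [hF]
  have hinv : NormedSpace.exp (θ • Y) * NormedSpace.exp (θ • -Y) = 1 := by
    rw [← NormedSpace.exp_add_of_commute
      ((((Commute.refl Y).neg_right).smul_left θ).smul_right θ)]
    simp
  rw [hF0] at hconst
  calc _ = NormedSpace.exp (θ • Y) * F θ := by
        simp only [hF, ← mul_assoc]
        rw [hinv, one_mul]
    _ = _ := by rw [hconst]

/-- `sin θ` is the modulus of the horizontal part. At the poles the argument takes its default
value, harmless because `sin θ = 0` there. -/
theorem polar_coordinates {v : Vec3} (hv : ‖v‖ = 1) :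
    Real.cos (Real.arccos (v 2)) = v 2 ∧
    (Real.sin (Real.arccos (v 2)) : ℂ) *
      Complex.exp (Complex.I * (Complex.arg ((v 0 : ℂ) + Complex.I * (v 1 : ℂ)) : ℂ)) =
        (v 0 : ℂ) + Complex.I * (v 1 : ℂ) := by
  have h1 := norm_sq_vec3 v
  rw [hv, one_pow] at h1
  have h2 : |v 2| ≤ 1 := by
    rw [← sq_le_one_iff_abs_le_one]
    nlinarith [sq_nonneg (v 0), sq_nonneg (v 1)]
  refine ⟨Real.cos_arccos (abs_le.1 h2).1 (abs_le.1 h2).2, ?_⟩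
  have h3 : Real.sin (Real.arccos (v 2)) = ‖(v 0 : ℂ) + Complex.I * (v 1 : ℂ)‖ := by
    rw [Real.sin_arccos, mul_comm Complex.I, Complex.norm_add_mul_I]
    congr 1
    linarith
  rw [h3, mul_comm Complex.I (Complex.arg _ : ℂ), Complex.norm_mul_exp_arg_mul_I]

theorem spinComponent_mul_exp {v : Vec3} (hv : ‖v‖ = 1) :
    spinComponent N v * NormedSpace.exp (coherentGenerator N v) =
      NormedSpace.exp (coherentGenerator N v) * spinMatrix N .z := by
  obtain ⟨hc, hs⟩ := polar_coordinates hv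
  set θ := Real.arccos (v 2)
  set e := Complex.exp (Complex.I * (Complex.arg ((v 0 : ℂ) + Complex.I * (v 1 : ℂ)) : ℂ))
    with he
  set f := Complex.exp (-(Complex.I * (Complex.arg ((v 0 : ℂ) + Complex.I * (v 1 : ℂ)) : ℂ)))
    with hf
  have hef : e * f = 1 := by rw [he, hf, ← Complex.exp_add]; simp
  have hfs : (Real.sin θ : ℂ) * f = (v 0 : ℂ) - Complex.I * (v 1 : ℂ) := by
    have := congrArg (starRingEnd ℂ) hs
    rw [map_mul, Complex.conj_ofReal, he, ← Complex.exp_conj] at this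
    simpa [sub_eq_add_neg] using this
  -- `Y` generates the rotation in the plane of the third axis and `v`; `P` is the spin component
  -- along the horizontal direction of `v`.
  set Y : SpinMat N := ((Real.sqrt 2 : ℂ))⁻¹ • (e • spinMatrix N .minus - f • spinMatrix N .plus)
    with hY
  set P : SpinMat N := ((Real.sqrt 2 : ℂ))⁻¹ • (f • spinMatrix N .plus + e • spinMatrix N .minus)
    with hP
  have h2 : ((Real.sqrt 2 : ℂ))⁻¹ * ((Real.sqrt 2 : ℂ))⁻¹ = 2⁻¹ := by
    rw [← mul_inv, sqrt_two_mul_self]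
  have hX : coherentGenerator N v = θ • Y := by
    rw [coherentGenerator, hY, ← Complex.coe_smul, smul_smul]
    congr 1
    push_cast
    rw [div_eq_mul_inv]
  have hPY : P * Y - Y * P = spinMatrix N .z := by
    rw [hP, hY, smul_mul_smul_comm, smul_mul_smul_comm, h2, ← smul_sub,
      ← commutator_plus_minus N]
    have : (f • spinMatrix N .plus + e • spinMatrix N .minus) *
        (e • spinMatrix N .minus - f • spinMatrix N .plus) -
        (e • spinMatrix N .minus - f • spinMatrix N .plus) *
        (f • spinMatrix N .plus + e • spinMatrix N .minus) =
        (2 : ℂ) • ((e * f) • (spinMatrix N .plus * spinMatrix N .minus) -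
          (e * f) • (spinMatrix N .minus * spinMatrix N .plus)) := by
      simp only [add_mul, mul_add, sub_mul, mul_sub, smul_mul_smul_comm]
      rw [mul_comm f e]
      module
    rw [this, hef, one_smul, one_smul, smul_smul]
    norm_num
  have hZY : spinMatrix N .z * Y - Y * spinMatrix N .z = -P := by
    have h3 := commutator_z_plus N
    have h4 := commutator_z_minus N
    have : spinMatrix N .z * Y - Y * spinMatrix N .z = ((Real.sqrt 2 : ℂ))⁻¹ •
        (e • (spinMatrix N .z * spinMatrix N .minus - spinMatrix N .minus * spinMatrix N .z) -
          f • (spinMatrix N .z * spinMatrix N .plus - spinMatrix N .plus * spinMatrix N .z)) := by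
      rw [hY]
      simp only [mul_smul_comm, smul_mul_assoc, mul_sub, sub_mul]
      module
    rw [this, h3, h4, hP]
    module
  have hS : spinComponent N v = Real.sin θ • P + Real.cos θ • spinMatrix N .z := by
    rw [spinComponent, Ladder.sum_univ, hc, hP, ← Complex.coe_smul, ← Complex.coe_smul, smul_smul,
      smul_add, smul_smul, smul_smul]
    simp only [Ladder.conj, ladderCoord]
    have e1 : (Real.sin θ : ℂ) * ((Real.sqrt 2 : ℂ))⁻¹ * f =
        ((v 0 : ℂ) - Complex.I * (v 1 : ℂ)) / (Real.sqrt 2 : ℂ) := by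
      rw [← hfs]; ring
    have e2 : (Real.sin θ : ℂ) * ((Real.sqrt 2 : ℂ))⁻¹ * e =
        ((v 0 : ℂ) + Complex.I * (v 1 : ℂ)) / (Real.sqrt 2 : ℂ) := by
      rw [← hs]; ring
    rw [e1, e2]
    abel
  rw [hS, hX]
  exact rotate_spin hPY hZY θ

/-- The coherent state `|v⟩` is the highest-weight vector in the direction `v`. -/
theorem spinComponent_mulVec_coherentVector {v : Vec3} (hv : ‖v‖ = 1) :
    Matrix.mulVec (spinComponent N v) (coherentVector N v) =
      ((N : ℂ) / 2) • coherentVector N v := by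
  rw [coherentVector, Matrix.mulVec_mulVec, spinComponent_mul_exp hv, ← Matrix.mulVec_mulVec,
    ← Matrix.mulVec_smul]
  congr 1
  funext j
  rw [spinMatrix, Matrix.mulVec_diagonal]
  by_cases h : j = 0
  · subst h; simp
  · simp [h]

theorem sum_norm_sq_coherentVector (v : Vec3) : ∑ k, ‖coherentVector N v k‖ ^ 2 = 1 := by
  have : ((∑ k, ‖coherentVector N v k‖ ^ 2 : ℝ) : ℂ) = 1 := by
    rw [← sum_coherentVector N v, Complex.ofReal_sum]
    refine Finset.sum_congr rfl fun k _ => ?_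
    rw [Complex.star_def, Complex.conj_mul', Complex.ofReal_pow]
  exact_mod_cast this

theorem sum_norm_sq_mulVec {n : Type*} [Fintype n] (B : Matrix n n ℂ) (v : n → ℂ) :
    ((∑ k, ‖Matrix.mulVec B v k‖ ^ 2 : ℝ) : ℂ) =
      dotProduct (star v) (Matrix.mulVec (star B * B) v) := by
  rw [← Matrix.mulVec_mulVec, Matrix.dotProduct_mulVec, Matrix.star_eq_conjTranspose,
    ← Matrix.star_mulVec, dotProduct, Complex.ofReal_sum]
  refine Finset.sum_congr rfl fun k _ => ?_
  rw [Pi.star_apply, Complex.star_def, Complex.conj_mul', Complex.ofReal_pow]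

/-- The fluctuations of the rescaled spin in a coherent state. -/
theorem coherent_fluctuation (hN : 1 ≤ N) {v : Vec3} (hv : ‖v‖ = 1) (i : Ladder) :
    ∑ k, ‖Matrix.mulVec (((N : ℂ) / 2)⁻¹ • spinMatrix N i - ladderCoord v i • (1 : SpinMat N))
      (coherentVector N v) k‖ ^ 2 ≤ 1 / ((N : ℝ) / 2) := by
  set B : Ladder → SpinMat N := fun i =>
    ((N : ℂ) / 2)⁻¹ • spinMatrix N i - ladderCoord v i • (1 : SpinMat N) with hB
  set c := coherentVector N v with hcdef
  have hs0 : (N : ℂ) ≠ 0 := by exact_mod_cast (by omega : N ≠ 0)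
  have hs : (N : ℂ) / 2 ≠ 0 := div_ne_zero hs0 two_ne_zero
  -- All three components are summed: the Casimir operator gives `1 + 1/s`, the length of `v` gives
  -- 1, and the cross terms give `-2/s` times the component along `v`, which equals `s` on the
  -- coherent vector. The total is `1/s`.
  have h1 : ∑ i, star (B i) * B i =
      ((((N : ℂ) / 2)⁻¹) * ((N : ℂ) / 2 + 1) + 1) • (1 : SpinMat N) -
        (2 * ((N : ℂ) / 2)⁻¹) • spinComponent N v := by
    have e1 : ∀ i, star (B i) * B i =
        (((N : ℂ) / 2)⁻¹ * ((N : ℂ) / 2)⁻¹) • (spinMatrix N i.conj * spinMatrix N i) -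
        ((N : ℂ) / 2)⁻¹ • (ladderCoord v i • spinMatrix N i.conj) -
        ((N : ℂ) / 2)⁻¹ • (ladderCoord v i.conj • spinMatrix N i) +
        (ladderCoord v i.conj * ladderCoord v i) • (1 : SpinMat N) := by
      intro i
      have es : star ((N : ℂ) / 2)⁻¹ = ((N : ℂ) / 2)⁻¹ := by simp
      simp only [hB]
      rw [star_sub, star_smul, star_smul, star_spinMatrix, star_ladderCoord, star_one, es]
      simp only [sub_mul, mul_sub, smul_mul_smul_comm, mul_one, one_mul]
      module
    have e2 : ∑ i, ladderCoord v i • spinMatrix N i.conj = spinComponent N v := by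
      rw [spinComponent, Ladder.sum_univ, Ladder.sum_univ]
      simp only [Ladder.conj]
      abel
    rw [Finset.sum_congr rfl fun i _ => e1 i]
    simp only [Finset.sum_add_distrib, Finset.sum_sub_distrib, ← Finset.smul_sum,
      ← Finset.sum_smul]
    rw [sum_conj_mul_spinMatrix, e2, ← spinComponent, sum_ladderCoord_conj_mul, hv, smul_smul]
    have e3 : ((N : ℂ) / 2)⁻¹ * ((N : ℂ) / 2)⁻¹ * ((N : ℂ) / 2 * ((N : ℂ) / 2 + 1)) =
        ((N : ℂ) / 2)⁻¹ * ((N : ℂ) / 2 + 1) := by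
      field_simp
    rw [e3]
    push_cast
    module
  have h2 : ((∑ i, ∑ k, ‖Matrix.mulVec (B i) c k‖ ^ 2 : ℝ) : ℂ) = ((1 / ((N : ℝ) / 2) : ℝ) : ℂ) := by
    rw [Complex.ofReal_sum]
    simp only [sum_norm_sq_mulVec]
    rw [← dotProduct_sum, ← Matrix.sum_mulVec, h1, Matrix.sub_mulVec, Matrix.smul_mulVec,
      Matrix.smul_mulVec, Matrix.one_mulVec, spinComponent_mulVec_coherentVector hv,
      smul_smul, ← sub_smul, dotProduct_smul]
    have h3 : dotProduct (star c) c = 1 := sum_coherentVector N v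
    rw [h3]
    push_cast
    rw [smul_eq_mul]
    field_simp
    ring
  have h3 : ∑ i, ∑ k, ‖Matrix.mulVec (B i) c k‖ ^ 2 = 1 / ((N : ℝ) / 2) := by exact_mod_cast h2
  rw [← h3]
  exact Finset.single_le_sum (f := fun i => ∑ k, ‖Matrix.mulVec (B i) c k‖ ^ 2)
    (fun _ _ => by positivity) (Finset.mem_univ i)

end Coherent

/-! ### Coherent product states -/

section ProductCoherent

variable {d : ℕ} {N : ℕ} {Λ : Finset (Site d)} (m : Site d → Vec3)

theorem tensorOp_mulVec_productVector (B : Λ → SpinMat N) (σ : Λ → Fin (N + 1)) :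
    Matrix.mulVec (tensorOp N B) (productVector N m Λ) σ =
      ∏ x, Matrix.mulVec (B x) (coherentVector N (m x)) (σ x) := by
  simp only [Matrix.mulVec, dotProduct, tensorOp, Matrix.of_apply, productVector,
    ← Finset.prod_mul_distrib]
  rw [Finset.prod_univ_sum, Fintype.piFinset_univ]

/-- The norm of `𝒜 |M_Λ⟩`. -/
def vectorNorm (N : ℕ) (m : Site d → Vec3) (Λ : Finset (Site d)) (A : LocalAlgebra N Λ) : ℝ :=
  ‖(WithLp.toLp 2 (Matrix.mulVec A (productVector N m Λ)) :
    EuclideanSpace ℂ (Λ → Fin (N + 1)))‖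

theorem vectorNorm_add_le (A B : LocalAlgebra N Λ) :
    vectorNorm N m Λ (A + B) ≤ vectorNorm N m Λ A + vectorNorm N m Λ B := by
  rw [vectorNorm, Matrix.add_mulVec, WithLp.toLp_add]
  exact norm_add_le _ _

theorem vectorNorm_smul (c : ℂ) (A : LocalAlgebra N Λ) :
    vectorNorm N m Λ (c • A) = ‖c‖ * vectorNorm N m Λ A := by
  rw [vectorNorm, Matrix.smul_mulVec, WithLp.toLp_smul, norm_smul]
  rfl

theorem vectorNorm_mul_le (A B : LocalAlgebra N Λ) :
    vectorNorm N m Λ (A * B) ≤ ‖A‖ * vectorNorm N m Λ B := by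
  rw [vectorNorm, ← Matrix.mulVec_mulVec]
  have h := Matrix.l2_opNorm_mulVec A (WithLp.toLp 2 (Matrix.mulVec B (productVector N m Λ)) :
    EuclideanSpace ℂ (Λ → Fin (N + 1)))
  exact h

theorem vectorNorm_one : vectorNorm N m Λ 1 = 1 := by
  have h : vectorNorm N m Λ 1 ^ 2 = 1 := by
    rw [vectorNorm, EuclideanSpace.norm_sq_eq, Matrix.one_mulVec]
    have := sum_prod_coherentVector N (fun x : Λ => m x)
    have h2 : ((∑ σ, ‖productVector N m Λ σ‖ ^ 2 : ℝ) : ℂ) = 1 := by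
      rw [← this, Complex.ofReal_sum]
      refine Finset.sum_congr rfl fun σ _ => ?_
      rw [Complex.star_def, Complex.conj_mul', Complex.ofReal_pow]
      rfl
    exact_mod_cast h2
  have h0 : 0 ≤ vectorNorm N m Λ 1 := norm_nonneg _
  nlinarith

theorem norm_localState_le_vectorNorm (A : LocalAlgebra N Λ) :
    ‖localState N m Λ A‖ ≤ vectorNorm N m Λ A := by
  have h4 : localState N m Λ A = inner ℂ
      (WithLp.toLp 2 (productVector N m Λ) : EuclideanSpace ℂ (Λ → Fin (N + 1)))
      (WithLp.toLp 2 (Matrix.mulVec A (productVector N m Λ))) := by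
    rw [EuclideanSpace.inner_eq_star_dotProduct, dotProduct_comm]
    rfl
  have h1 := vectorNorm_one (N := N) (Λ := Λ) m
  rw [vectorNorm, Matrix.one_mulVec] at h1
  rw [h4]
  refine (norm_inner_le_norm _ _).trans_eq ?_
  rw [h1, one_mul]
  rfl

/-- The other factors of the product vector are normalized, so only the site `x` remains. -/
theorem vectorNorm_siteHom_sq (x : Λ) (B : SpinMat N) :
    vectorNorm N m Λ (siteHom N x B) ^ 2 =
      ∑ k, ‖Matrix.mulVec B (coherentVector N (m x)) k‖ ^ 2 := by
  rw [vectorNorm, EuclideanSpace.norm_sq_eq]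
  have h1 : ∀ σ : Λ → Fin (N + 1),
      ‖Matrix.mulVec (siteHom N x B) (productVector N m Λ) σ‖ ^ 2 = ∏ y,
        ‖Matrix.mulVec ((Function.update (fun _ => 1) x B : Λ → SpinMat N) y)
          (coherentVector N (m y)) (σ y)‖ ^ 2 := by
    intro σ
    have := tensorOp_mulVec_productVector m (Function.update (fun _ => 1) x B) σ
    rw [Finset.prod_pow, ← norm_prod, ← this]
    rfl
  have h2 := Finset.prod_univ_sum (fun _ : Λ => (Finset.univ : Finset (Fin (N + 1))))
    (fun y k => ‖Matrix.mulVec ((Function.update (fun _ => 1) x B : Λ → SpinMat N) y)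
          (coherentVector N (m y)) k‖ ^ 2)
  rw [Fintype.piFinset_univ] at h2
  change ∑ σ, ‖Matrix.mulVec (siteHom N x B) (productVector N m Λ) σ‖ ^ 2 = _
  rw [Finset.sum_congr rfl fun σ _ => h1 σ, ← h2, Finset.prod_eq_single x]
  · rw [Function.update_self]
  · intro y _ hy
    rw [Function.update_of_ne hy, Matrix.one_mulVec, sum_norm_sq_coherentVector]
  · simp

theorem vectorNorm_spinOp_sub_le (hN : 1 ≤ N) (x : Λ) (hm : ‖m x‖ = 1) (i : Ladder) :
    vectorNorm N m Λ (spinOp N x i - ladderCoord (m x) i • 1) ≤ 1 / Real.sqrt ((N : ℝ) / 2) := by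
  have h1 : spinOp N x i - ladderCoord (m x) i • 1 = siteHom N x
      (((N : ℂ) / 2)⁻¹ • spinMatrix N i - ladderCoord (m x) i • (1 : SpinMat N)) := by
    rw [map_sub, ← spinOp_eq, map_smul (siteHom N x) (ladderCoord (m x) i), map_one]
  refine abs_le_of_sq_le_sq' ?_ (by positivity) |>.2
  rw [h1, vectorNorm_siteHom_sq, div_pow, one_pow, Real.sq_sqrt (by positivity)]
  exact coherent_fluctuation hN hm i

/-- Letters are replaced by their classical values one at a time, starting next to the vector. The
operators remaining on the left have norm at most one, so each replacement costs `1/√s`, even if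
sites repeat. -/
theorem exists_local_word (hN1 : 1 ≤ N) (hN : SpinBound N 1) (hm : ∀ x, ‖m x‖ = 1) (w : Word d)
    (hw : ∀ p ∈ w, p.1 ∈ Λ) : ∃ A : LocalAlgebra N Λ, QuasiLocal.ofLocal Λ A = wordOp N w ∧
      vectorNorm N m Λ (A - evalWord m w • 1) ≤ w.length * (1 / Real.sqrt ((N : ℝ) / 2)) := by
  induction w with
  | nil => exact ⟨1, by simp [wordOp], by simp [evalWord, vectorNorm]⟩
  | cons p w ih =>
    obtain ⟨A, hA, hA'⟩ := ih fun q hq => hw q (List.mem_cons_of_mem _ hq)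
    have hp := hw p List.mem_cons_self
    refine ⟨spinOp N ⟨p.1, hp⟩ p.2 * A, ?_, ?_⟩
    · rw [map_mul, ofLocal_spinOp, hA]
      simp [wordOp]
    · have e : spinOp N ⟨p.1, hp⟩ p.2 * A - evalWord m (p :: w) • (1 : LocalAlgebra N Λ) =
          spinOp N ⟨p.1, hp⟩ p.2 * (A - evalWord m w • 1) +
            evalWord m w • (spinOp N ⟨p.1, hp⟩ p.2 - ladderCoord (m p.1) p.2 • 1) := by
        rw [evalWord_cons, mul_sub, mul_smul_comm, mul_one, smul_sub, smul_smul,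
          mul_comm (ladderCoord _ _)]
        abel
      rw [e]
      refine (vectorNorm_add_le m _ _).trans ?_
      rw [vectorNorm_smul, List.length_cons]
      have h1 : ‖spinOp N (⟨p.1, hp⟩ : Λ) p.2‖ ≤ 1 := by
        rw [← norm_ofLocal, ofLocal_spinOp]
        exact norm_letterOp_le hN _
      have h2 := (vectorNorm_mul_le m (spinOp N (⟨p.1, hp⟩ : Λ) p.2)
        (A - evalWord m w • 1)).trans (mul_le_of_le_one_left (norm_nonneg _) h1)
      have h3 := vectorNorm_spinOp_sub_le m hN1 (⟨p.1, hp⟩ : Λ) (hm p.1) p.2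
      have h4 := mul_le_mul (norm_evalWord_le (fun x => (hm x).le) w) h3 (norm_nonneg _)
        zero_le_one
      push_cast
      linarith

/-- In coherent states the quantized words have almost classical expectation values. -/
theorem norm_coherentState_wordOp_sub_le (hN1 : 1 ≤ N) (hN : SpinBound N 1)
    (hm : ∀ x, ‖m x‖ = 1) (w : Word d) :
    ‖coherentState N m (wordOp N w) - evalWord m w‖ ≤
      w.length * (1 / Real.sqrt ((N : ℝ) / 2)) := by
  obtain ⟨A, hA, hA'⟩ := exists_local_word (Λ := (w.map Prod.fst).toFinset) m hN1 hN hm w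
    fun p hp => by
      rw [List.mem_toFinset]
      exact List.mem_map_of_mem hp
  have h1 : coherentState N m (1 : QuasiLocal d N) = 1 := by
    rw [← map_one (QuasiLocal.ofLocal (∅ : Finset (Site d))), coherentState_ofLocal, localState,
      Matrix.one_mulVec]
    exact sum_prod_coherentVector N (fun x : (∅ : Finset (Site d)) => m x)
  have h2 : coherentState N m (wordOp N w) - evalWord m w =
      localState N m _ (A - evalWord m w • 1) := by
    rw [← coherentState_ofLocal, map_sub, map_sub, hA, map_smul, map_one, map_smul, h1,
      smul_eq_mul, mul_one]
  rw [h2]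
  exact (norm_localState_le_vectorNorm m _).trans hA'

theorem norm_coherentState_le (a : QuasiLocal d N) : ‖coherentState N m a‖ ≤ ‖a‖ := by
  refine QuasiLocal.induction_on (p := fun a => ‖coherentState N m a‖ ≤ ‖a‖) a
    (isClosed_le (coherentState N m).continuous.norm continuous_norm) fun b => ?_
  obtain ⟨Λ, A, rfl⟩ := LocalUnion.exists_of b
  change ‖coherentState N m (QuasiLocal.ofLocal Λ A)‖ ≤ ‖QuasiLocal.ofLocal Λ A‖
  rw [coherentState_ofLocal, norm_ofLocal]
  exact norm_localState_le N m Λ A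

end ProductCoherent

/-! ### The classical equation of motion in terms of words -/

section ClassicalWords

variable {d : ℕ} {V : MultiIndex d → ℂ} (m : Site d → Vec3)

theorem classicalMonomial_of_coe_eq {w : Word d} {α : MultiIndex d}
    (h : (w : Multiset (Site d × Ladder)) = Finsupp.toMultiset α) :
    evalWord m w = classicalMonomial m α := by
  rw [← evalWord_normalWord, evalWord, evalWord, ← Multiset.prod_coe, ← Multiset.prod_coe,
    ← Multiset.map_coe, ← Multiset.map_coe, h, coe_normalWord]

/-- The removed letter occurs in the word, so the truncated subtraction of multi-indices is a
genuine one. -/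
theorem evalWord_replace (α : MultiIndex d) (a : Fin (normalWord α).length)
    (q : Site d × Ladder) :
    evalWord m ((normalWord α).take a ++ q :: (normalWord α).drop (a + 1)) =
      classicalMonomial m
        (α - Finsupp.single (normalWord α)[a.1] 1 + Finsupp.single q 1) := by
  refine classicalMonomial_of_coe_eq m ?_
  have h1 : (((normalWord α).take a ++ q :: (normalWord α).drop (a + 1) : Word d) :
      Multiset (Site d × Ladder)) = q ::ₘ (normalWord α : Multiset _).erase (normalWord α)[a.1] := by
    rw [Multiset.coe_erase, Multiset.cons_coe, Multiset.coe_eq_coe]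
    refine List.perm_middle.trans (List.Perm.cons q ?_)
    rw [← List.eraseIdx_eq_take_drop_succ]
    exact (@List.erase_getElem _ instBEqOfDecidableEq _ _ _ a.2).symm
  rw [h1, coe_normalWord]
  ext p
  rw [Multiset.count_cons, Finsupp.count_toMultiset, Finsupp.add_apply, Finsupp.tsub_apply,
    Finsupp.single_apply, Finsupp.single_apply]
  by_cases hp : p = (normalWord α)[a.1]
  · rw [hp, Multiset.count_erase_self, Finsupp.count_toMultiset]
    simp [eq_comm]
  · rw [Multiset.count_erase_of_ne hp, Finsupp.count_toMultiset, if_neg (Ne.symm hp)]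
    simp [eq_comm]

theorem bracketSum_singleton (u : Word d) (q : Site d × Ladder) :
    bracketSum u [q] (evalWord m) = ∑ a : Fin u.length, exchangeCoeff u[a.1] q *
      evalWord m (u.take a ++ (u[a.1].1, u[a.1].2.bracket q.2) :: u.drop (a + 1)) := by
  rw [bracketSum]
  refine Finset.sum_congr rfl fun a _ => ?_
  rw [Finset.sum_eq_single (⟨0, by simp⟩ : Fin [q].length)]
  · simp [exchange]
  · intro b _ hb
    exact absurd (Fin.ext (by have := b.2; simp at this ⊢)) hb
  · simp

/-- The sum weighted by `α_j(x)` runs over the positions of the normal word at `x`, and the sum over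
`k` has one nonzero term. -/
theorem hamiltonField_eq (x : Site d) (i : Ladder) :
    hamiltonField V m x i = liouville V (evalWord m) [(x, i)] := by
  refine tsum_congr fun α => ?_
  rw [smul_eq_mul]
  congr 1
  have h1 : ∀ j, ∑ k, Complex.I * epsTilde j i k * (α (x, j) : ℂ) *
      classicalMonomial m (α - Finsupp.single (x, j) 1 + Finsupp.single (x, k) 1) =
      α (x, j) • (Complex.I * epsTilde j i (j.bracket i) * classicalMonomial m
        (α - Finsupp.single (x, j) 1 + Finsupp.single (x, j.bracket i) 1)) := by
    intro j
    have := sum_epsTilde_smul j i fun k => Complex.I * (α (x, j) : ℂ) *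
      classicalMonomial m (α - Finsupp.single (x, j) 1 + Finsupp.single (x, k) 1)
    simp only [smul_eq_mul] at this
    rw [nsmul_eq_mul]
    calc _ = ∑ k, epsTilde j i k * (Complex.I * (α (x, j) : ℂ) *
        classicalMonomial m (α - Finsupp.single (x, j) 1 + Finsupp.single (x, k) 1)) :=
          Finset.sum_congr rfl fun k _ => by ring
      _ = _ := by rw [this]; ring
  rw [Finset.sum_congr rfl fun j _ => h1 j, ← sum_map_normalWord α x, bracketSum_singleton,
    ← Fin.sum_univ_fun_getElem]
  refine Finset.sum_congr rfl fun a _ => ?_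
  rw [evalWord_replace, exchangeCoeff]
  split_ifs with h
  · generalize (normalWord α)[a.1] = p at h ⊢
    obtain ⟨y, j⟩ := p
    simp only at h
    subst h
    rfl
  · rw [zero_mul]

/-- Classical values commute, so the letters of `w` not involved factor out. The bracket is then a
derivation in `w`, and words obey the Liouville equation as soon as single letters do. -/
theorem bracketSum_evalWord (u w : Word d) :
    bracketSum u w (evalWord m) = ∑ b : Fin w.length,
      evalWord m (w.take b) * bracketSum u [w[b.1]] (evalWord m) * evalWord m (w.drop (b + 1)) := by
  simp only [bracketSum_singleton]
  rw [bracketSum, Finset.sum_comm]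
  refine Finset.sum_congr rfl fun b _ => ?_
  rw [Finset.mul_sum, Finset.sum_mul]
  refine Finset.sum_congr rfl fun a _ => ?_
  simp only [exchange, evalWord_append, evalWord_cons, smul_eq_mul]
  ring

variable {m}

theorem norm_evalWord_le' (hm : ∀ x, ‖m x‖ ≤ 1) (w : Word d) :
    ‖evalWord m w‖ ≤ 1 * ((w.length : ℝ) ^ 0 * 1 ^ w.length) := by
  simpa using norm_evalWord_le hm w

theorem summable_evalWord (hV : potentialENorm V < ⊤) (hm : ∀ x, ‖m x‖ ≤ 1) (w : Word d) :
    Summable fun α => V α • bracketSum (normalWord α) w (evalWord m) :=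
  summable_liouville (V := V) (fun _ => le_rfl)
    (fun v => enorm_le_scaledWeight zero_le_one (norm_evalWord_le' hm v))
    (iterate_majorant_scaledWeight_ne_top (FlowData.one hV) zero_le_one 1 w.length)

theorem liouville_evalWord (hV : potentialENorm V < ⊤) (hm : ∀ x, ‖m x‖ ≤ 1) (w : Word d) :
    liouville V (evalWord m) w = ∑ b : Fin w.length,
      evalWord m (w.take b) * liouville V (evalWord m) [w[b.1]] *
        evalWord m (w.drop (b + 1)) := by
  have hs : ∀ b : Fin w.length, Summable fun α => evalWord m (w.take b) *
      (V α • bracketSum (normalWord α) [w[b.1]] (evalWord m)) * evalWord m (w.drop (b + 1)) :=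
    fun b => ((summable_evalWord hV hm _).mul_left _).mul_right _
  simp only [liouville, ← tsum_mul_left, ← tsum_mul_right]
  rw [← Summable.tsum_finsetSum fun b _ => hs b]
  refine tsum_congr fun α => ?_
  rw [bracketSum_evalWord, Finset.smul_sum]
  refine Finset.sum_congr rfl fun b _ => ?_
  simp only [smul_eq_mul]
  ring

theorem hasDerivAt_evalWord_aux {m : ℝ → Site d → Vec3} {D : Site d × Ladder → ℂ} {t : ℝ}
    (h : ∀ p, HasDerivAt (fun τ => ladderCoord (m τ p.1) p.2) (D p) t) (w : Word d) :
    HasDerivAt (fun τ => evalWord (m τ) w) (∑ b : Fin w.length,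
      evalWord (m t) (w.take b) * D w[b.1] * evalWord (m t) (w.drop (b + 1))) t := by
  induction w with
  | nil => simpa [evalWord] using hasDerivAt_const t (1 : ℂ)
  | cons p w ih =>
    simp only [evalWord_cons]
    refine ((h p).mul ih).congr_deriv ?_
    refine Eq.trans ?_ (Fin.sum_univ_succ (n := w.length) _).symm
    simp only [Fin.val_zero, List.take_zero, List.getElem_cons_zero, List.drop_succ_cons,
      List.drop_zero, Fin.val_succ, List.take_succ_cons, List.getElem_cons_succ, zero_add,
      evalWord_cons]
    rw [Finset.mul_sum]
    congr 1
    · simp [evalWord]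
    · refine Finset.sum_congr rfl fun b _ => ?_
      ring

end ClassicalWords

/-! ### Classical solutions -/

section ClassicalEvolution

variable {d : ℕ} {V : MultiIndex d → ℂ} {M₀ : Site d → Metric.sphere (0 : Vec3) 1}
  {M M' : ℝ → lp (fun _ : Site d => Vec3) ∞}

theorem IsHamiltonianEvolution.hasDerivAt_evalWord (hV : potentialENorm V < ⊤)
    (hM : IsHamiltonianEvolution V M₀ M) (t : ℝ) (w : Word d) :
    HasDerivAt (fun t => evalWord (M t) w) (liouville V (evalWord (M t)) w) t := by
  rw [liouville_evalWord hV fun x => (hM.norm_eq_one t x).le]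
  refine hasDerivAt_evalWord_aux (D := fun p => liouville V (evalWord (M t)) [p])
    (fun p => ?_) w
  rw [← hamiltonField_eq]
  exact hM.hasDerivAt t p.1 p.2

theorem IsHamiltonianEvolution.evalWord_add (hV : potentialENorm V < ⊤)
    (hM : IsHamiltonianEvolution V M₀ M) (t : ℝ) {τ : ℝ} (hτ : |τ| * potentialNorm V < 1)
    (w : Word d) : evalWord (M (t + τ)) w = flow V τ (evalWord (M t)) w :=
  eq_flow_of_hasDerivAt (φ := fun t => evalWord (M t)) (FlowData.one hV) (fun _ => le_rfl)
    (hM.hasDerivAt_evalWord hV) (fun t v => by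
      simpa using norm_evalWord_le (fun x => (hM.norm_eq_one t x).le) v) t hτ w

theorem eq_of_ladderCoord_eq {v w : Vec3} (h : ∀ i, ladderCoord v i = ladderCoord w i) :
    v = w := by
  have h2 := sqrt_two_ne_zero
  have hp := h .plus
  have hz := h .z
  rw [ladderCoord_plus, ladderCoord_plus, div_left_inj' h2] at hp
  have h0 := congrArg Complex.re hp
  have h1 := congrArg Complex.im hp
  simp at h0 h1
  rw [ladderCoord_z, ladderCoord_z, Complex.ofReal_inj] at hz
  ext j
  fin_cases j
  · exact h0
  · exact h1
  · exact hz

theorem IsHamiltonianEvolution.unique (hV : potentialENorm V < ⊤)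
    (hM : IsHamiltonianEvolution V M₀ M) (hM' : IsHamiltonianEvolution V M₀ M') : M = M' := by
  funext t
  obtain ⟨n, hn, ht⟩ := exists_step V one_pos t
  have hn' : (0 : ℝ) < n := by exact_mod_cast hn
  have key : ∀ k : ℕ, evalWord (M (k * (t / n))) = evalWord (M' (k * (t / n))) := by
    intro k
    induction k with
    | zero =>
      have : ((M 0 : lp (fun _ : Site d => Vec3) ∞) : Site d → Vec3) = M' 0 := by
        funext x
        rw [hM.initial, hM'.initial]
      simp [this]
    | succ k ih =>
      funext w
      have hτ : |t / n| * potentialNorm V < 1 := by rwa [abs_div, Nat.abs_cast]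
      rw [Nat.cast_succ, add_one_mul, hM.evalWord_add hV _ hτ, hM'.evalWord_add hV _ hτ, ih]
  have h1 := key n
  rw [mul_div_cancel₀ _ hn'.ne'] at h1
  refine lp.ext (funext fun x => eq_of_ladderCoord_eq fun i => ?_)
  simpa [evalWord] using congrFun h1 [(x, i)]

end ClassicalEvolution

/-! ### Global solutions of bounded Lipschitz vector fields -/

/-- As `B` bounds the field everywhere, Picard–Lindelöf applies on each `[-(n+1), n+1]` with a ball
of radius `B (n+1)`; uniqueness glues the solutions. -/
theorem exists_global_solution {E : Type*} [NormedAddCommGroup E] [NormedSpace ℝ E]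
    [CompleteSpace E] {G : E → E} {K B : NNReal} (hG : LipschitzWith K G) (hB : ∀ x, ‖G x‖ ≤ B)
    (x₀ : E) : ∃ f : ℝ → E, f 0 = x₀ ∧ ∀ t, HasDerivAt f (G (f t)) t := by
  have hloc : ∀ n : ℕ, ∃ f : ℝ → E, f 0 = x₀ ∧
      ∀ t ∈ Set.Ioo (-(n + 1 : ℝ)) (n + 1), HasDerivAt f (G (f t)) t := by
    intro n
    have h0 : (0 : ℝ) ∈ Set.Icc (-(n + 1 : ℝ)) (n + 1) := by
      constructor <;> linarith [(Nat.cast_nonneg n : (0 : ℝ) ≤ n)]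
    have hp : IsPicardLindelof (fun _ => G) (⟨0, h0⟩ : Set.Icc (-(n + 1 : ℝ)) (n + 1)) x₀
        (B * (n + 1)) 0 B K :=
      IsPicardLindelof.of_time_independent (fun x _ => hB x) (hG.lipschitzOnWith)
        (by push_cast; simp)
    obtain ⟨f, hf0, hf⟩ := hp.exists_eq_forall_mem_Icc_hasDerivWithinAt₀
    exact ⟨f, hf0, fun t ht =>
      (hf t (Set.Ioo_subset_Icc_self ht)).hasDerivAt (Icc_mem_nhds ht.1 ht.2)⟩
  choose f hf0 hf using hloc
  have heq : ∀ n k : ℕ, n ≤ k → Set.EqOn (f n) (f k) (Set.Ioo (-(n + 1 : ℝ)) (n + 1)) := by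
    intro n k hnk
    have hnk' : (n : ℝ) ≤ k := by exact_mod_cast hnk
    refine ODE_solution_unique_of_mem_Ioo (v := fun _ => G) (s := fun _ => Set.univ) (K := K)
      (t₀ := 0) (fun _ _ => hG.lipschitzOnWith) ?_ (fun t ht => ⟨hf n t ht, trivial⟩)
      (fun t ht => ⟨hf k t ⟨by linarith [ht.1], by linarith [ht.2]⟩, trivial⟩)
      ((hf0 n).trans (hf0 k).symm)
    constructor <;> linarith [(Nat.cast_nonneg n : (0 : ℝ) ≤ n)]
  have hmem : ∀ t : ℝ, t ∈ Set.Ioo (-((⌈|t|⌉₊ : ℝ) + 1)) ((⌈|t|⌉₊ : ℝ) + 1) := fun t => by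
    have h1 := Nat.le_ceil |t|
    have h2 := abs_le.1 (le_refl |t|)
    constructor <;> linarith
  -- The extra 1 in the intervals keeps `t` in the interior, so near `t` the glued function agrees
  -- with a single solution although the index jumps.
  refine ⟨fun t => f ⌈|t|⌉₊ t, by simp [hf0], fun t => ?_⟩
  have h1 : (fun s => f ⌈|s|⌉₊ s) =ᶠ[𝓝 t] f ⌈|t|⌉₊ := by
    filter_upwards [Ioo_mem_nhds (hmem t).1 (hmem t).2] with s hs
    rcases le_total ⌈|s|⌉₊ ⌈|t|⌉₊ with h | h
    · exact heq _ _ h (hmem s)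
    · exact (heq _ _ h hs).symm
  exact (hf _ t (hmem t)).congr_of_eventuallyEq h1

/-! ### Radial projection on the unit ball -/

section UnitBall

variable {E : Type*} [NormedAddCommGroup E] [NormedSpace ℝ E]

/-- The radial projection on the closed unit ball. -/
def unitBallProj (v : E) : E := (max 1 ‖v‖)⁻¹ • v

theorem norm_unitBallProj_le (v : E) : ‖unitBallProj v‖ ≤ 1 := by
  have h : 0 < max 1 ‖v‖ := lt_max_of_lt_left one_pos
  rw [unitBallProj, norm_smul, norm_inv, Real.norm_of_nonneg h.le, inv_mul_le_one₀ h]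
  exact le_max_right _ _

theorem unitBallProj_of_norm_le_one {v : E} (h : ‖v‖ ≤ 1) : unitBallProj v = v := by
  rw [unitBallProj, max_eq_left h, inv_one, one_smul]

theorem smul_unitBallProj (v : E) : (max 1 ‖v‖) • unitBallProj v = v := by
  have h : 0 < max 1 ‖v‖ := lt_max_of_lt_left one_pos
  rw [unitBallProj, smul_smul, mul_inv_cancel₀ h.ne', one_smul]

/-- One `‖v - w‖` accounts for the change of the vector, the other for that of the normalizing
factor. -/
theorem norm_unitBallProj_sub_le (v w : E) :
    ‖unitBallProj v - unitBallProj w‖ ≤ 2 * ‖v - w‖ := by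
  set a := max 1 ‖v‖ with ha
  set b := max 1 ‖w‖ with hb
  have ha1 : 1 ≤ a := le_max_left _ _
  have hb1 : 1 ≤ b := le_max_left _ _
  have hwb : ‖w‖ ≤ b := le_max_right _ _
  have hab : |b - a| ≤ ‖v - w‖ := by
    have h1 := abs_max_sub_max_le_abs ‖w‖ ‖v‖ 1
    rw [max_comm _ (1 : ℝ), max_comm _ (1 : ℝ)] at h1
    exact h1.trans ((abs_norm_sub_norm_le w v).trans_eq (norm_sub_rev w v))
  have e : unitBallProj v - unitBallProj w = a⁻¹ • (v - w) + (a⁻¹ - b⁻¹) • w := by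
    rw [unitBallProj, unitBallProj]
    module
  have e2 : a⁻¹ - b⁻¹ = (b - a) / (a * b) := by
    field_simp
  rw [e, two_mul]
  refine (norm_add_le _ _).trans (add_le_add ?_ ?_)
  · rw [norm_smul, Real.norm_of_nonneg (by positivity)]
    exact mul_le_of_le_one_left (norm_nonneg _) (inv_le_one_of_one_le₀ ha1)
  · rw [norm_smul, e2, norm_div, Real.norm_eq_abs, Real.norm_of_nonneg (by positivity),
      div_mul_eq_mul_div, div_le_iff₀ (by positivity)]
    calc |b - a| * ‖w‖ ≤ ‖v - w‖ * b := by gcongr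
      _ ≤ ‖v - w‖ * (a * b) := by
        gcongr
        exact le_mul_of_one_le_left (by linarith) ha1

end UnitBall

/-! ### The Hamiltonian vector field -/

section VectorField

/-- The vector with ladder coordinates `f`, if these are the coordinates of a real vector. -/
def vecOfLadder (f : Ladder → ℂ) : Vec3 :=
  !₂[Real.sqrt 2 * (f .plus).re, Real.sqrt 2 * (f .plus).im, (f .z).re]

theorem vecOfLadder_zero (f : Ladder → ℂ) : vecOfLadder f 0 = Real.sqrt 2 * (f .plus).re := rfl

theorem vecOfLadder_one (f : Ladder → ℂ) : vecOfLadder f 1 = Real.sqrt 2 * (f .plus).im := rfl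

theorem vecOfLadder_two (f : Ladder → ℂ) : vecOfLadder f 2 = (f .z).re := rfl

theorem ladderCoord_vecOfLadder {f : Ladder → ℂ} (hf : ∀ i, star (f i) = f i.conj) (i : Ladder) :
    ladderCoord (vecOfLadder f) i = f i := by
  have h2 := sqrt_two_ne_zero
  have hm : f .minus = star (f .plus) := (hf .plus).symm
  have hz := hf .z
  cases i
  · rw [ladderCoord_plus, vecOfLadder_zero, vecOfLadder_one, div_eq_iff h2]
    conv_rhs => rw [← Complex.re_add_im (f .plus)]
    push_cast
    ring
  · rw [ladderCoord_z, vecOfLadder_two]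
    exact Complex.conj_eq_iff_re.1 hz
  · have e : star (f .plus) = (f .plus).re - Complex.I * (f .plus).im := by
      apply Complex.ext <;> simp
    rw [ladderCoord_minus, vecOfLadder_zero, vecOfLadder_one, div_eq_iff h2, hm, e]
    push_cast
    ring

theorem norm_vecOfLadder_le {f : Ladder → ℂ} {b : ℝ} (hf : ∀ i, ‖f i‖ ≤ b) :
    ‖vecOfLadder f‖ ≤ 2 * b := by
  have hb : 0 ≤ b := (norm_nonneg _).trans (hf .z)
  refine abs_le_of_sq_le_sq' ?_ (by positivity) |>.2
  rw [norm_sq_vec3, vecOfLadder_zero, vecOfLadder_one, vecOfLadder_two, mul_pow, mul_pow,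
    Real.sq_sqrt (by norm_num)]
  have h1 := Complex.sq_norm (f .plus)
  rw [Complex.normSq_apply] at h1
  have h2 := abs_le.1 ((Complex.abs_re_le_norm (f .z)).trans (hf .z))
  have h3 := hf .plus
  nlinarith [norm_nonneg (f .plus)]

theorem vecOfLadder_sub (f g : Ladder → ℂ) :
    vecOfLadder f - vecOfLadder g = vecOfLadder fun i => f i - g i := by
  ext j
  fin_cases j <;> simp [vecOfLadder] <;> ring

theorem ladderCoord_sub (v w : Vec3) (i : Ladder) :
    ladderCoord (v - w) i = ladderCoord v i - ladderCoord w i := by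
  cases i <;> simp [ladderCoord] <;> ring

theorem hasDerivAt_ladderCoord {f : ℝ → Vec3} {f' : Vec3} {t : ℝ} (h : HasDerivAt f f' t)
    (i : Ladder) : HasDerivAt (fun τ => ladderCoord (f τ) i) (ladderCoord f' i) t := by
  have hc : ∀ j, HasDerivAt (fun τ => ((f τ j : ℝ) : ℂ)) (f' j : ℂ) t := fun j =>
    ((EuclideanSpace.proj (𝕜 := ℝ) j).hasFDerivAt.comp_hasDerivAt t h).ofReal_comp
  cases i
  · exact ((hc 0).add ((hc 1).const_mul Complex.I)).div_const _
  · exact hc 2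
  · exact ((hc 0).sub ((hc 1).const_mul Complex.I)).div_const _

theorem inner_vecOfLadder (v : Vec3) (f : Ladder → ℂ) (hf : ∀ i, star (f i) = f i.conj)
    (h : ∑ i, ladderCoord v i.conj * f i = 0) : inner ℝ v (vecOfLadder f) = 0 := by
  have hm : f .minus = star (f .plus) := (hf .plus).symm
  have h3 : (Real.sqrt 2 : ℂ) * Real.sqrt 2 = 2 := by
    rw [← Complex.ofReal_mul, Real.mul_self_sqrt (by norm_num)]
    norm_num
  have e : star (f .plus) = (f .plus).re - Complex.I * (f .plus).im := by
    apply Complex.ext <;> simp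
  have hz : ((f .z).re : ℂ) = f .z := Complex.conj_eq_iff_re.1 (hf .z)
  have hp := Complex.re_add_im (f .plus)
  rw [Ladder.sum_univ, hm, e, ← hz] at h
  simp only [Ladder.conj, ladderCoord] at h
  rw [PiLp.inner_apply, Fin.sum_univ_three, vecOfLadder_zero, vecOfLadder_one, vecOfLadder_two]
  simp only [RCLike.inner_apply, conj_trivial]
  apply Complex.ofReal_injective
  generalize (f .plus).re = p at *
  generalize (f .plus).im = q at *
  rw [← hp] at h
  rw [Complex.ofReal_zero, ← h]
  have h2 := sqrt_two_ne_zero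
  push_cast
  field_simp
  linear_combination (v 0 * p + v 1 * q : ℂ) * h3 + 2 * (v 1 * q : ℂ) * Complex.I_sq

variable {d : ℕ} {V : MultiIndex d → ℂ} {m m' : Site d → Vec3}

theorem norm_hamiltonField_le (hV : potentialENorm V < ⊤) (hm : ∀ x, ‖m x‖ ≤ 1) (x : Site d)
    (i : Ladder) : ‖hamiltonField V m x i‖ ≤ Real.exp 1 * potentialNorm V := by
  rw [hamiltonField_eq]
  simpa using norm_iterate_liouville_le (FlowData.one hV) (fun _ => le_rfl) zero_le_one
    (norm_evalWord_le' hm) 1 [(x, i)]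

theorem norm_evalWord_sub_le (hm : ∀ x, ‖m x‖ ≤ 1) (hm' : ∀ x, ‖m' x‖ ≤ 1) {δ : ℝ}
    (h : ∀ x, ‖m x - m' x‖ ≤ δ) (w : Word d) :
    ‖evalWord m w - evalWord m' w‖ ≤ δ * w.length := by
  induction w with
  | nil => simp [evalWord]
  | cons p w ih =>
    have e : evalWord m (p :: w) - evalWord m' (p :: w) =
        ladderCoord (m p.1) p.2 * (evalWord m w - evalWord m' w) +
          ladderCoord (m p.1 - m' p.1) p.2 * evalWord m' w := by
      rw [evalWord_cons, evalWord_cons, ladderCoord_sub]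
      ring
    rw [e, List.length_cons]
    refine (norm_add_le _ _).trans ?_
    rw [norm_mul, norm_mul]
    have h1 := mul_le_mul ((norm_ladderCoord_le _ p.2).trans (hm p.1)) ih (norm_nonneg _)
      zero_le_one
    have h2 := mul_le_mul ((norm_ladderCoord_le _ p.2).trans (h p.1)) (norm_evalWord_le hm' w)
      (norm_nonneg _) ((norm_nonneg _).trans (h p.1))
    push_cast
    linarith

/-- Word values are Lipschitz with constant the word length, so their difference has weight `j = 1`;
the factor 2 is `(1 + 1)!`. -/
theorem norm_hamiltonField_sub_le (hV : potentialENorm V < ⊤) (hm : ∀ x, ‖m x‖ ≤ 1)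
    (hm' : ∀ x, ‖m' x‖ ≤ 1) {δ : ℝ} (hδ : 0 ≤ δ) (h : ∀ x, ‖m x - m' x‖ ≤ δ) (x : Site d)
    (i : Ladder) : ‖hamiltonField V m x i - hamiltonField V m' x i‖ ≤
      δ * (2 * Real.exp 1 * potentialNorm V) := by
  have h1 := congrFun (iterate_liouville_sub (V := V) (FlowData.one hV) zero_le_one
    (norm_evalWord_le' hm) (norm_evalWord_le' hm') 1) [(x, i)]
  have h2 := norm_iterate_liouville_le (FlowData.one hV) (V' := V) (j := 1) (fun _ => le_rfl) hδ
    (φ := fun v => evalWord m v - evalWord m' v)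
    (fun v => by simpa using norm_evalWord_sub_le hm hm' h v) 1 [(x, i)]
  rw [h1] at h2
  simp only [Function.iterate_one] at h2
  rw [hamiltonField_eq, hamiltonField_eq]
  refine h2.trans_eq ?_
  simp
  ring

theorem star_classicalMonomial (m : Site d → Vec3) (α : MultiIndex d) :
    star (classicalMonomial m α) = classicalMonomial m (conjIndex α) := by
  have hinj : Function.Injective fun p : Site d × Ladder => (p.1, p.2.conj) := by
    rintro ⟨x, i⟩ ⟨y, j⟩ h
    simp only [Prod.mk.injEq] at h
    rw [h.1, ← i.conj_conj, h.2, Ladder.conj_conj]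
  rw [classicalMonomial, classicalMonomial, conjIndex, Finsupp.prod_mapDomain_index_inj hinj,
    Finsupp.prod, Finsupp.prod, star_prod]
  refine Finset.prod_congr rfl fun p _ => ?_
  rw [star_pow, star_ladderCoord]

/-- The permutation `i ↦ conj i` of the ladder indices. -/
def Ladder.conjEquiv : Ladder ≃ Ladder := ⟨Ladder.conj, Ladder.conj, conj_conj, conj_conj⟩

theorem star_hamiltonField (hV : IsPotential V) (m : Site d → Vec3) (x : Site d) (i : Ladder) :
    star (hamiltonField V m x i) = hamiltonField V m x i.conj := by
  let e : MultiIndex d ≃ MultiIndex d :=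
    ⟨conjIndex, conjIndex, conjIndex_conjIndex, conjIndex_conjIndex⟩
  rw [hamiltonField, tsum_star, hamiltonField]
  refine Eq.trans (tsum_congr fun α => ?_) (e.tsum_eq _)
  have he : e α = conjIndex α := rfl
  rw [he, hV.conj_eq, star_mul', star_sum, ← Ladder.conjEquiv.sum_comp (fun j => ∑ k : Ladder,
    Complex.I * epsTilde j i.conj k * (conjIndex α (x, j) : ℂ) * classicalMonomial m
      (conjIndex α - Finsupp.single (x, j) 1 + Finsupp.single (x, k) 1))]
  congr 1
  refine Finset.sum_congr rfl fun j _ => ?_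
  rw [star_sum, ← Ladder.conjEquiv.sum_comp (fun k =>
    Complex.I * epsTilde (Ladder.conjEquiv j) i.conj k * (conjIndex α (x, Ladder.conjEquiv j) : ℂ) *
      classicalMonomial m (conjIndex α - Finsupp.single (x, Ladder.conjEquiv j) 1 +
        Finsupp.single (x, k) 1))]
  refine Finset.sum_congr rfl fun k _ => ?_
  change _ = Complex.I * epsTilde j.conj i.conj k.conj * (conjIndex α (x, j.conj) : ℂ) *
      classicalMonomial m (conjIndex α - Finsupp.single (x, j.conj) 1 +
        Finsupp.single (x, k.conj) 1)
  have h1 : star (Complex.I * epsTilde j i k) =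
      Complex.I * epsTilde j.conj i.conj k.conj := by
    cases j <;> cases i <;> cases k <;> simp [epsTilde, Ladder.conj]
  have h2 : conjIndex (α - Finsupp.single (x, j) 1 + Finsupp.single (x, k) 1) =
      conjIndex α - Finsupp.single (x, j.conj) 1 + Finsupp.single (x, k.conj) 1 := by
    ext ⟨y, l⟩
    have h3 : ∀ n : Ladder, (x, n) = (y, l.conj) ↔ (x, n.conj) = (y, l) := fun n => by
      cases n <;> cases l <;> simp [Ladder.conj]
    simp only [conjIndex_apply, Finsupp.add_apply, Finsupp.tsub_apply, Finsupp.single_apply, h3]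
  rw [star_mul', star_mul', h1, star_natCast, star_classicalMonomial, h2, conjIndex_apply,
    Ladder.conj_conj]

/-- The spins precess: the vector field at `x` is orthogonal to the spin at `x`. -/
theorem sum_ladderCoord_mul_hamiltonField (hV : potentialENorm V < ⊤) (hm : ∀ x, ‖m x‖ ≤ 1)
    (x : Site d) : ∑ i, ladderCoord (m x) i.conj * hamiltonField V m x i = 0 := by
  simp only [hamiltonField_eq, liouville, ← tsum_mul_left]
  rw [← Summable.tsum_finsetSum fun i _ => (summable_evalWord hV hm _).mul_left _]
  rw [← tsum_zero (β := MultiIndex d) (α := ℂ)]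
  refine tsum_congr fun α => ?_
  have h1 : ∀ i, ladderCoord (m x) i.conj *
      V α • bracketSum (normalWord α) [(x, i)] (evalWord m) =
      V α * ∑ a : Fin (normalWord α).length, evalWord m ((normalWord α).take a) *
        evalWord m ((normalWord α).drop (a + 1)) * (ladderCoord (m x) i.conj *
          (exchangeCoeff (normalWord α)[a.1] (x, i) * ladderCoord (m (normalWord α)[a.1].1)
            ((normalWord α)[a.1].2.bracket i))) := by
    intro i
    rw [bracketSum_singleton, smul_eq_mul, mul_left_comm, Finset.mul_sum]
    congr 1
    refine Finset.sum_congr rfl fun a _ => ?_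
    rw [evalWord_append, evalWord_cons]
    ring
  rw [Finset.sum_congr rfl fun i _ => h1 i, ← Finset.mul_sum, Finset.sum_comm,
    Finset.sum_eq_zero, mul_zero]
  intro a _
  rw [← Finset.mul_sum]
  refine mul_eq_zero_of_right _ ?_
  generalize (normalWord α)[a.1] = p
  obtain ⟨y, j⟩ := p
  simp only [exchangeCoeff]
  -- The sum vanishes for each letter of the word separately: at the site `x` it is a triple product
  -- in which the spin occurs twice.
  by_cases h : y = x
  · subst h
    cases j <;> simp [Ladder.sum_univ, Ladder.conj, Ladder.bracket, epsTilde] <;> ring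
  · simp [h]

/-- The Hamiltonian vector field on the space of bounded configurations, composed with the radial
projection of every spin on the unit ball. -/
def cutoffField (hV : potentialENorm V < ⊤) (m : lp (fun _ : Site d => Vec3) ∞) :
    lp (fun _ : Site d => Vec3) ∞ :=
  ⟨fun x => vecOfLadder (hamiltonField V (fun y => unitBallProj (m y)) x),
    memℓp_infty ⟨2 * (Real.exp 1 * potentialNorm V), by
      rintro _ ⟨x, rfl⟩
      exact norm_vecOfLadder_le fun i =>
        norm_hamiltonField_le hV (fun y => norm_unitBallProj_le _) x i⟩⟩

theorem cutoffField_apply (hV : potentialENorm V < ⊤) (m : lp (fun _ : Site d => Vec3) ∞)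
    (x : Site d) : cutoffField hV m x =
      vecOfLadder (hamiltonField V (fun y => unitBallProj (m y)) x) := rfl

theorem norm_cutoffField_le (hV : potentialENorm V < ⊤) (m : lp (fun _ : Site d => Vec3) ∞) :
    ‖cutoffField hV m‖ ≤ 2 * (Real.exp 1 * potentialNorm V) := by
  have h0 : 0 ≤ potentialNorm V := ENNReal.toReal_nonneg
  refine lp.norm_le_of_forall_le (by positivity) fun x => ?_
  exact norm_vecOfLadder_le fun i =>
    norm_hamiltonField_le hV (fun y => norm_unitBallProj_le _) x i

theorem lipschitz_cutoffField (hV : potentialENorm V < ⊤) :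
    ∃ K : NNReal, LipschitzWith K (cutoffField (d := d) (V := V) hV) := by
  have h0 : 0 ≤ potentialNorm V := ENNReal.toReal_nonneg
  -- `8 = 2 · 2 · 2`: from `vecOfLadder`, from the projection, and from the Lipschitz bound of the
  -- field.
  refine ⟨Real.toNNReal (8 * Real.exp 1 * potentialNorm V), LipschitzWith.of_dist_le_mul ?_⟩
  intro m m'
  rw [dist_eq_norm, dist_eq_norm, Real.coe_toNNReal _ (by positivity)]
  refine lp.norm_le_of_forall_le (by positivity) fun x => ?_
  rw [lp.coeFn_sub, Pi.sub_apply, cutoffField_apply, cutoffField_apply, vecOfLadder_sub]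
  refine (norm_vecOfLadder_le fun i => norm_hamiltonField_sub_le hV
    (fun y => norm_unitBallProj_le _) (fun y => norm_unitBallProj_le _)
    (δ := 2 * ‖m - m'‖) (by positivity) (fun y => ?_) x i).trans_eq (by ring)
  refine (norm_unitBallProj_sub_le _ _).trans ?_
  have := lp.norm_apply_le_norm ENNReal.top_ne_zero (m - m') y
  rw [lp.coeFn_sub, Pi.sub_apply] at this
  linarith

theorem inner_cutoffField (hV : IsPotential V) (m : lp (fun _ : Site d => Vec3) ∞) (x : Site d) :
    inner ℝ (m x) (cutoffField hV.norm_lt_top m x) = 0 := by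
  rw [← smul_unitBallProj (m x), inner_smul_left, cutoffField_apply, inner_vecOfLadder, mul_zero]
  · exact star_hamiltonField hV _ x
  · exact sum_ladderCoord_mul_hamiltonField (m := fun y => unitBallProj (m y)) hV.norm_lt_top
      (fun y => norm_unitBallProj_le _) x

/-- Orthogonality of field and spin holds for the cut-off field too. Every spin thus keeps length
one, where the projection is the identity, so the cut-off solution solves the original equation. -/
theorem exists_hamiltonianEvolution (hV : IsPotential V)
    (M₀ : Site d → Metric.sphere (0 : Vec3) 1) :
    ∃ M : ℝ → lp (fun _ : Site d => Vec3) ∞, IsHamiltonianEvolution V M₀ M := by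
  have h0 : 0 ≤ potentialNorm V := ENNReal.toReal_nonneg
  have hM₀ : ∀ x, ‖(M₀ x : Vec3)‖ = 1 := fun x => by simp
  set m₀ : lp (fun _ : Site d => Vec3) ∞ := ⟨fun x => (M₀ x : Vec3), memℓp_infty ⟨1, by
    rintro _ ⟨x, rfl⟩
    exact (hM₀ x).le⟩⟩ with hm₀
  obtain ⟨K, hK⟩ := lipschitz_cutoffField (V := V) hV.norm_lt_top
  obtain ⟨M, hM0, hM⟩ := exists_global_solution hK
    (B := Real.toNNReal (2 * (Real.exp 1 * potentialNorm V)))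
    (fun m => (norm_cutoffField_le hV.norm_lt_top m).trans (Real.le_coe_toNNReal _)) m₀
  have hx : ∀ t x, HasDerivAt (fun t => M t x) (cutoffField hV.norm_lt_top (M t) x) t :=
    fun t x => (lp.evalCLM ℝ (fun _ : Site d => Vec3) ∞ x).hasFDerivAt.comp_hasDerivAt t (hM t)
  have hnorm : ∀ t x, ‖M t x‖ = 1 := by
    intro t x
    have hd : ∀ t, HasDerivAt (fun t => ‖M t x‖ ^ 2) 0 t := fun t => by
      refine (hx t x).norm_sq.congr_deriv ?_
      rw [inner_cutoffField hV, mul_zero]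
    have h1 := is_const_of_deriv_eq_zero (fun t => (hd t).differentiableAt)
      (fun t => (hd t).deriv) t 0
    have h2 : M 0 x = M₀ x := by rw [hM0]
    simp only [h2, hM₀] at h1
    nlinarith [norm_nonneg (M t x)]
  refine ⟨M, ?_, fun x => by rw [hM0], hnorm, fun t x i => ?_⟩
  · rw [contDiff_one_iff_deriv]
    refine ⟨fun t => (hM t).differentiableAt, ?_⟩
    have : deriv M = fun t => cutoffField hV.norm_lt_top (M t) := funext fun t => (hM t).deriv
    rw [this]
    exact hK.continuous.comp (continuous_iff_continuousAt.2 fun t => (hM t).continuousAt)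
  · have h1 := hasDerivAt_ladderCoord (hx t x) i
    have h2 : (fun y => unitBallProj (M t y)) = M t :=
      funext fun y => unitBallProj_of_norm_le_one (hnorm t y).le
    rwa [cutoffField_apply, h2, ladderCoord_vecOfLadder (star_hamiltonField hV _ x)] at h1

end VectorField

/-! ### The large-spin limit and its rate -/

section ClassicalLimit

variable {d N : ℕ} {V : MultiIndex d → ℂ} {M₀ : Site d → Metric.sphere (0 : Vec3) 1}
  {M : ℝ → lp (fun _ : Site d => Vec3) ∞}

/-- The difference between the quantum and the classical expectation of a word at time `t`. -/
def deviation (V : MultiIndex d → ℂ) (M₀ : Site d → Metric.sphere (0 : Vec3) 1)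
    (M : ℝ → lp (fun _ : Site d => Vec3) ∞) (N : ℕ) (t : ℝ) (w : Word d) : ℂ :=
  coherentState N (fun x => (M₀ x : Vec3)) (quantumEvolution N V t (wordOp N w)) -
    evalWord (M t) w

theorem norm_deviation_le {R : ℝ} (hV : IsPotential V) (hM : IsHamiltonianEvolution V M₀ M)
    (hN1 : 1 ≤ N) (hN : SpinBound N R) (t : ℝ) (w : Word d) :
    ‖deviation V M₀ M N t w‖ ≤ R ^ w.length + 1 :=
  (norm_sub_le _ _).trans (add_le_add
    ((norm_coherentState_le _ _).trans (norm_quantumEvolution_le hV hN1 hN t w))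
    (norm_evalWord_le (fun x => (hM.norm_eq_one t x).le) w))

theorem norm_deviation_zero_le (hM : IsHamiltonianEvolution V M₀ M) (hN1 : 1 ≤ N)
    (hN : SpinBound N 1) (w : Word d) :
    ‖deviation V M₀ M N 0 w‖ ≤ w.length * (1 / Real.sqrt ((N : ℝ) / 2)) := by
  have h : (M 0 : Site d → Vec3) = fun x => (M₀ x : Vec3) := funext hM.initial
  rw [deviation, quantumEvolution_zero, h]
  exact norm_coherentState_wordOp_sub_le _ hN1 hN (fun x => by simp) w

theorem deviation_add (hV : IsPotential V) (hM : IsHamiltonianEvolution V M₀ M) (hN1 : 1 ≤ N)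
    (hN : SpinBound N 1) (t : ℝ) {τ : ℝ} (hτ : |τ| * potentialNorm V < 1) (w : Word d) :
    deviation V M₀ M N (t + τ) w = flow V τ (deviation V M₀ M N t) w := by
  have h := FlowData.one hV.norm_lt_top
  have hq : ∀ v : Word d, ‖quantumEvolution N V t (wordOp N v)‖ ≤
      1 * ((v.length : ℝ) ^ 0 * 1 ^ v.length) := fun v => by
    simpa using norm_quantumEvolution_le hV hN1 hN t v
  have hρ : ∀ v : Word d, ‖coherentState N (fun x => (M₀ x : Vec3))
      (quantumEvolution N V t (wordOp N v))‖ ≤ 1 * ((v.length : ℝ) ^ 0 * 1 ^ v.length) :=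
    fun v => (norm_coherentState_le _ _).trans (hq v)
  have hc : ∀ v : Word d, ‖evalWord (M t) v‖ ≤ 1 * ((v.length : ℝ) ^ 0 * 1 ^ v.length) :=
    fun v => by simpa using norm_evalWord_le (fun x => (hM.norm_eq_one t x).le) v
  rw [deviation, quantumEvolution_add hV h hN1 hN t hτ, hM.evalWord_add hV.norm_lt_top t hτ,
    ← flow_map h (coherentState N fun x => (M₀ x : Vec3)) zero_le_one hq hτ,
    ← flow_sub h zero_le_one hρ hc hτ]
  rfl

theorem sub_evalAt_eq_sum (hV : IsPotential V) (hN1 : 1 ≤ N) (t : ℝ) (A : PolyObs d) :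
    coherentState N (fun x => (M₀ x : Vec3)) (quantumEvolution N V t (quantize N A)) -
        A.evalAt (M t) =
      ∑ α ∈ A.support, A.coeff α * deviation V M₀ M N t (normalWord α) := by
  rw [quantumEvolution_quantize hV hN1, evalAt_eq, map_sum, ← Finset.sum_sub_distrib]
  refine Finset.sum_congr rfl fun α _ => ?_
  rw [map_smul, smul_eq_mul, deviation, mul_sub]

/-- The filter of large spins, uniformly for times in `[a, b]`. -/
def spinTimeFilter (a b : ℝ) : Filter (ℕ × ℝ) := atTop ×ˢ 𝓟 (Set.Icc a b)

theorem eventually_two_le (a b : ℝ) :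
    ∀ᶠ q in spinTimeFilter a b, 2 ≤ q.1 ∧ q.2 ∈ Set.Icc a b :=
  (eventually_ge_atTop 2).prod_mk (eventually_principal.2 fun _ h => h)

/-- Only convergence word by word is passed on from step to step. The quantitative bound grows like
`e^|w|` after one step, too fast to start another, whereas the a priori bound holds at all times. -/
theorem tendsto_deviation_mul (hV : IsPotential V) (hM : IsHamiltonianEvolution V M₀ M)
    (a b : ℝ) {n : ℕ} (hn : 0 < n) (hτ : max |a| |b| / n * potentialNorm V < 1) (k : ℕ)
    (w : Word d) :
    Tendsto (fun q : ℕ × ℝ => deviation V M₀ M q.1 (k * (q.2 / n)) w) (spinTimeFilter a b)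
      (𝓝 0) := by
  have hn' : (0 : ℝ) < n := by exact_mod_cast hn
  have h0 : 0 ≤ potentialNorm V := ENNReal.toReal_nonneg
  have hstep : ∀ q : ℕ × ℝ, q.2 ∈ Set.Icc a b → |q.2 / n| ≤ max |a| |b| / n := fun q hq => by
    rw [abs_div, Nat.abs_cast]
    gcongr
    exact abs_le_max_abs_abs hq.1 hq.2
  induction k generalizing w with
  | zero =>
    simp only [Nat.cast_zero, zero_mul]
    have h1 : Tendsto (fun N : ℕ => (w.length : ℝ) * (1 / Real.sqrt ((N : ℝ) / 2))) atTop
        (𝓝 0) := by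
      have h2 : Tendsto (fun N : ℕ => Real.sqrt ((N : ℝ) / 2)) atTop atTop :=
        Real.tendsto_sqrt_atTop.comp
          ((tendsto_natCast_atTop_atTop (R := ℝ)).atTop_div_const two_pos)
      simpa using (tendsto_inv_atTop_zero.comp h2).const_mul (w.length : ℝ)
    refine squeeze_zero_norm' ?_ (h1.comp tendsto_fst)
    filter_upwards [eventually_two_le a b] with q hq
    exact norm_deviation_zero_le hM (by omega) (spinBound_one hq.1) w
  | succ k ih =>
    -- The comparison function is zero, whose flow vanishes; `c = 2` adds the quantum and the
    -- classical a priori bound.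
    have h1 := tendsto_flow_sub_flow (V' := V) (W := fun _ : ℕ × ℝ => V) (c := 2) (j := 0)
      (φ := fun q => deviation V M₀ M q.1 (k * (q.2 / n))) (φ' := fun _ => 0)
      (σ := fun q => q.2 / n) (ℱ := spinTimeFilter a b)
      (FlowData.one hV.norm_lt_top) (fun _ _ => le_rfl) (fun _ => le_rfl)
      (fun _ => tendsto_const_nhds) two_pos.le
      (by
        filter_upwards [eventually_two_le a b] with q hq v
        have := norm_deviation_le hV hM (by omega) (spinBound_one hq.1) (k * (q.2 / n)) v
        rw [one_pow] at this ⊢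
        linarith)
      (fun v => by simp) ih
      ((eventually_two_le a b).mono fun q hq => hstep q hq.2) (by positivity) hτ w
    simp only [flow_zero, sub_zero] at h1
    refine h1.congr' ?_
    filter_upwards [eventually_two_le a b] with q hq
    rw [← deviation_add hV hM (by omega) (spinBound_one hq.1) _
      ((mul_le_mul_of_nonneg_right (hstep q hq.2) h0).trans_lt hτ)]
    congr 1
    push_cast
    ring

theorem tendsto_deviation (hV : IsPotential V) (hM : IsHamiltonianEvolution V M₀ M)
    (a b : ℝ) (w : Word d) :
    Tendsto (fun q : ℕ × ℝ => deviation V M₀ M q.1 q.2 w) (spinTimeFilter a b) (𝓝 0) := by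
  obtain ⟨n, hn, ht⟩ := exists_step V one_pos (max |a| |b|)
  rw [abs_of_nonneg (le_max_of_le_left (abs_nonneg a))] at ht
  refine (tendsto_deviation_mul hV hM a b hn ht n w).congr fun q => ?_
  have hn' : (n : ℝ) ≠ 0 := by positivity
  rw [mul_div_cancel₀ _ hn']

theorem tendstoUniformlyOn_evalAt (hV : IsPotential V) (hM : IsHamiltonianEvolution V M₀ M)
    (A : PolyObs d) (a b : ℝ) :
    TendstoUniformlyOn
      (fun (N : ℕ) (t : ℝ) => coherentState N (fun x => (M₀ x : Vec3))
        (quantumEvolution N V t (quantize N A)))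
      (fun t => A.evalAt (M t)) atTop (Set.Icc a b) := by
  rw [tendstoUniformlyOn_iff_tendsto, tendsto_uniformity_iff_dist_tendsto_zero]
  have h1 : Tendsto (fun q : ℕ × ℝ => ∑ α ∈ A.support,
      A.coeff α * deviation V M₀ M q.1 q.2 (normalWord α)) (spinTimeFilter a b) (𝓝 0) := by
    have := tendsto_finsetSum A.support fun α _ =>
      (tendsto_deviation hV hM a b (normalWord α)).const_mul (A.coeff α)
    simpa using this
  refine (tendsto_zero_iff_norm_tendsto_zero.1 h1).congr' ?_
  filter_upwards [eventually_two_le a b] with q hq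
  rw [← sub_evalAt_eq_sum hV (by omega), dist_comm, dist_eq_norm]

/-- The constant in the short-time error bound for a word of length `p`. -/
def rateConst (V : MultiIndex d → ℂ) (T : ℝ) (p : ℕ) : ℝ :=
  ((3 / 2 : ℝ) ^ p + 1) + ∑' k, flowBound V 1 1 T 1 p k

theorem norm_deviation_le_rate (hV : IsPotential V) (hM : IsHamiltonianEvolution V M₀ M)
    (hN1 : 1 ≤ N) {t T : ℝ} (ht : |t| ≤ T) (hT : T * potentialNorm V < 1) (w : Word d) :
    ‖deviation V M₀ M N t w‖ ≤ rateConst V T w.length / Real.sqrt ((N : ℝ) / 2) := by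
  have h0 : 0 ≤ potentialNorm V := ENNReal.toReal_nonneg
  have hT0 : 0 ≤ T := (abs_nonneg t).trans ht
  have hN0 : (0 : ℝ) < N := by exact_mod_cast hN1
  have hs : 0 < Real.sqrt ((N : ℝ) / 2) := Real.sqrt_pos.2 (by positivity)
  have hF : 0 ≤ ∑' k, flowBound V 1 1 T 1 w.length k := tsum_nonneg fun k => by
    rw [flowBound]
    positivity
  -- For `s = 1/2` the spins exceed norm one and the flow with `R = r = 1` is not available. A
  -- single value of `s` is absorbed in the constant by the trivial bound, as `√s ≤ 1`.
  obtain rfl | hN2 := hN1.eq_or_lt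
  · refine (norm_deviation_le hV hM le_rfl (spinBound_half le_rfl) t w).trans ?_
    rw [le_div_iff₀ hs, rateConst]
    have h1 : Real.sqrt (((1 : ℕ) : ℝ) / 2) ≤ 1 := Real.sqrt_le_one.2 (by norm_num)
    have h2 : 0 ≤ (3 / 2 : ℝ) ^ w.length + 1 := by positivity
    exact (mul_le_of_le_one_right h2 h1).trans (by linarith)
  · have h1 := deviation_add hV hM hN1 (spinBound_one hN2) 0
      ((mul_le_mul_of_nonneg_right ht h0).trans_lt hT) w
    rw [zero_add] at h1
    rw [h1]
    -- The initial deviation `|w|/√s` means `j = 1` and `c = 1/√s`, and the bound for the flow is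
    -- proportional to `c`.
    refine (norm_flow_le (FlowData.one hV.norm_lt_top) (c := 1 / Real.sqrt ((N : ℝ) / 2)) (j := 1)
      (fun _ => le_rfl) (by positivity) (fun v => ?_) ht hT w).trans ?_
    · rw [one_pow, pow_one, mul_one, mul_comm]
      exact norm_deviation_zero_le hM hN1 (spinBound_one hN2) v
    · have h2 : ∀ k, flowBound V 1 (1 / Real.sqrt ((N : ℝ) / 2)) T 1 w.length k =
          1 / Real.sqrt ((N : ℝ) / 2) * flowBound V 1 1 T 1 w.length k := fun k => by
        simp only [flowBound]
        ring
      rw [tsum_congr h2, tsum_mul_left, one_div_mul_eq_div, rateConst]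
      gcongr
      linarith [show (0 : ℝ) ≤ (3 / 2 : ℝ) ^ w.length + 1 by positivity]

theorem norm_sub_evalAt_le (hV : IsPotential V) (hM : IsHamiltonianEvolution V M₀ M)
    (hN1 : 1 ≤ N) {t T : ℝ} (ht : |t| ≤ T) (hT : T * potentialNorm V < 1) (A : PolyObs d) :
    ‖coherentState N (fun x => (M₀ x : Vec3)) (quantumEvolution N V t (quantize N A)) -
        A.evalAt (M t)‖ ≤
      (∑ α ∈ A.support, ‖A.coeff α‖ * rateConst V T (normalWord α).length) /
        Real.sqrt ((N : ℝ) / 2) := by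
  rw [sub_evalAt_eq_sum hV hN1, Finset.sum_div]
  refine norm_sum_le_of_le _ fun α _ => ?_
  rw [norm_mul, mul_div_assoc]
  exact mul_le_mul_of_nonneg_left (norm_deviation_le_rate hV hM hN1 ht hT _) (norm_nonneg _)

end ClassicalLimit

end SpinSystem

end

theorem mainTheorem3 (d : ℕ) (V : SpinSystem.MultiIndex d → ℂ) (hV : SpinSystem.IsPotential V) :
    -- the infinite-volume quantum dynamics of every quantized observable is a genuine norm limit
    (∀ N : ℕ, 1 ≤ N → ∀ (t : ℝ) (A : SpinSystem.PolyObs d),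
      Tendsto (fun Λ : Finset (SpinSystem.Site d) =>
          SpinSystem.finiteVolumeEvolution N V Λ t (SpinSystem.quantize N A))
        atTop (𝓝 (SpinSystem.quantumEvolution N V t (SpinSystem.quantize N A)))) ∧
    -- the classical evolution exists and is unique
    (∀ M₀ : SpinSystem.Site d → Metric.sphere (0 : SpinSystem.Vec3) 1,
      ∃! M : ℝ → lp (fun _ : SpinSystem.Site d => SpinSystem.Vec3) ∞,
        SpinSystem.IsHamiltonianEvolution V M₀ M) ∧
    -- the large-spin limit `s = N / 2 → ∞`, uniformly on compact time intervals
    (∀ (A : SpinSystem.PolyObs d) (M₀ : SpinSystem.Site d → Metric.sphere (0 : SpinSystem.Vec3) 1)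
      (M : ℝ → lp (fun _ : SpinSystem.Site d => SpinSystem.Vec3) ∞),
      SpinSystem.IsHamiltonianEvolution V M₀ M →
      ∀ a b : ℝ, TendstoUniformlyOn
        (fun (N : ℕ) (t : ℝ) => SpinSystem.coherentState N (fun x => (M₀ x : SpinSystem.Vec3))
          (SpinSystem.quantumEvolution N V t (SpinSystem.quantize N A)))
        (fun t => A.evalAt (M t)) atTop (Set.Icc a b)) ∧
    -- the rate `O(s^{-1/2})` for short times
    (∀ (A : SpinSystem.PolyObs d) (T : ℝ), T * SpinSystem.potentialNorm V < 1 →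
      ∃ C : ℝ, ∀ (M₀ : SpinSystem.Site d → Metric.sphere (0 : SpinSystem.Vec3) 1)
        (M : ℝ → lp (fun _ : SpinSystem.Site d => SpinSystem.Vec3) ∞),
        SpinSystem.IsHamiltonianEvolution V M₀ M →
        ∀ t : ℝ, |t| ≤ T → ∀ N : ℕ, 1 ≤ N →
          ‖SpinSystem.coherentState N (fun x => (M₀ x : SpinSystem.Vec3))
              (SpinSystem.quantumEvolution N V t (SpinSystem.quantize N A)) -
            A.evalAt (M t)‖ ≤ C / Real.sqrt ((N : ℝ) / 2)) := by
  refine ⟨fun N hN t A => ?_, fun M₀ => ?_, fun A M₀ M hM a b => ?_, fun A T hT =>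
    ⟨_, fun M₀ M hM t ht N hN => SpinSystem.norm_sub_evalAt_le hV hM hN ht hT A⟩⟩
  · rw [SpinSystem.quantumEvolution_quantize hV hN]
    exact SpinSystem.tendsto_quantize hV hN t A
  · obtain ⟨M, hM⟩ := SpinSystem.exists_hamiltonianEvolution hV M₀
    exact ⟨M, hM, fun M' hM' => hM'.unique hV.norm_lt_top hM⟩
  · exact SpinSystem.tendstoUniformlyOn_evalAt hV hM A a b
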